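/- **Setting.** Let $\Upsilon=(0,\infty)$, let $D\subseteq\mathbb R^d$ carry its Borel $\sigma$-algebra, and let $\Omega=(\Upsilon^{\mathbb N}\times\Upsilon^{\mathbb N})\times D$ with the product $\sigma$-algebra $\Sigma$ and coordinate maps $W_n$ (interarrival times), $X_n$ (claim sizes), $\Theta$. Put $T_n=\sum_{k\le n}W_k$, $N_t=\#\{n\ge1:T_n\le t\}$, $S_t=\sum_{j=1}^{N_t}X_j$, $V_t=t-T_{N_t}$ (in $S_t$, $V_t$ and in the products below read $N_t$ as $0$ on the null event $\{N_t=\infty\}$), $\mathcal F_t=\sigma(S_s,\,s\le t;\ \Theta)$. Let $\mu$ be a probability measure on $D$, $\mathbf K$ a Markov kernel from $D$ to $\Upsilon$, $R$ a probability measure on $\Upsilon$, $P_\theta=\mathbf K(\theta)^{\otimes\mathbb N}\otimes R^{\otimes\mathbb N}\otimes\delta_\theta$ and $P=\int P_\theta\,\mu(d\theta)$, so that $P_\Theta=\mu$. Let $c:D\to(0,\infty)$ be measurable. For a probability measure $Q$ on $\Sigma$ and a Markov kernel $\mathbf L$ from $D$ to $\Upsilon$, $S$ is a $Q$-CMRP$(\mathbf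 L(\Theta))$ if $X$ is $Q$-i.i.d., the processes $N$ and $X$ are $Q$-independent, $W$ is $Q$-conditionally independent given $\Theta$, and $Q_{W_n\mid\Theta}=\mathbf L(\Theta)$ a.s. for all $n$. $\mathcal M_{S,\mathbf L(\Theta)}$ is the class of probability measures $Q$ such that $W$ and $X$ are $Q$-conditionally independent given $\Theta$, $\Theta$ and $X$ are $Q$-independent, $Q{\restriction}\mathcal F_t\sim P{\restriction}\mathcal F_t$ for all $t\ge0$, and $S$ is a $Q$-CMRP$(\mathbf L(\Theta))$. For fixed $\theta$, $\mathcal M_{S,\mathbf L(\theta)}$ is the class of probability measures $Q_\theta$ with $Q_\theta{\restriction}\mathcal F_t\sim P_\theta{\restriction}\mathcal F_t$ for all $t$ under which $X$ is i.i.d., $N$ and $X$ are independent and $W$ is independent with $(Q_\theta)_{W_n}=\mathbf L(\theta)$ for all $n$. $\mathcal F_{P,\ln}$ is the set of measurable $\gamma:\Upsilon\to\mathbb R$ with $E_P[e^{\gamma(X_1)}]=1$; $\mathcal R_+(D)$ is the set of measurable $\xi:D\to\mathbb R$ with $\xi>0$ $P_\Theta$-a.s. and $E_P[\xi(\Theta)]=1$.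 A regular conditional probability (rcp) of $Q$ over $Q_\Theta$ consistent with $\Theta$ is a measurable family $\{Q_\theta\}_{\theta\in D}$ of probability measures on $\Sigma$ with $Q=\int Q_\theta\,Q_\Theta(d\theta)$ and, for every Borel $B\subseteq D$, $Q_\theta(\Theta\in B)=1$ for $Q_\Theta$-a.e. $\theta\in B$. **Proposition.** Let $r\ge0$ with $m:=E_P[e^{rX_1}]<\infty$. For every $\theta\in D$ there is a unique $\kappa_\theta(r)\in\mathbb R$ with $$E_P[e^{rX_1}]\;E_{P_\theta}\big[e^{-(\kappa_\theta(r)+c(\theta)r)W_1}\big]=1 .$$ Write $s(\theta)=\kappa_\theta(r)+c(\theta)r$ and $\gamma(x)=rx-\ln E_P[e^{rX_1}]$. Let $\rho:D\to\mathbb R^k$ be measurable and let $\mathbf\Lambda$ be a Markov kernel from $\mathbb R^k$ to $\Upsilon$ such that for each Borel $B\subseteq\Upsilon$, $P$-a.s., $$\mathbf\Lambda(\rho(\Theta))(B)=\frac{E_P[\chi_{\{W_1\in B\}}e^{-s(\Theta)W_1}\mid\Theta]}{E_P[e^{-s(\Theta)W_1}\mid\Theta]} .$$ For $\gamma'\in\mathcal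 F_{P,\ln}$ and $\xi'\in\mathcal R_+(D)$ put (with the same symbols for laws on $\Upsilon$ and their distribution functions, and a jointly measurable version of the Radon–Nikodym derivative) $$\widetilde M^{(\gamma')}_t(\theta)=\Big[\prod_{j=1}^{N_t}e^{\gamma'(X_j)}\frac{d\mathbf\Lambda(\rho(\theta))}{d\mathbf K(\theta)}(W_j)\Big]\frac{1-\mathbf\Lambda(\rho(\theta))(V_t)}{1-\mathbf K(\theta)(V_t)},\qquad M^{(\gamma',\xi')}_t(\Theta)=\xi'(\Theta)\,\widetilde M^{(\gamma')}_t(\Theta),$$ and let $(RRM_{\gamma',\xi'})$ denote: $Q(A)=\int_A M_t^{(\gamma',\xi')}(\Theta)\,dP$ for all $0\le u\le t$, $A\in\mathcal F_u$. Below $M_t=M_t^{(\gamma,\xi)}(\Theta)$. 1. Let $Q\in\mathcal M_{S,\mathbf\Lambda(\rho(\Theta))}$ with $Q_{X_1}(B)=E_P[\chi_{\{X_1\in B\}}e^{rX_1}]/E_P[e^{rX_1}]$ for all Borel $B\subseteq\Upsilon$. Then $\gamma\in\mathcal F_{P,\ln}$ and there is $\xi\in\mathcal R_+(D)$, a Radon–Nikodym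 derivative of $Q_\Theta$ with respect to $P_\Theta$, such that $(RRM_{\gamma,\xi})$ holds, $M$ is a $P$-a.s. positive $(\mathcal F_t)$-martingale with mean $1$ under $P$, and $P$-a.s., for all $t\ge0$, $$M_t=\xi(\Theta)\,e^{rS_t-s(\Theta)T_{N_t}+\ln m}\,\frac{\int_{(V_t,\infty)}e^{-s(\Theta)w}\,P_{W_1\mid\Theta}(dw)}{1-\mathbf K(\Theta)(V_t)} .\tag{1}$$ The pair $(\gamma,\xi)$ is essentially unique: if $(\gamma',\xi')\in\mathcal F_{P,\ln}\times\mathcal R_+(D)$ satisfies $(RRM_{\gamma',\xi'})$, then $\gamma'=\gamma$ $P_{X_1}$-a.s. and $\xi'=\xi$ $P_\Theta$-a.s. 2. Conversely, for every $\xi\in\mathcal R_+(D)$: $\gamma\in\mathcal F_{P,\ln}$, there is exactly one probability measure $Q$ on $\Sigma$ satisfying $(RRM_{\gamma,\xi})$, it belongs to $\mathcal M_{S,\mathbf\Lambda(\rho(\Theta))}$, has $Q_{X_1}$ as in 1 and $dQ_\Theta/dP_\Theta=\xi$, and $M$ is a $P$-a.s. positive $(\mathcal F_t)$-martingale with mean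 $1$ fulfilling (1) $P$-a.s. for all $t$. 3. In both cases there are an essentially unique (up to $Q_\Theta$-null sets) rcp $\{Q_\theta\}_{\theta\in D}$ of $Q$ over $Q_\Theta$ consistent with $\Theta$ and a $P_\Theta$-null Borel set $L_{**}\subseteq D$ such that for all $\theta\notin L_{**}$: $Q_\theta\in\mathcal M_{S,\mathbf\Lambda(\rho(\theta))}$; $Q_\theta(A)=\int_A\widetilde M^{(\gamma)}_t(\theta)\,dP_\theta$ for all $0\le u\le t$, $A\in\mathcal F_u$; $\widetilde M^{(\gamma)}(\theta)$ is a $P_\theta$-a.s. positive $(\mathcal F_t)$-martingale with mean $1$ under $P_\theta$; and $P_\theta$-a.s., for all $t$, $$\widetilde M^{(\gamma)}_t(\theta)=e^{rS_t-s(\theta)T_{N_t}+\ln m}\,\frac{\int_{(V_t,\infty)}e^{-s(\theta)w}\,(P_\theta)_{W_1}(dw)}{1-\mathbf K(\theta)(V_t)} .$$ In particular, suppose that $P_{W_1}$ is absolutely continuous with respect to Lebesgue measure. For $u>0$ let $r^u_t(\theta)=u+c(\theta)t-S_t$ and let Schmidli's process be $$L^r_t(\theta)=e^{-r(r^u_t(\theta)-u)}\,e^{-\kappa_\theta(r)t}\,m\,e^{s(\theta)V_t}\,\frac{\int_{(V_t,\infty)}e^{-s(\theta)w}\,(P_\theta)_{W_1}(dw)}{1-(P_\theta)_{W_1}((0,V_t])}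 .$$ Then for every $\theta\notin L_{**}$, $L^r(\theta)$ is a $P_\theta$-a.s. positive $(\mathcal F_t)$-martingale with mean $1$ under $P_\theta$ and, $P_\theta$-a.s., $\widetilde M^{(\gamma)}_t(\theta)=L^r_t(\theta)$ for all $t$; and for every $\xi\in\mathcal R_+(D)$, $P$-a.s., $M_t=\xi(\Theta)\,L^r_t(\Theta)$ for all $t\ge0$. -/

import Mathlib

open MeasureTheory ProbabilityTheory Filter
open scoped NNReal ENNReal

namespace CMRP

/-- The half-line `(0, ∞)`, the value space of interarrival times and claim sizes. -/
abbrev Pos : Type := Set.Ioi (0 : ℝ)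

instance instStandardBorelSpacePos : StandardBorelSpace Pos := measurableSet_Ioi.standardBorel

instance instNonemptyPos : Nonempty Pos := ⟨⟨1, Set.mem_Ioi.2 one_pos⟩⟩

/-- The canonical space `((0,∞)^ℕ × (0,∞)^ℕ) × D`, with its product `σ`-algebra. -/
abbrev Omega (D : Type*) : Type _ := ((ℕ → Pos) × (ℕ → Pos)) × D

section Processes

variable {D : Type*}

/-- Interarrival times; `W n` is the `(n+1)`-st one. -/
def W (n : ℕ) (ω : Omega D) : Pos := ω.1.1 n

/-- Claim sizes; `X n` is the `(n+1)`-st one. -/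
def X (n : ℕ) (ω : Omega D) : Pos := ω.1.2 n

/-- The mixing parameter. -/
def Theta (ω : Omega D) : D := ω.2

/-- Arrival times, `T 0 = 0`. -/
def T (n : ℕ) (ω : Omega D) : ℝ := ∑ k ∈ Finset.range n, (W k ω : ℝ)

/-- The counting process of the arrival times: the number of `n ≥ 1` with `T n ≤ t`. -/
noncomputable def N (t : ℝ≥0) (ω : Omega D) : ℕ∞ := {n : ℕ | T (n + 1) ω ≤ t}.encard

/-- The number of arrivals up to time `t` as a natural number (`0` on the explosion event
`{N t = ∞}`, which is a null event for all the measures considered). -/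
noncomputable def count (t : ℝ≥0) (ω : Omega D) : ℕ := (N t ω).toNat

/-- The aggregate claims process. -/
noncomputable def S (t : ℝ≥0) (ω : Omega D) : ℝ := ∑ k ∈ Finset.range (count t ω), (X k ω : ℝ)

/-- The time elapsed since the last arrival before `t`. -/
noncomputable def V (t : ℝ≥0) (ω : Omega D) : ℝ := t - T (count t ω) ω

/-- The reserve process with initial reserve `u` and premium rate `c`. -/
noncomputable def reserve (u c : ℝ) (t : ℝ≥0) (ω : Omega D) : ℝ := u + c * t - S t ω

/-- The `σ`-algebra generated by `S s`, `s ≤ t`. -/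
@[reducible] noncomputable def sigmaS (D : Type*) (t : ℝ≥0) : MeasurableSpace (Omega D) :=
  ⨆ s : Set.Iic t, MeasurableSpace.comap (S (s : ℝ≥0)) Real.measurableSpace

theorem sigmaS_mono {t t' : ℝ≥0} (h : t ≤ t') : sigmaS D t ≤ sigmaS D t' :=
  iSup_le fun s => le_iSup
    (fun s : Set.Iic t' => MeasurableSpace.comap (S (s : ℝ≥0) : Omega D → ℝ) Real.measurableSpace)
    ⟨s, s.2.trans h⟩

variable [MeasurableSpace D]

theorem measurable_W (k : ℕ) : Measurable (W k : Omega D → Pos) :=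
  (measurable_pi_apply k).comp (measurable_fst.comp measurable_fst)

theorem measurable_X (k : ℕ) : Measurable (X k : Omega D → Pos) :=
  (measurable_pi_apply k).comp (measurable_snd.comp measurable_fst)

theorem measurable_Theta : Measurable (Theta : Omega D → D) := measurable_snd

theorem measurable_T (k : ℕ) : Measurable (T k : Omega D → ℝ) :=
  Finset.measurable_sum _ fun j _ => measurable_subtype_coe.comp (measurable_W j)

theorem measurable_N (t : ℝ≥0) : Measurable (N t : Omega D → ℕ∞) := by
  have h : Measurable fun ω : Omega D => {n : ℕ | T (n + 1) ω ≤ t} := by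
    refine measurable_set_iff.2 fun k => ?_
    exact measurableSet_setOfPred.1 (measurableSet_le (measurable_T (k + 1)) measurable_const)
  exact measurable_encard.comp h

theorem measurable_count (t : ℝ≥0) : Measurable (count t : Omega D → ℕ) :=
  (Measurable.of_discrete (f := ENat.toNat)).comp (measurable_N t)

theorem measurable_S (t : ℝ≥0) : Measurable (S t : Omega D → ℝ) := by
  have h : ∀ m : ℕ, Measurable fun ω : Omega D => ∑ k ∈ Finset.range m, (X k ω : ℝ) := fun m =>
    Finset.measurable_sum _ fun j _ => measurable_subtype_coe.comp (measurable_X j)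
  have h2 : Measurable fun p : ℕ × Omega D => ∑ k ∈ Finset.range p.1, (X k p.2 : ℝ) :=
    measurable_from_prod_countable_right h
  exact h2.comp ((measurable_count t).prodMk measurable_id)

/-- The `σ`-algebra generated by `Θ`. -/
@[reducible] noncomputable def sigmaTheta (D : Type*) [mD : MeasurableSpace D] : MeasurableSpace (Omega D) :=
  MeasurableSpace.comap Theta mD

theorem sigmaS_le (t : ℝ≥0) : sigmaS D t ≤ (inferInstance : MeasurableSpace (Omega D)) :=
  iSup_le fun s => (measurable_S (s : ℝ≥0)).comap_le

/-- The filtration generated by `S` and `Θ`: `F t = σ((S s)_{s ≤ t}, Θ)`. -/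
noncomputable def F (D : Type*) [MeasurableSpace D] :
    Filtration ℝ≥0 (inferInstance : MeasurableSpace (Omega D)) where
  seq t := sigmaS D t ⊔ sigmaTheta D
  mono' _ _ h := sup_le_sup_right (sigmaS_mono h) _
  le' t := sup_le (sigmaS_le t) measurable_Theta.comap_le

end Processes

section Measures

variable {D : Type*} [MeasurableSpace D]

/-- `P_θ = K(θ)^ℕ ⊗ R^ℕ ⊗ δ_θ`. -/
noncomputable def condP (K : Kernel D Pos) [IsMarkovKernel K] (R : Measure Pos)
    [IsProbabilityMeasure R] (θ : D) : Measure (Omega D) :=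
  ((Measure.infinitePi fun _ : ℕ => K θ).prod (Measure.infinitePi fun _ : ℕ => R)).prod
    (Measure.dirac θ)

/-- The mixture `P = ∫ P_θ μ(dθ)`. -/
noncomputable def mixP (μ : Measure D) (K : Kernel D Pos) [IsMarkovKernel K] (R : Measure Pos)
    [IsProbabilityMeasure R] : Measure (Omega D) :=
  μ.bind (condP K R)

instance instIsProbabilityMeasureCondP (K : Kernel D Pos) [IsMarkovKernel K] (R : Measure Pos)
    [IsProbabilityMeasure R] (θ : D) : IsProbabilityMeasure (condP K R θ) := by
  unfold condP; infer_instance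

theorem measurable_infinitePi (K : Kernel D Pos) [IsMarkovKernel K] :
    Measurable fun θ => Measure.infinitePi fun _ : ℕ => K θ := by
  refine Measurable.measure_of_isPiSystem_of_isProbabilityMeasure
    (generateFrom_squareCylinders (α := fun _ : ℕ => Pos)).symm
    (isPiSystem_squareCylinders (fun _ => MeasurableSpace.isPiSystem_measurableSet) (by simp)) ?_
  rintro _ ⟨s, t, ht, rfl⟩
  have h : (fun θ => (Measure.infinitePi fun _ : ℕ => K θ) ((s : Set ℕ).pi t)) =
      fun θ => ∏ i ∈ s, K θ (t i) := by
    funext θ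
    exact Measure.infinitePi_pi _ fun i _ => ht i (Set.mem_univ i)
  rw [h]
  exact Finset.measurable_prod _ fun i _ => K.measurable_coe (ht i (Set.mem_univ i))

theorem measurable_condP (K : Kernel D Pos) [IsMarkovKernel K] (R : Measure Pos)
    [IsProbabilityMeasure R] : Measurable (condP K R) := by
  let k1 : Kernel D (ℕ → Pos) := ⟨_, measurable_infinitePi K⟩
  have : IsMarkovKernel k1 := ⟨fun θ => by
    change IsProbabilityMeasure (Measure.infinitePi fun _ : ℕ => K θ); infer_instance⟩
  let k : Kernel D (Omega D) :=
    (k1 ×ₖ Kernel.const D (Measure.infinitePi fun _ : ℕ => R)) ×ₖ Kernel.id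
  have h : condP K R = k := by
    funext θ
    simp only [k, Kernel.prod_apply, Kernel.const_apply, Kernel.id_apply]
    rfl
  rw [h]
  exact k.measurable

instance instIsProbabilityMeasureMixP (μ : Measure D) [IsProbabilityMeasure μ] (K : Kernel D Pos)
    [IsMarkovKernel K] (R : Measure Pos) [IsProbabilityMeasure R] :
    IsProbabilityMeasure (mixP μ K R) := by
  constructor
  rw [mixP, Measure.bind_apply MeasurableSet.univ (measurable_condP K R).aemeasurable]
  simp

end Measures

section Structure

variable {D : Type*} [MeasurableSpace D]

/-- The process `Y` is conditionally independent over `σ(Θ)` under `Q`. -/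
def CondIndepSeq (Q : Measure (Omega D)) (Y : ℕ → Omega D → Pos) : Prop :=
  ∀ m : ℕ, 2 ≤ m → ∀ y : ℕ → ℝ,
    Q⟦⋂ k ∈ Finset.range m, {ω | (Y k ω : ℝ) ≤ y k} | sigmaTheta D⟧ =ᵐ[Q]
      fun ω => ∏ k ∈ Finset.range m, (Q⟦{ω | (Y k ω : ℝ) ≤ y k} | sigmaTheta D⟧) ω

/-- Condition (a1): the processes `W` and `X` are conditionally independent over `σ(Θ)`. -/
def CondA1 (Q : Measure (Omega D)) : Prop :=
  ∀ A B : Set (ℕ → Pos), MeasurableSet A → MeasurableSet B →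
    Q⟦{ω | (fun k => W k ω) ∈ A} ∩ {ω | (fun k => X k ω) ∈ B} | sigmaTheta D⟧ =ᵐ[Q]
      fun ω => (Q⟦{ω | (fun k => W k ω) ∈ A} | sigmaTheta D⟧) ω *
        (Q⟦{ω | (fun k => X k ω) ∈ B} | sigmaTheta D⟧) ω

/-- Condition (a2): `Θ` and the process `X` are independent. -/
def CondA2 (Q : Measure (Omega D)) : Prop :=
  IndepFun Theta (fun (ω : Omega D) (k : ℕ) => X k ω) Q

/-- `(N, X)` is a risk process under `Q`: `X` is i.i.d., and the processes `N` and `X` are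
independent. (The paths of `N` are those of a counting process by construction.) -/
structure IsRiskProcess (Q : Measure (Omega D)) : Prop where
  indep_X : iIndepFun (fun k (ω : Omega D) => X k ω) Q
  identDistrib_X : ∀ k, IdentDistrib (X k : Omega D → Pos) (X 0) Q Q
  indep : IndepFun (fun (ω : Omega D) (t : ℝ≥0) => N t ω) (fun (ω : Omega D) (k : ℕ) => X k ω) Q

/-- `S` is a compound mixed renewal process under `Q`, with interarrival time conditional
distribution `L(Θ)`. -/
structure IsCMRP (Q : Measure (Omega D)) [IsProbabilityMeasure Q] (L : Kernel D Pos) : Prop where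
  risk : IsRiskProcess Q
  condIndep : CondIndepSeq Q W
  condLaw : ∀ k, ∀ᵐ θ ∂(Q.map Theta), condDistrib (W k) Theta Q θ = L θ

/-- `S` is a compound renewal process under `Q`, with interarrival time distribution `ν`. -/
structure IsCRP (Q : Measure (Omega D)) (ν : Measure Pos) : Prop where
  risk : IsRiskProcess Q
  indep : iIndepFun (fun k (ω : Omega D) => W k ω) Q
  law : ∀ k, Q.map (W k) = ν

/-- `Q` and `P` are progressively equivalent: they have the same null sets in each `F t`. -/
def ProgEquiv (Q P : Measure (Omega D)) : Prop :=
  ∀ t : ℝ≥0, ∀ A, MeasurableSet[F D t] A → (Q A = 0 ↔ P A = 0)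

/-- The class `M_{S, L(Θ)}` (relative to `P`). -/
structure MemM (P Q : Measure (Omega D)) [IsProbabilityMeasure Q] (L : Kernel D Pos) : Prop where
  a1 : CondA1 Q
  a2 : CondA2 Q
  progEquiv : ProgEquiv Q P
  isCMRP : IsCMRP Q L

/-- The class `M_{S, ν}` of probability measures, relative to `P_θ`. -/
structure MemMTheta (Pθ Qθ : Measure (Omega D)) (ν : Measure Pos) : Prop where
  isProb : IsProbabilityMeasure Qθ
  progEquiv : ProgEquiv Qθ Pθ
  isCRP : IsCRP Qθ ν

/-- `(Q_y)` is a regular conditional probability of `Q` over the law of `f` under `Q`, consistent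
with `f`. -/
structure IsRCP {E Y : Type*} [MeasurableSpace E] [MeasurableSpace Y] (Q : Measure E) (f : E → Y)
    (Qy : Y → Measure E) : Prop where
  isProb : ∀ y, IsProbabilityMeasure (Qy y)
  measurable : ∀ A, MeasurableSet A → Measurable fun y => Qy y A
  disintegrate : ∀ A, MeasurableSet A → ∫⁻ y, Qy y A ∂(Q.map f) = Q A
  consistent : ∀ B, MeasurableSet B → ∀ᵐ y ∂(Q.map f), y ∈ B → Qy y (f ⁻¹' B) = 1

/-- `γ ∈ F_{P, ln}`: `γ` is measurable and `E_P[exp(γ(X₁))] = 1`. -/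
def MemFPln (P : Measure (Omega D)) (γ : Pos → ℝ) : Prop :=
  Measurable γ ∧ ∫ ω, Real.exp (γ (X 0 ω)) ∂P = 1

/-- `ξ ∈ R_+(D)`: `ξ` is measurable, `P_Θ`-a.s. positive, and `E_P[ξ(Θ)] = 1`. -/
def MemRPlus (P : Measure (Omega D)) (ξ : D → ℝ) : Prop :=
  Measurable ξ ∧ (∀ᵐ θ ∂(P.map Theta), 0 < ξ θ) ∧ ∫ ω, ξ (Theta ω) ∂P = 1

/-- The distribution function of a law on `(0, ∞)`. -/
noncomputable def distr (ν : Measure Pos) (x : ℝ) : ℝ := ν.real {w | (w : ℝ) ≤ x}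

/-- `M̃_t^{(γ)}(θ)`, for the interarrival laws `K(θ)` (old) and `L(θ)` (new). -/
noncomputable def Mtilde (K L : Kernel D Pos) (γ : Pos → ℝ) (θ : D) (t : ℝ≥0) (ω : Omega D) : ℝ :=
  (∏ j ∈ Finset.range (count t ω), Real.exp (γ (X j ω)) * (Kernel.rnDeriv L K θ (W j ω)).toReal) *
    ((1 - distr (L θ) (V t ω)) / (1 - distr (K θ) (V t ω)))

/-- `M_t^{(γ)}(Θ) = ξ(Θ) M̃_t^{(γ)}(Θ)`. -/
noncomputable def Mmix (K L : Kernel D Pos) (γ : Pos → ℝ) (ξ : D → ℝ) (t : ℝ≥0) (ω : Omega D) : ℝ :=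
  ξ (Theta ω) * Mtilde K L γ (Theta ω) t ω

/-- `M_t` is a density of `Q` with respect to `P` on `F_u`, for all `u ≤ t`. -/
def IsProgDensity (P Q : Measure (Omega D)) (M : ℝ≥0 → Omega D → ℝ) : Prop :=
  ∀ u t : ℝ≥0, u ≤ t → ∀ A, MeasurableSet[F D u] A →
    IntegrableOn (M t) A P ∧ Q.real A = ∫ ω in A, M t ω ∂P

/-- `M` is an a.s. positive martingale with respect to the filtration `F`, with mean `1`. -/
def IsPosMartingale (P : Measure (Omega D)) (M : ℝ≥0 → Omega D → ℝ) : Prop :=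
  Martingale M (F D) P ∧ ∀ t, (∀ᵐ ω ∂P, 0 < M t ω) ∧ ∫ ω, M t ω ∂P = 1

end Structure

section Exponential

variable {D : Type*} [MeasurableSpace D]

/-- `k` solves `M_{X₁}(r) (M_θ)_{W₁}(-k - c r) = 1`, where the moment generating functions are
those of `X₁` under `P` and of `W₁` under `P_θ`. -/
def IsKappa (P Pθ : Measure (Omega D)) (r c k : ℝ) : Prop :=
  mgf (fun ω => (X 0 ω : ℝ)) P r * mgf (fun ω => (W 0 ω : ℝ)) Pθ (-k - c * r) = 1

/-- `κ_θ(r)`: the solution of the equation in `IsKappa`. -/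
noncomputable def kappa (P Pθ : Measure (Omega D)) (r c : ℝ) : ℝ :=
  Classical.epsilon fun k => IsKappa P Pθ r c k

/-- `γ(x) = r x - ln E_P[exp(r X₁)]`. -/
noncomputable def gam (P : Measure (Omega D)) (r : ℝ) (x : Pos) : ℝ :=
  r * x - Real.log (∫ ω, Real.exp (r * X 0 ω) ∂P)

/-- `exp(r S_t - s T_{N_t} + ln m) ∫_{(V_t, ∞)} exp(-s w) ν(dw) / (1 - G(V_t))`, where
`V_t = t - T_{N_t}`. -/
noncomputable def Mexp (r m s : ℝ) (ν G : Measure Pos) (t : ℝ≥0) (ω : Omega D) : ℝ :=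
  Real.exp (r * S t ω - s * T (count t ω) ω + Real.log m) *
    ((∫ w in {w : Pos | V t ω < w}, Real.exp (-s * w) ∂ν) / (1 - distr G (V t ω)))

/-- Schmidli's martingale in the renewal model with interarrival law `G`, premium rate `c`, initial
reserve `u`; here `m = E[exp(r X₁)]` and `k` is the root of `m E[exp(-(k + c r) W₁)] = 1`:
`L_t = exp(-r (r_t - u)) exp(-k t) m exp((k + c r) V_t) ∫_{(V_t, ∞)} exp(-(k + c r) w) G(dw)
  / (1 - G(V_t))`. -/
noncomputable def schmidliL (r m c k u : ℝ) (G : Measure Pos) (t : ℝ≥0) (ω : Omega D) : ℝ :=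
  Real.exp (-r * (reserve u c t ω - u)) * Real.exp (-k * t) * m * Real.exp ((k + c * r) * V t ω) *
    (∫ w in {w : Pos | V t ω < w}, Real.exp (-(k + c * r) * w) ∂G) / (1 - distr G (V t ω))

/-- The exponentially tilted law of `X₁`: `Q(X₁ ∈ B) = E_P[1_{X₁ ∈ B} exp(r X₁)] / E_P[exp(r X₁)]`. -/
def IsTiltedX (P Q : Measure (Omega D)) (r : ℝ) : Prop :=
  ∀ B : Set Pos, MeasurableSet B →
    Q.real (X 0 ⁻¹' B) =
      (∫ ω in X 0 ⁻¹' B, Real.exp (r * X 0 ω) ∂P) / ∫ ω, Real.exp (r * X 0 ω) ∂P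

/-- `L(Θ)` is the conditional law of `W₁` given `Θ` tilted by `exp(-s(Θ) W₁)`: for every Borel `B`,
`L(Θ)(B) = E_P[1_{W₁ ∈ B} exp(-s(Θ) W₁) | Θ] / E_P[exp(-s(Θ) W₁) | Θ]` almost surely. -/
def IsTiltedW (P : Measure (Omega D)) (s : D → ℝ) (L : Kernel D Pos) : Prop :=
  ∀ B : Set Pos, MeasurableSet B →
    (fun ω : Omega D => (L (Theta ω)).real B) =ᵐ[P] fun ω =>
      (P[(W 0 ⁻¹' B).indicator (fun ω => Real.exp (-s (Theta ω) * W 0 ω)) | sigmaTheta D]) ω /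
        (P[fun ω => Real.exp (-s (Theta ω) * W 0 ω) | sigmaTheta D]) ω

end Exponential

end CMRP

open CMRP

/-! Everything rests on one change-of-measure identity for product measures, `condP_apply_eq`: if `L
θ ≪ K θ`, then on `F D t` the measure `condP L (expTilt R γ) θ` has density `Mtilde K L γ θ t` with
respect to `condP K R θ`. Claims are positive, so the path of `S` reveals the arrivals. Before the
arrival with index `n + 1`, an event of `F D t` depends only on `Θ`, the first `n` interarrival
times and the first `n` claims. On the event of exactly `n` arrivals the variable `W n` enters only
through the survival condition `W n > t - T n`. The first `n` coordinates contribute the product of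
the one-dimensional densities. Integrating out `W n` contributes a tail probability, and the ratio
of the two tails is the last factor of `Mtilde`. Summing over `n` loses nothing, because arrival
times are a.s. unbounded. Integrating over `θ` against `ξ` gives the mixed version `mixP_apply_eq`.

Two rigidity statements give the converse and the uniqueness. By `eq_mixP`, the structural
conditions determine `Q` as a mixture of product measures, given the laws of `Θ` and `X 0` and the
interarrival kernel. By `eq_of_forall_F`, two probability measures that agree on every `F D t`
coincide if there is no explosion under one of them. Hence a progressive density identifies the
whole measure, and with it the law of `Θ`, the claim law and the regular conditional probability.

The exponential formulas are then computation. Since `m ≥ 1`, and the Laplace transform of a law on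
the half-line decreases continuously from `1` to `0` on `[0, ∞)`, the equation for `κ` has exactly
one root, and `s ≥ 0`. By `ae_eq_lapTilt`, the new interarrival law has density `m exp (-s w)` for
almost every `θ`. Substitution cancels the constants `m` claim by claim (`Mtilde_eq_Mexp`).
Positivity comes from the a.s. nonvanishing tail beyond `V t` (`Mexp_pos`), and Schmidli's form from
`T (count t) = t - V t` (`Mexp_eq_schmidliL`). -/

namespace CMRP

/-! ### Infinite product measures: tilting and isolating finitely many coordinates. -/

section ProductMeasures

/-- The point `1` of `(0, ∞)`. -/
def onePos : Pos := ⟨1, Set.mem_Ioi.2 one_pos⟩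

/-- The sequence that agrees with `w` below `n` and is constantly `1` from `n` on. -/
noncomputable def trunc (n : ℕ) (w : ℕ → Pos) : ℕ → Pos :=
  fun k => if k < n then w k else onePos

theorem trunc_apply_of_lt {n k : ℕ} (h : k < n) (w : ℕ → Pos) : trunc n w k = w k := if_pos h

@[fun_prop]
theorem measurable_trunc (n : ℕ) : Measurable (trunc n) := by
  refine measurable_pi_lambda _ fun k => ?_
  unfold trunc
  split_ifs
  · exact measurable_pi_apply k
  · exact measurable_const

/-- Truncation acts coordinate by coordinate and sends every factor from `n` on to the point mass at
`onePos`, so the later factors are invisible. -/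
theorem map_trunc_congr {α β : ℕ → Measure Pos} [∀ k, IsProbabilityMeasure (α k)]
    [∀ k, IsProbabilityMeasure (β k)] {n : ℕ} (h : ∀ k < n, α k = β k) :
    (Measure.infinitePi α).map (trunc n) = (Measure.infinitePi β).map (trunc n) := by
  have hf : ∀ k : ℕ, Measurable fun x : Pos => if k < n then x else onePos := by
    intro k; split_ifs
    · exact measurable_id
    · exact measurable_const
  have ht : trunc n = fun w k => (fun x : Pos => if k < n then x else onePos) (w k) := rfl
  rw [ht, Measure.infinitePi_map_pi α hf, Measure.infinitePi_map_pi β hf]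
  congr 1
  funext k
  by_cases hk : k < n
  · rw [h k hk]
  · simp [hk]

theorem lintegral_finset_prod_infinitePi (α : ℕ → Measure Pos) [∀ k, IsProbabilityMeasure (α k)]
    (s : Finset ℕ) {f : ℕ → Pos → ℝ≥0∞} (hf : ∀ k, Measurable (f k)) :
    ∫⁻ w, ∏ k ∈ s, f k (w k) ∂(Measure.infinitePi α) = ∏ k ∈ s, ∫⁻ x, f k x ∂(α k) := by
  rw [lintegral_prod_eq_prod_lintegral_of_indepFun s (fun k (w : ℕ → Pos) => f k (w k))
    (iIndepFun_infinitePi hf) (fun k => (hf k).comp (measurable_pi_apply k))]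
  refine Finset.prod_congr rfl fun k _ => ?_
  rw [← Measure.infinitePi_map_eval α k, lintegral_map (hf k) (measurable_pi_apply k)]

/-- Only finitely many coordinates are tilted, since the fully tilted product is in general singular
to the original one. It suffices to test on boxes. -/
theorem infinitePi_withDensity (κ : Measure Pos) [IsProbabilityMeasure κ] {f : Pos → ℝ≥0∞}
    (hf : Measurable f) [IsProbabilityMeasure (κ.withDensity f)] (n : ℕ) :
    (Measure.infinitePi fun _ : ℕ => κ).withDensity (fun w => ∏ j ∈ Finset.range n, f (w j)) =
      Measure.infinitePi fun k => if k < n then κ.withDensity f else κ := by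
  have : ∀ k : ℕ, IsProbabilityMeasure (if k < n then κ.withDensity f else κ) := by
    intro k; split_ifs <;> infer_instance
  refine Measure.eq_infinitePi _ fun s t ht => ?_
  rw [withDensity_apply _ (MeasurableSet.pi s.countable_toSet fun i _ => ht i),
    ← lintegral_indicator (MeasurableSet.pi s.countable_toSet fun i _ => ht i)]
  -- `F k` merges the tilt and the box constraint of coordinate `k`, each replaced by `1` where
  -- absent. The integrand is then a single product over `s ∪ range n`.
  set F : ℕ → Pos → ℝ≥0∞ := fun k x =>
    (if k < n then f x else 1) * (if k ∈ s then (t k).indicator 1 x else 1) with hF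
  have hFm : ∀ k, Measurable (F k) := by
    intro k
    refine Measurable.mul ?_ ?_
    · split_ifs
      · exact hf
      · exact measurable_const
    · split_ifs
      · exact measurable_one.indicator (ht k)
      · exact measurable_const
  have h1 : ((s : Set ℕ).pi t).indicator (fun w => ∏ j ∈ Finset.range n, f (w j)) =
      fun w => ∏ k ∈ s ∪ Finset.range n, F k (w k) := by
    funext w
    simp only [hF, Finset.prod_mul_distrib]
    have ha : ∏ k ∈ s ∪ Finset.range n, (if k < n then f (w k) else 1) =
        ∏ k ∈ Finset.range n, f (w k) := by
      rw [← Finset.prod_subset (Finset.subset_union_right (s₁ := s) (s₂ := Finset.range n))]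
      · exact Finset.prod_congr rfl fun k hk => if_pos (Finset.mem_range.1 hk)
      · intro k _ hk
        exact if_neg (by simpa using hk)
    have hb : ∏ k ∈ s ∪ Finset.range n, (if k ∈ s then (t k).indicator (1 : Pos → ℝ≥0∞) (w k) else 1)
        = ∏ k ∈ s, (t k).indicator 1 (w k) := by
      rw [← Finset.prod_subset (Finset.subset_union_left (s₁ := s) (s₂ := Finset.range n))]
      · exact Finset.prod_congr rfl fun k hk => if_pos hk
      · intro k _ hk
        exact if_neg hk
    rw [ha, hb]
    by_cases hw : w ∈ (s : Set ℕ).pi t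
    · rw [Set.indicator_of_mem hw, Finset.prod_eq_one (s := s), mul_one]
      intro k hk
      exact Set.indicator_of_mem (hw k hk) _
    · rw [Set.indicator_of_notMem hw]
      have : ∃ k ∈ s, w k ∉ t k := by simpa [Set.mem_pi] using hw
      obtain ⟨k, hk, hkt⟩ := this
      rw [Finset.prod_eq_zero hk (Set.indicator_of_notMem hkt _), mul_zero]
  rw [h1, lintegral_finset_prod_infinitePi _ _ hFm,
    ← Finset.prod_subset (Finset.subset_union_left (s₁ := s) (s₂ := Finset.range n))]
  · refine Finset.prod_congr rfl fun k hk => ?_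
    simp only [hF, if_pos hk]
    by_cases hkn : k < n
    · simp only [if_pos hkn]
      rw [withDensity_apply _ (ht k), ← lintegral_indicator (ht k)]
      refine lintegral_congr fun x => ?_
      by_cases hx : x ∈ t k <;> simp [hx]
    · simp only [if_neg hkn, one_mul]
      rw [lintegral_indicator_one (ht k)]
  -- A tilted but unconstrained coordinate integrates to the total mass of the tilted law, which is
  -- `1`.
  · intro k hk hks
    have hkn : k < n := by
      rcases Finset.mem_union.1 hk with h | h
      · exact absurd h hks
      · simpa using h
    simp only [hF, if_neg hks, if_pos hkn, mul_one]
    have := measure_univ (μ := κ.withDensity f)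
    rwa [withDensity_apply _ MeasurableSet.univ, Measure.restrict_univ] at this

theorem lintegral_trunc_withDensity (κ : Measure Pos) [IsProbabilityMeasure κ] {f : Pos → ℝ≥0∞}
    (hf : Measurable f) [IsProbabilityMeasure (κ.withDensity f)] (n : ℕ)
    {h : (ℕ → Pos) → ℝ≥0∞} (hh : Measurable h) :
    ∫⁻ w, h (trunc n w) ∂(Measure.infinitePi fun _ : ℕ => κ.withDensity f) =
      ∫⁻ w, (∏ j ∈ Finset.range n, f (w j)) * h (trunc n w) ∂(Measure.infinitePi fun _ : ℕ => κ) := by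
  have : ∀ k : ℕ, IsProbabilityMeasure (if k < n then κ.withDensity f else κ) := by
    intro k; split_ifs <;> infer_instance
  rw [← lintegral_map hh (measurable_trunc n),
    map_trunc_congr (β := fun k => if k < n then κ.withDensity f else κ)
      (fun k hk => (if_pos hk).symm),
    ← infinitePi_withDensity κ hf n, lintegral_map hh (measurable_trunc n),
    lintegral_withDensity_eq_lintegral_mul _ (by fun_prop)
      (by fun_prop)]
  rfl

theorem measurable_update_prod (n : ℕ) :
    Measurable fun p : (ℕ → Pos) × Pos => Function.update p.1 n p.2 := by
  refine measurable_pi_lambda _ fun k => ?_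
  by_cases hk : k = n
  · subst hk; simpa using measurable_snd
  · simp only [Function.update_of_ne hk]; fun_prop

/-- Resampling coordinate `n` independently preserves the law. This gives the independence of that
coordinate from the others in a form suited to Fubini. -/
theorem infinitePi_map_update (κ : Measure Pos) [IsProbabilityMeasure κ] (n : ℕ) :
    ((Measure.infinitePi fun _ : ℕ => κ).prod κ).map (fun p => Function.update p.1 n p.2) =
      Measure.infinitePi fun _ : ℕ => κ := by
  have hu := measurable_update_prod n
  refine Measure.eq_infinitePi _ fun s t ht => ?_
  rw [Measure.map_apply hu (MeasurableSet.pi s.countable_toSet fun i _ => ht i)]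
  have h1 : (fun p : (ℕ → Pos) × Pos => Function.update p.1 n p.2) ⁻¹' ((s : Set ℕ).pi t) =
      (((s.erase n : Finset ℕ) : Set ℕ).pi t) ×ˢ (if n ∈ s then t n else Set.univ) := by
    ext p
    simp only [Set.mem_preimage, Set.mem_pi, Set.mem_prod, Finset.mem_coe, Finset.mem_erase]
    constructor
    · intro h
      refine ⟨fun k hk => by simpa [hk.1] using h k hk.2, ?_⟩
      split_ifs with hn
      · simpa using h n hn
      · trivial
    · rintro ⟨h1, h2⟩ k hk
      by_cases hkn : k = n
      · subst hkn; simpa [hk] using h2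
      · simpa [hkn] using h1 k ⟨hkn, hk⟩
  rw [h1, Measure.prod_prod, Measure.infinitePi_pi _ fun i _ => ht i]
  split_ifs with hn
  · exact Finset.prod_erase_mul _ _ hn
  · rw [Finset.erase_eq_of_notMem hn]; simp

/-- `trunc n` ignores coordinate `n`, so after resampling that coordinate the integral splits by
Fubini. -/
theorem lintegral_trunc_eval (κ : Measure Pos) [IsProbabilityMeasure κ] (n : ℕ)
    {g : (ℕ → Pos) → Pos → ℝ≥0∞} (hg : Measurable fun p : (ℕ → Pos) × Pos => g p.1 p.2) :
    ∫⁻ w, g (trunc n w) (w n) ∂(Measure.infinitePi fun _ : ℕ => κ) =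
      ∫⁻ w, ∫⁻ v, g (trunc n w) v ∂κ ∂(Measure.infinitePi fun _ : ℕ => κ) := by
  have hu := measurable_update_prod n
  have hg' : Measurable fun w => g (trunc n w) (w n) :=
    hg.comp ((measurable_trunc n).prodMk (measurable_pi_apply n))
  conv_lhs => rw [← infinitePi_map_update κ n]
  rw [lintegral_map hg' hu]
  have h : ∀ p : (ℕ → Pos) × Pos,
      g (trunc n (Function.update p.1 n p.2)) (Function.update p.1 n p.2 n) =
        g (trunc n p.1) p.2 := by
    intro p
    have : trunc n (Function.update p.1 n p.2) = trunc n p.1 := by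
      funext k
      unfold trunc
      split_ifs with hk
      · rw [Function.update_of_ne hk.ne]
      · rfl
    rw [this, Function.update_self]
  simp_rw [h]
  rw [lintegral_prod (fun p : (ℕ → Pos) × Pos => g (trunc n p.1) p.2)
    (hg.comp ((measurable_trunc n).prodMap measurable_id)).aemeasurable]

/-- Partial sums of i.i.d. positive variables are almost surely unbounded. -/
theorem ae_exists_lt_sum (κ : Measure Pos) [IsProbabilityMeasure κ] (t : ℝ) :
    ∀ᵐ w ∂(Measure.infinitePi fun _ : ℕ => κ), ∃ n, t < ∑ k ∈ Finset.range n, (w k : ℝ) := by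
  set e : Pos → ℝ≥0∞ := fun x => ENNReal.ofReal (Real.exp (-(x : ℝ))) with he
  have hem : Measurable e := by fun_prop
  set a : ℝ≥0∞ := ∫⁻ x, e x ∂κ with ha
  have ha1 : a < 1 := by
    have hlt : ∀ x : Pos, e x < 1 := by
      intro x
      rw [he, ENNReal.ofReal_lt_one, Real.exp_lt_one_iff]
      exact neg_lt_zero.2 x.2
    have := lintegral_strict_mono (μ := κ) (f := e) (g := fun _ => 1) (by
      exact IsProbabilityMeasure.ne_zero κ) aemeasurable_const ?_ (ae_of_all _ hlt)
    · simpa using this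
    · refine ((lintegral_mono fun x => (hlt x).le).trans_lt ?_).ne
      simp
  -- Chernoff bound: where the `n`-th partial sum is at most `t`, the product of the `exp (-w k)` is
  -- at least `exp (-t)`, while its mean is `a ^ n` with `a < 1`.
  have hb : ∀ n : ℕ, (Measure.infinitePi fun _ : ℕ => κ)
      {w | ∀ n, ∑ k ∈ Finset.range n, (w k : ℝ) ≤ t} ≤ ENNReal.ofReal (Real.exp t) * a ^ n := by
    intro n
    have h1 := lintegral_finset_prod_infinitePi (fun _ => κ) (Finset.range n) (f := fun _ => e)
      fun _ => hem
    rw [Finset.prod_const, Finset.card_range] at h1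
    rw [← ha] at h1
    rw [← h1, ← lintegral_const_mul _ (by fun_prop)]
    refine (measure_mono (t := {w | 1 ≤ ENNReal.ofReal (Real.exp t) *
      ∏ j ∈ Finset.range n, e (w j)}) ?_).trans ?_
    · intro w hw
      have := hw n
      simp only [he, Set.mem_ofPred_eq]
      rw [← ENNReal.ofReal_prod_of_nonneg fun _ _ => (Real.exp_pos _).le,
        ← ENNReal.ofReal_mul (Real.exp_pos _).le, ← Real.exp_sum, ← Real.exp_add,
        ENNReal.one_le_ofReal, Real.one_le_exp_iff, Finset.sum_neg_distrib]
      linarith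
    · have := mul_meas_ge_le_lintegral (μ := Measure.infinitePi fun _ : ℕ => κ)
        (f := fun w => ENNReal.ofReal (Real.exp t) * ∏ j ∈ Finset.range n, e (w j))
        (by fun_prop) 1
      simpa using this
  have h0 : (Measure.infinitePi fun _ : ℕ => κ)
      {w | ∀ n, ∑ k ∈ Finset.range n, (w k : ℝ) ≤ t} = 0 := by
    refine le_antisymm (ge_of_tendsto' (x := atTop) ?_ hb) zero_le
    have := ENNReal.Tendsto.const_mul (a := ENNReal.ofReal (Real.exp t))
      (ENNReal.tendsto_pow_atTop_nhds_zero_of_lt_one ha1) (Or.inr ENNReal.ofReal_ne_top)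
    simpa using this
  rw [ae_iff]
  simpa using h0

end ProductMeasures

/-! ### Paths: what the aggregate claims process reveals about arrivals and claims. -/

section Paths

variable {D : Type*}

theorem T_succ (n : ℕ) (ω : Omega D) : T (n + 1) ω = T n ω + W n ω := Finset.sum_range_succ _ _

theorem T_zero (ω : Omega D) : T 0 ω = 0 := Finset.sum_range_zero _

theorem T_strictMono (ω : Omega D) : StrictMono fun n => T n ω :=
  strictMono_nat_of_lt_succ fun n => by
    rw [T_succ]
    exact lt_add_of_pos_right _ (W n ω).2

theorem T_nonneg (n : ℕ) (ω : Omega D) : 0 ≤ T n ω :=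
  Finset.sum_nonneg fun k _ => (W k ω).2.le

theorem T_congr {n : ℕ} {ω ω' : Omega D} (h : ∀ k < n, W k ω = W k ω') : T n ω = T n ω' :=
  Finset.sum_congr rfl fun k hk => by rw [h k (Finset.mem_range.1 hk)]

theorem count_eq {t : ℝ≥0} {ω : Omega D} {n : ℕ} (h1 : T n ω ≤ t) (h2 : t < T (n + 1) ω) :
    count t ω = n := by
  have h : {k : ℕ | T (k + 1) ω ≤ t} = (Finset.range n : Set ℕ) := by
    ext k
    simp only [Set.mem_ofPred_eq, Finset.coe_range, Set.mem_Iio]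
    constructor
    · intro hk
      have := (T_strictMono ω).lt_iff_lt.1 (hk.trans_lt h2)
      omega
    · intro hk
      exact ((T_strictMono ω).monotone (Nat.succ_le_of_lt hk)).trans h1
  rw [count, N, h, Set.encard_coe_eq_coe_finsetCard]
  simp

theorem count_eq_zero_of_forall_le {t : ℝ≥0} {ω : Omega D} (h : ∀ n, T n ω ≤ t) :
    count t ω = 0 := by
  have h' : {k : ℕ | T (k + 1) ω ≤ t} = Set.univ := Set.eq_univ_of_forall fun k => h (k + 1)
  rw [count, N, h']
  simp

theorem exists_bracket {t : ℝ≥0} {ω : Omega D} (h : ∃ n, t < T n ω) :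
    ∃ n, T n ω ≤ t ∧ t < T (n + 1) ω := by
  classical
  have h0 : Nat.find h ≠ 0 := by
    intro h0
    have := Nat.find_spec h
    rw [h0, T_zero] at this
    exact absurd this (not_lt.2 t.2)
  obtain ⟨k, hk⟩ := Nat.exists_eq_succ_of_ne_zero h0
  refine ⟨k, not_lt.1 (Nat.find_min h (by omega)), ?_⟩
  have := Nat.find_spec h
  rwa [hk] at this

theorem bracket_count {t : ℝ≥0} {ω : Omega D} (h : ∃ n, t < T n ω) :
    T (count t ω) ω ≤ t ∧ t < T (count t ω + 1) ω := by
  obtain ⟨n, h1, h2⟩ := exists_bracket h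
  rw [count_eq h1 h2]
  exact ⟨h1, h2⟩

theorem exists_lt_T_of_count_pos {t : ℝ≥0} {ω : Omega D} (h : 0 < count t ω) :
    ∃ n, t < T n ω := by
  by_contra hc
  push Not at hc
  exact h.ne' (count_eq_zero_of_forall_le hc)

theorem exists_lt_T_mono {s t : ℝ≥0} (hst : s ≤ t) {ω : Omega D} (h : ∃ n, t < T n ω) :
    ∃ n, s < T n ω :=
  h.imp fun _ hn => (NNReal.coe_le_coe.2 hst).trans_lt hn

theorem le_count_iff {t : ℝ≥0} {ω : Omega D} (h : ∃ n, t < T n ω) (k : ℕ) :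
    k ≤ count t ω ↔ T k ω ≤ t := by
  obtain ⟨h1, h2⟩ := bracket_count h
  constructor
  · intro hk
    exact ((T_strictMono ω).monotone hk).trans h1
  · intro hk
    have := (T_strictMono ω).lt_iff_lt.1 (hk.trans_lt h2)
    omega

/-- Partial sums of the claim sizes. -/
noncomputable def U (n : ℕ) (ω : Omega D) : ℝ := ∑ k ∈ Finset.range n, (X k ω : ℝ)

theorem U_strictMono (ω : Omega D) : StrictMono fun n => U n ω :=
  strictMono_nat_of_lt_succ fun n => by
    have : U (n + 1) ω = U n ω + X n ω := Finset.sum_range_succ _ _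
    rw [this]
    exact lt_add_of_pos_right _ (X n ω).2

theorem S_eq_U (t : ℝ≥0) (ω : Omega D) : S t ω = U (count t ω) ω := rfl

theorem S_lt_S_iff {s t : ℝ≥0} {ω : Omega D} : S s ω < S t ω ↔ count s ω < count t ω :=
  (U_strictMono ω).lt_iff_lt

theorem S_pos_iff {t : ℝ≥0} {ω : Omega D} : 0 < S t ω ↔ 0 < count t ω :=
  (U_strictMono ω).lt_iff_lt (a := 0) (b := count t ω)

theorem measurable_S_sigmaS {s t : ℝ≥0} (h : s ≤ t) : Measurable[sigmaS D t] (S s : Omega D → ℝ) :=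
  Measurable.of_comap_le (le_iSup
    (fun s : Set.Iic t => MeasurableSpace.comap (S (s : ℝ≥0) : Omega D → ℝ) Real.measurableSpace)
    ⟨s, h⟩)

theorem exists_nnrat_btwn {a b : ℝ} (ha : 0 ≤ a) (hab : a < b) :
    ∃ q : ℚ≥0, a < ((q : ℝ≥0) : ℝ) ∧ ((q : ℝ≥0) : ℝ) < b := by
  obtain ⟨q, h1, h2⟩ := exists_rat_btwn hab
  have hq : (0 : ℚ) ≤ q := by exact_mod_cast (ha.trans h1.le)
  lift q to ℚ≥0 using hq
  exact ⟨q, by exact_mod_cast h1, by exact_mod_cast h2⟩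

/-- Positive claims make `S` jump at every arrival. So `n + 1` arrivals by time `s` means that at
some rational `q ≤ s` there were `n` of them and `S q < S s`. The condition `0 < count t ω` excludes
explosion by time `t`, where `count` takes its default value `0` and is no longer monotone in time.
It is visible to `sigmaS` because it says `0 < S t`. -/
theorem measurableSet_le_count_aux (t : ℝ≥0) (n : ℕ) : ∀ s ≤ t,
    MeasurableSet[sigmaS D t] {ω : Omega D | 0 < count t ω ∧ n ≤ count s ω} := by
  induction n with
  | zero =>
    intro s _
    have : {ω : Omega D | 0 < count t ω ∧ 0 ≤ count s ω} = S t ⁻¹' Set.Ioi 0 := by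
      ext ω; simp [S_pos_iff]
    rw [this]
    exact measurable_S_sigmaS le_rfl measurableSet_Ioi
  | succ n ih =>
    intro s hs
    have : {ω : Omega D | 0 < count t ω ∧ n + 1 ≤ count s ω} =
        ⋃ q : {q : ℚ≥0 // (q : ℝ≥0) ≤ s}, {ω : Omega D | 0 < count t ω ∧ n ≤ count ((q : ℚ≥0) : ℝ≥0) ω} ∩
          {ω | S ((q : ℚ≥0) : ℝ≥0) ω < S s ω} := by
      ext ω
      simp only [Set.mem_ofPred_eq, Set.mem_iUnion, Set.mem_inter_iff, S_lt_S_iff]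
      constructor
      · rintro ⟨h0, hn⟩
        have hex := exists_lt_T_mono hs (exists_lt_T_of_count_pos h0)
        have hT := (le_count_iff hex _).1 hn
        obtain ⟨q, hq1, hq2⟩ := exists_nnrat_btwn (T_nonneg n ω) (T_strictMono ω n.lt_succ_self)
        have hqs : (q : ℝ≥0) ≤ s := NNReal.coe_le_coe.1 (hq2.le.trans hT)
        refine ⟨⟨q, hqs⟩, ⟨h0, ?_⟩, ?_⟩
        · exact (le_count_iff (exists_lt_T_mono hqs hex) _).2 hq1.le
        · refine lt_of_lt_of_le (not_le.1 ?_) hn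
          rw [le_count_iff (exists_lt_T_mono hqs hex)]
          exact not_le.2 hq2
      · rintro ⟨q, ⟨h0, h1⟩, h2⟩
        exact ⟨h0, by omega⟩
    rw [this]
    refine MeasurableSet.iUnion fun q => (ih _ (q.2.trans hs)).inter ?_
    exact measurableSet_lt (measurable_S_sigmaS (q.2.trans hs)) (measurable_S_sigmaS hs)

theorem measurable_count_sigmaS (t : ℝ≥0) :
    Measurable[sigmaS D t] (count t : Omega D → ℕ) := by
  refine measurable_of_Ici fun n => ?_
  rcases Nat.eq_zero_or_pos n with rfl | hn
  · convert MeasurableSet.univ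
    ext ω; simp
  · convert measurableSet_le_count_aux (D := D) t n t le_rfl using 1
    ext ω
    simp only [Set.mem_preimage, Set.mem_Ici, Set.mem_ofPred_eq]
    exact ⟨fun h => ⟨hn.trans_le h, h⟩, fun h => h.2⟩

theorem measurable_T_sigmaS (t : ℝ≥0) (n : ℕ) :
    Measurable[sigmaS D t] fun ω : Omega D => if n ≤ count t ω then T n ω else 0 := by
  rcases Nat.eq_zero_or_pos n with rfl | hn
  · simp only [T_zero, ite_self]
    exact measurable_const
  refine measurable_of_Iic fun x => ?_
  have hc : MeasurableSet[sigmaS D t] {ω : Omega D | n ≤ count t ω} :=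
    measurable_count_sigmaS t measurableSet_Ici
  rcases lt_or_ge x 0 with hx | hx
  · convert MeasurableSet.empty
    ext ω
    simp only [Set.mem_preimage, Set.mem_Iic, Set.mem_empty_iff_false, iff_false, not_le]
    split_ifs
    · exact hx.trans_le (T_nonneg n ω)
    · exact hx
  -- Given `T n ≤ t`, the inequality `T n ≤ x` says that `n` arrivals have occurred by `min x t`.
  · have : (fun ω : Omega D => if n ≤ count t ω then T n ω else 0) ⁻¹' Set.Iic x =
        {ω | n ≤ count t ω}ᶜ ∪
          {ω | n ≤ count t ω} ∩ {ω | 0 < count t ω ∧ n ≤ count (min x.toNNReal t) ω} := by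
      ext ω
      simp only [Set.mem_preimage, Set.mem_Iic, Set.mem_union, Set.mem_compl_iff,
        Set.mem_ofPred_eq, Set.mem_inter_iff]
      by_cases h : n ≤ count t ω
      · have hex := exists_lt_T_of_count_pos (hn.trans_le h)
        have hT := (le_count_iff hex _).1 h
        simp only [h, if_true, not_true_eq_false, false_or, true_and, hn.trans_le h]
        rw [le_count_iff (exists_lt_T_mono (min_le_right _ _) hex), NNReal.coe_min,
          Real.coe_toNNReal x hx, le_min_iff]
        exact ⟨fun h => ⟨h, hT⟩, fun h => h.1⟩
      · simp [h, hx]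
    rw [this]
    exact hc.compl.union (hc.inter (measurableSet_le_count_aux t n _ (min_le_right _ _)))

theorem measurable_U_sigmaS (t : ℝ≥0) (n : ℕ) :
    Measurable[sigmaS D t] fun ω : Omega D => if n ≤ count t ω then U n ω else 0 := by
  rcases Nat.eq_zero_or_pos n with rfl | hn
  · have : ∀ ω : Omega D, U 0 ω = 0 := fun _ => rfl
    simp only [this, ite_self]
    exact measurable_const
  refine measurable_of_Iic fun x => ?_
  have hc : MeasurableSet[sigmaS D t] {ω : Omega D | n ≤ count t ω} :=
    measurable_count_sigmaS t measurableSet_Ici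
  -- `U n` is the value of `S` while there are exactly `n` arrivals. It is at most `x` iff `S ≤ x`
  -- at every rational time, capped at `t`, with at most `n` arrivals.
  have : (fun ω : Omega D => if n ≤ count t ω then U n ω else 0) ⁻¹' Set.Iic x =
      ({ω | n ≤ count t ω}ᶜ ∩ {_ω | 0 ≤ x}) ∪ ({ω | n ≤ count t ω} ∩
        ⋂ q : ℚ≥0, ({ω : Omega D | 0 < count t ω ∧ n + 1 ≤ count (min (q : ℝ≥0) t) ω} ∪
          S (min (q : ℝ≥0) t) ⁻¹' Set.Iic x)) := by
    ext ω
    simp only [Set.mem_preimage, Set.mem_Iic, Set.mem_union, Set.mem_compl_iff,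
      Set.mem_ofPred_eq, Set.mem_inter_iff, Set.mem_iInter]
    by_cases h : n ≤ count t ω
    · have h0 := hn.trans_le h
      have hex := exists_lt_T_of_count_pos h0
      have hT := (le_count_iff hex _).1 h
      simp only [h, if_true, not_true_eq_false, false_or, true_and, false_and, h0]
      constructor
      · intro hU q
        by_cases hq : n + 1 ≤ count (min (q : ℝ≥0) t) ω
        · exact Or.inl hq
        · refine Or.inr (le_trans ?_ hU)
          exact (U_strictMono ω).monotone (by omega : count (min (q : ℝ≥0) t) ω ≤ n)
      · intro hq
        -- If the next arrival comes after `t`, any rational beyond `t` is capped to `t` itself.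
        -- Otherwise a rational is taken between `T n` and `T (n + 1)`.
        have : ∃ q : ℚ≥0, count (min (q : ℝ≥0) t) ω = n := by
          rcases lt_or_ge (t : ℝ) (T (n + 1) ω) with h1 | h1
          · obtain ⟨q, hq1, -⟩ := exists_nnrat_btwn t.2 (lt_add_one (t : ℝ))
            refine ⟨q, ?_⟩
            rw [min_eq_right (NNReal.coe_le_coe.1 hq1.le)]
            exact count_eq hT h1
          · obtain ⟨q, hq1, hq2⟩ := exists_nnrat_btwn (T_nonneg n ω)
              (T_strictMono ω n.lt_succ_self)
            refine ⟨q, ?_⟩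
            rw [min_eq_left (NNReal.coe_le_coe.1 (hq2.le.trans h1))]
            exact count_eq hq1.le hq2
        obtain ⟨q, hqn⟩ := this
        have := hq q
        rw [S_eq_U, hqn] at this
        exact this.resolve_left (by omega)
    · simp [h]
  rw [this]
  refine (hc.compl.inter (MeasurableSet.const _)).union (hc.inter (MeasurableSet.iInter fun q => ?_))
  exact (measurableSet_le_count_aux t _ _ (min_le_right _ _)).union
    (measurable_S_sigmaS (min_le_right _ _) measurableSet_Iic)

/-- The path in which all data not observed up to time `t` are replaced by `1`. -/
noncomputable def observed (t : ℝ≥0) (ω : Omega D) : Omega D :=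
  ((trunc (count t ω) fun k => W k ω, trunc (count t ω) fun k => X k ω), Theta ω)

theorem W_observed {t : ℝ≥0} {ω : Omega D} {k : ℕ} (h : k < count t ω) :
    W k (observed t ω) = W k ω := trunc_apply_of_lt h _

theorem X_observed {t : ℝ≥0} {ω : Omega D} {k : ℕ} (h : k < count t ω) :
    X k (observed t ω) = X k ω := trunc_apply_of_lt h _

theorem setOf_W_inter_setOf_X_inter_Theta (A B : Set (ℕ → Pos)) (C : Set D) :
    {ω : Omega D | (fun k => W k ω) ∈ A} ∩ {ω | (fun k => X k ω) ∈ B} ∩ Theta ⁻¹' C =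
      (A ×ˢ B) ×ˢ C := rfl

/-- Truncation of both sequences of a path. -/
noncomputable def truncPath (k : ℕ) (ω : Omega D) : Omega D :=
  ((trunc k fun j => W j ω, trunc k fun j => X j ω), Theta ω)

theorem trunc_trunc {k l : ℕ} (h : k ≤ l) (w : ℕ → Pos) : trunc k (trunc l w) = trunc k w := by
  funext j
  unfold trunc
  split_ifs <;> first | rfl | omega

theorem truncPath_truncPath {k l : ℕ} (h : k ≤ l) (ω : Omega D) :
    truncPath k (truncPath l ω) = truncPath k ω :=
  Prod.ext (Prod.ext (trunc_trunc h _) (trunc_trunc h _)) rfl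

theorem truncPath_observed {k : ℕ} {t : ℝ≥0} {ω : Omega D} (h : k ≤ count t ω) :
    truncPath k (observed t ω) = truncPath k ω :=
  Prod.ext (Prod.ext (trunc_trunc h _) (trunc_trunc h _)) rfl

/-- The event of exactly `n` arrivals up to time `t`. -/
def arrivals (D : Type*) (t : ℝ≥0) (n : ℕ) : Set (Omega D) := {ω | T n ω ≤ t ∧ t < T (n + 1) ω}

theorem count_of_mem_arrivals {t : ℝ≥0} {n : ℕ} {ω : Omega D} (h : ω ∈ arrivals D t n) :
    count t ω = n := count_eq h.1 h.2

variable [MeasurableSpace D]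

theorem sigmaS_le_F (t : ℝ≥0) : sigmaS D t ≤ F D t := le_sup_left

theorem measurable_Theta_F (t : ℝ≥0) : Measurable[F D t] (Theta : Omega D → D) :=
  Measurable.of_comap_le le_sup_right

/-- Any measurable function of `observed t` is thereby adapted. Each observed coordinate is a
difference of consecutive values of `T` or `U`, already known to be measurable on the observed
range. -/
theorem measurable_observed (t : ℝ≥0) : Measurable[F D t] (observed t : Omega D → Omega D) := by
  have hc : ∀ k, MeasurableSet[sigmaS D t] {ω : Omega D | k < count t ω} := fun k =>
    measurable_count_sigmaS t measurableSet_Ioi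
  refine Measurable.prodMk (Measurable.prodMk ?_ ?_) (measurable_Theta_F t)
  · refine Measurable.mono ?_ (sigmaS_le_F t) le_rfl
    refine (@measurable_pi_iff _ _ _ (sigmaS D t) _ _).2 fun k => ?_
    refine measurable_comap_iff.2 ?_
    have : (Subtype.val ∘ fun ω : Omega D => trunc (count t ω) (fun k => W k ω) k) = fun ω =>
        if k < count t ω then (if k + 1 ≤ count t ω then T (k + 1) ω else 0) -
          (if k ≤ count t ω then T k ω else 0) else (1 : ℝ) := by
      funext ω
      simp only [Function.comp, trunc]
      by_cases h : k < count t ω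
      · simp [h, h.le, Nat.succ_le_of_lt h, T_succ]
      · simp [h, onePos]
    rw [this]
    have h1 := (measurable_T_sigmaS (D := D) t (k + 1)).fun_sub (measurable_T_sigmaS t k)
    exact Measurable.ite (hc k) h1 measurable_const
  · refine Measurable.mono ?_ (sigmaS_le_F t) le_rfl
    refine (@measurable_pi_iff _ _ _ (sigmaS D t) _ _).2 fun k => ?_
    refine measurable_comap_iff.2 ?_
    have : (Subtype.val ∘ fun ω : Omega D => trunc (count t ω) (fun k => X k ω) k) = fun ω =>
        if k < count t ω then (if k + 1 ≤ count t ω then U (k + 1) ω else 0) -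
          (if k ≤ count t ω then U k ω else 0) else (1 : ℝ) := by
      funext ω
      simp only [Function.comp, trunc]
      by_cases h : k < count t ω
      · have : U (k + 1) ω = U k ω + X k ω := Finset.sum_range_succ _ _
        simp [h, h.le, Nat.succ_le_of_lt h, this]
      · simp [h, onePos]
    rw [this]
    have h1 := (measurable_U_sigmaS (D := D) t (k + 1)).fun_sub (measurable_U_sigmaS t k)
    exact Measurable.ite (hc k) h1 measurable_const

/-- Events of `F t` are determined by the path of `S` up to time `t` and by `Θ`. -/
theorem mem_iff_of_measurableSet_F {t : ℝ≥0} {A : Set (Omega D)} (hA : MeasurableSet[F D t] A)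
    {ω ω' : Omega D} (hS : ∀ s ≤ t, S s ω = S s ω') (hΘ : Theta ω = Theta ω') :
    ω ∈ A ↔ ω' ∈ A := by
  -- The sets that do not separate `ω` from `ω'` form a `σ`-algebra, so only the generators of `F D
  -- t` need checking.
  let m : MeasurableSpace (Omega D) :=
    { MeasurableSet' := fun A => ω ∈ A ↔ ω' ∈ A
      measurableSet_empty := Iff.rfl
      measurableSet_compl := fun A h => not_congr h
      measurableSet_iUnion := fun f h => by
        simp only [Set.mem_iUnion]
        exact exists_congr h }
  have hm : F D t ≤ m := by
    refine sup_le (iSup_le fun s => ?_) ?_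
    · rintro _ ⟨B, -, rfl⟩
      change S s ω ∈ B ↔ S s ω' ∈ B
      rw [hS s s.2]
    · rintro _ ⟨B, -, rfl⟩
      change Theta ω ∈ B ↔ Theta ω' ∈ B
      rw [hΘ]
  exact hm A hA

/-- The path with the same first `n` arrivals and claims and no further arrival up to time `t`. -/
noncomputable def stopPath (t : ℝ≥0) (n : ℕ) (w x : ℕ → Pos) (θ : D) : Omega D :=
  ((Function.update w n ⟨t + 1, Set.mem_Ioi.2 (by positivity)⟩, x), θ)

theorem measurable_stopPath (t : ℝ≥0) (n : ℕ) (θ : D) :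
    Measurable fun p : (ℕ → Pos) × (ℕ → Pos) => stopPath t n p.1 p.2 θ := by
  refine Measurable.prodMk (Measurable.prodMk ?_ measurable_snd) measurable_const
  exact (measurable_update_prod n).comp (measurable_fst.prodMk measurable_const)

/-- The interarrival time `t + 1` placed at index `n` forces the next arrival beyond `t`. Both paths
then have the same arrivals and claims up to `t`, hence the same `S`. -/
theorem mem_stopPath_iff {t : ℝ≥0} {A : Set (Omega D)} (hA : MeasurableSet[F D t] A) {n : ℕ}
    {w x : ℕ → Pos} {θ : D} (h2 : t < T (n + 1) ((w, x), θ)) :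
    ((w, x), θ) ∈ A ↔ stopPath t n (trunc n w) (trunc n x) θ ∈ A := by
  refine mem_iff_of_measurableSet_F hA (fun s hs => ?_) rfl
  set ω : Omega D := ((w, x), θ) with hω
  set ω' := stopPath t n (trunc n w) (trunc n x) θ with hω'
  have hW : ∀ k < n, W k ω = W k ω' := by
    intro k hk
    change w k = Function.update (trunc n w) n _ k
    rw [Function.update_of_ne hk.ne, trunc_apply_of_lt hk]
  have hX : ∀ k < n, X k ω = X k ω' := by
    intro k hk
    exact (trunc_apply_of_lt hk x).symm
  have hT : ∀ k ≤ n, T k ω = T k ω' := fun k hk => T_congr fun j hj => hW j (hj.trans_le hk)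
  have h2' : t < T (n + 1) ω' := by
    have : W n ω' = ⟨t + 1, Set.mem_Ioi.2 (by positivity)⟩ := by
      change Function.update (trunc n w) n _ n = _
      rw [Function.update_self]
    rw [T_succ, this]
    have := T_nonneg n ω'
    simp only
    linarith
  have hb := bracket_count (exists_lt_T_mono hs ⟨n + 1, h2⟩)
  have hs' : (s : ℝ) ≤ t := NNReal.coe_le_coe.2 hs
  have hk : count s ω ≤ n := by
    have := (T_strictMono ω).lt_iff_lt.1 ((hb.1.trans hs').trans_lt h2)
    omega
  have hc : count s ω' = count s ω := by
    refine count_eq ?_ ?_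
    · rw [← hT _ hk]; exact hb.1
    · rcases hk.lt_or_eq with h | h
      · rw [← hT _ h]; exact hb.2
      · rw [h]; exact hs'.trans_lt h2'
  rw [S_eq_U, S_eq_U, hc]
  exact Finset.sum_congr rfl fun k hk' => by rw [hX k ((Finset.mem_range.1 hk').trans_le hk)]

end Paths

/-! ### The density process for fixed parameter: tails and measurability. -/

section Density

variable {D : Type*} [MeasurableSpace D]

theorem lintegral_condP (K : Kernel D Pos) [IsMarkovKernel K] (R : Measure Pos)
    [IsProbabilityMeasure R] (θ : D) {h : Omega D → ℝ≥0∞} (hh : Measurable h) :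
    ∫⁻ ω, h ω ∂(condP K R θ) = ∫⁻ w, ∫⁻ x, h ((w, x), θ) ∂(Measure.infinitePi fun _ : ℕ => R)
      ∂(Measure.infinitePi fun _ : ℕ => K θ) := by
  rw [condP, lintegral_prod _ hh.aemeasurable]
  have : ∀ p : (ℕ → Pos) × (ℕ → Pos), ∫⁻ θ', h (p, θ') ∂(Measure.dirac θ) = h (p, θ) := fun p =>
    lintegral_dirac' _ (hh.comp measurable_prodMk_left)
  simp_rw [this]
  rw [lintegral_prod (fun p => h (p, θ)) (hh.comp measurable_prodMk_right).aemeasurable]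

theorem ae_condP_of_ae_W (K : Kernel D Pos) [IsMarkovKernel K] (R : Measure Pos)
    [IsProbabilityMeasure R] (θ : D) {p : (ℕ → Pos) → Prop}
    (h : ∀ᵐ w ∂(Measure.infinitePi fun _ : ℕ => K θ), p w) :
    ∀ᵐ ω ∂(condP K R θ), p fun k => W k ω := by
  have h1 := (measurePreserving_fst (μ := Measure.infinitePi fun _ : ℕ => K θ)
    (ν := Measure.infinitePi fun _ : ℕ => R)).comp (measurePreserving_fst
      (μ := (Measure.infinitePi fun _ : ℕ => K θ).prod (Measure.infinitePi fun _ : ℕ => R))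
      (ν := Measure.dirac θ))
  exact h1.quasiMeasurePreserving.ae h

theorem ae_condP_forall_W (K : Kernel D Pos) [IsMarkovKernel K] (R : Measure Pos)
    [IsProbabilityMeasure R] (θ : D) {p : Pos → Prop} (h : ∀ᵐ w ∂(K θ), p w) :
    ∀ᵐ ω ∂(condP K R θ), ∀ k, p (W k ω) :=
  ae_condP_of_ae_W K R θ (p := fun w => ∀ k, p (w k)) <| ae_all_iff.2 fun k =>
    (measurePreserving_eval_infinitePi (fun _ : ℕ => K θ) k).quasiMeasurePreserving.ae h

theorem ae_condP_exists_lt_T (K : Kernel D Pos) [IsMarkovKernel K] (R : Measure Pos)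
    [IsProbabilityMeasure R] (θ : D) : ∀ᵐ ω ∂(condP K R θ), ∀ t : ℝ, ∃ n, t < T n ω := by
  have h : ∀ᵐ ω ∂(condP K R θ), ∀ j : ℕ, ∃ n, (j : ℝ) < T n ω := ae_all_iff.2 fun j =>
    ae_condP_of_ae_W K R θ (ae_exists_lt_sum (K θ) j)
  filter_upwards [h] with ω hω t
  obtain ⟨j, hj⟩ := exists_nat_ge t
  exact (hω j).imp fun n hn => hj.trans_lt hn

theorem ofReal_one_sub_distr (ν : Measure Pos) [IsProbabilityMeasure ν] (v : ℝ) :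
    ENNReal.ofReal (1 - distr ν v) = ν {w | v < w} := by
  have hm : MeasurableSet {w : Pos | (w : ℝ) ≤ v} :=
    measurableSet_le measurable_subtype_coe measurable_const
  have h : {w : Pos | v < w} = {w : Pos | (w : ℝ) ≤ v}ᶜ := by ext w; simp
  rw [h, distr, ← probReal_compl_eq_one_sub hm, ofReal_measureReal]

theorem one_sub_distr (ν : Measure Pos) [IsProbabilityMeasure ν] (v : ℝ) :
    1 - distr ν v = ν.real {w | v < w} := by
  rw [measureReal_def, ← ofReal_one_sub_distr, ENNReal.toReal_ofReal]
  exact sub_nonneg.2 measureReal_le_one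

theorem one_sub_distr_nonneg (ν : Measure Pos) [IsProbabilityMeasure ν] (v : ℝ) :
    0 ≤ 1 - distr ν v := by
  rw [one_sub_distr]; exact measureReal_nonneg

/-- Division by zero is harmless here: where the old tail vanishes, absolute continuity makes the
new tail vanish too. -/
theorem ofReal_ratio_mul {ν κ : Measure Pos} [IsProbabilityMeasure ν] [IsProbabilityMeasure κ]
    (h : ν ≪ κ) (v : ℝ) :
    ENNReal.ofReal ((1 - distr ν v) / (1 - distr κ v)) * κ {w | v < w} = ν {w | v < w} := by
  rcases eq_or_ne (κ {w | v < w}) 0 with h0 | h0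
  · rw [h0, mul_zero, h h0]
  · have hp : 0 < 1 - distr κ v := by
      rw [← ENNReal.ofReal_pos, ofReal_one_sub_distr]
      exact pos_iff_ne_zero.2 h0
    rw [ENNReal.ofReal_div_of_pos hp, ofReal_one_sub_distr, ofReal_one_sub_distr,
      ENNReal.div_mul_cancel h0 (measure_ne_top _ _)]

theorem measurable_distr (L : Kernel D Pos) [IsMarkovKernel L] :
    Measurable fun p : D × ℝ => distr (L p.1) p.2 := by
  have hs : MeasurableSet {q : (D × ℝ) × Pos | (q.2 : ℝ) ≤ q.1.2} :=
    measurableSet_le (measurable_subtype_coe.comp measurable_snd)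
      (measurable_snd.comp measurable_fst)
  exact (Kernel.measurable_kernel_prodMk_left (κ := L.comap Prod.fst measurable_fst) hs).ennreal_toReal

/-- The value of `Mtilde` at time `t` on the event of `n` arrivals. -/
noncomputable def MtildeOn (K L : Kernel D Pos) (γ : Pos → ℝ) (t : ℝ≥0) (n : ℕ) (θ : D)
    (ω : Omega D) : ℝ :=
  (∏ j ∈ Finset.range n, Real.exp (γ (X j ω)) * (Kernel.rnDeriv L K θ (W j ω)).toReal) *
    ((1 - distr (L θ) (t - T n ω)) / (1 - distr (K θ) (t - T n ω)))

theorem Mtilde_eq (K L : Kernel D Pos) (γ : Pos → ℝ) (θ : D) (t : ℝ≥0) (ω : Omega D) :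
    Mtilde K L γ θ t ω = MtildeOn K L γ t (count t ω) θ ω := rfl

theorem Mtilde_eq_observed (K L : Kernel D Pos) (γ : Pos → ℝ) (θ : D) (t : ℝ≥0) (ω : Omega D) :
    Mtilde K L γ θ t ω = MtildeOn K L γ t (count t ω) θ (observed t ω) := by
  have hT : T (count t ω) (observed t ω) = T (count t ω) ω := T_congr fun k hk => W_observed hk
  rw [Mtilde_eq, MtildeOn, MtildeOn, hT]
  congr 1
  refine Finset.prod_congr rfl fun k hk => ?_
  rw [W_observed (Finset.mem_range.1 hk), X_observed (Finset.mem_range.1 hk)]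

variable (K L : Kernel D Pos) [IsMarkovKernel K] [IsMarkovKernel L]

theorem measurable_MtildeOn {γ : Pos → ℝ} (hγ : Measurable γ) (t : ℝ≥0) (n : ℕ) :
    Measurable fun p : D × Omega D => MtildeOn K L γ t n p.1 p.2 := by
  have hV : Measurable fun p : D × Omega D => (p.1, (t : ℝ) - T n p.2) :=
    measurable_fst.prodMk (measurable_const.sub ((measurable_T n).comp measurable_snd))
  refine Measurable.mul (Finset.measurable_fun_prod _ fun j _ => ?_) ?_
  · refine Measurable.mul ?_ ?_
    · exact Real.measurable_exp.comp (hγ.comp ((measurable_X j).comp measurable_snd))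
    · exact ((Kernel.measurable_rnDeriv L K).comp (measurable_fst.prodMk
        ((measurable_W j).comp measurable_snd))).ennreal_toReal
  · exact (measurable_const.sub ((measurable_distr L).comp hV)).div
      (measurable_const.sub ((measurable_distr K).comp hV))

/-- `Mtilde` factors through `count t` and `observed t`. The parameter map `g` covers both a fixed
`θ` and `Theta`. -/
theorem measurable_Mtilde_comp {γ : Pos → ℝ} (hγ : Measurable γ) (t : ℝ≥0) {g : Omega D → D}
    (hg : Measurable[F D t] g) : Measurable[F D t] fun ω => Mtilde K L γ (g ω) t ω := by
  have h : Measurable fun p : ℕ × (D × Omega D) => MtildeOn K L γ t p.1 p.2.1 p.2.2 :=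
    measurable_from_prod_countable_right fun n => measurable_MtildeOn K L hγ t n
  have h1 : Measurable[F D t] (count t : Omega D → ℕ) :=
    (measurable_count_sigmaS t).mono (sigmaS_le_F t) le_rfl
  have h2 : Measurable[F D t] fun ω : Omega D => (count t ω, (g ω, observed t ω)) :=
    h1.prodMk (hg.prodMk (measurable_observed t))
  have h3 := h.comp h2
  have h4 : (fun ω => Mtilde K L γ (g ω) t ω) =
      (fun p : ℕ × (D × Omega D) => MtildeOn K L γ t p.1 p.2.1 p.2.2) ∘
        fun ω => (count t ω, (g ω, observed t ω)) :=
    funext fun ω => Mtilde_eq_observed K L γ (g ω) t ω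
  rw [h4]
  exact h3

theorem measurable_Mtilde {γ : Pos → ℝ} (hγ : Measurable γ) (t : ℝ≥0) (θ : D) :
    Measurable[F D t] (Mtilde K L γ θ t) :=
  measurable_Mtilde_comp K L hγ t (g := fun _ => θ) measurable_const

theorem Mtilde_nonneg (γ : Pos → ℝ) (θ : D) (t : ℝ≥0) (ω : Omega D) : 0 ≤ Mtilde K L γ θ t ω :=
  mul_nonneg (Finset.prod_nonneg fun _ _ => mul_nonneg (Real.exp_pos _).le ENNReal.toReal_nonneg)
    (div_nonneg (one_sub_distr_nonneg _ _) (one_sub_distr_nonneg _ _))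

theorem measurableSet_arrivals (t : ℝ≥0) (n : ℕ) : MeasurableSet (arrivals D t n) :=
  (measurableSet_le (measurable_T n) measurable_const).inter
    (measurableSet_lt measurable_const (measurable_T (n + 1)))

end Density

/-! ### The change-of-measure identity for fixed parameter. -/

section DensityTheta

variable {D : Type*} [MeasurableSpace D]

open Classical in
/-- Indicator, in terms of the first `n` arrivals and claims, of `A` and of `T n ≤ t`. -/
noncomputable def pastInd (A : Set (Omega D)) (t : ℝ≥0) (n : ℕ) (θ : D) (w x : ℕ → Pos) : ℝ≥0∞ :=
  if stopPath t n w x θ ∈ A ∧ ∑ k ∈ Finset.range n, (w k : ℝ) ≤ t then 1 else 0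

theorem measurable_pastInd {A : Set (Omega D)} (hA : MeasurableSet A) (t : ℝ≥0) (n : ℕ) (θ : D) :
    Measurable fun p : (ℕ → Pos) × (ℕ → Pos) => pastInd A t n θ p.1 p.2 := by
  have h : MeasurableSet {p : (ℕ → Pos) × (ℕ → Pos) |
      ∑ k ∈ Finset.range n, (p.1 k : ℝ) ≤ t} := measurableSet_le (by fun_prop) measurable_const
  exact Measurable.ite ((measurable_stopPath t n θ hA).inter h) measurable_const measurable_const

theorem sum_trunc (n : ℕ) (w : ℕ → Pos) :
    ∑ k ∈ Finset.range n, (trunc n w k : ℝ) = ∑ k ∈ Finset.range n, (w k : ℝ) :=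
  Finset.sum_congr rfl fun k hk => by rw [trunc_apply_of_lt (Finset.mem_range.1 hk)]

/-- This separates the past, a function of the first `n` arrivals and claims, from the survival
condition, the only place where `W n` enters. -/
theorem indicator_arrivals {A : Set (Omega D)} {t : ℝ≥0} (hA : MeasurableSet[F D t] A) (n : ℕ)
    (θ : D) (w x : ℕ → Pos) (c : ℝ≥0∞) :
    (A ∩ arrivals D t n).indicator (fun _ => c) ((w, x), θ) =
      pastInd A t n θ (trunc n w) (trunc n x) * c *
        {v : Pos | t - ∑ k ∈ Finset.range n, (trunc n w k : ℝ) < v}.indicator 1 (w n) := by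
  have hiff : ((w, x), θ) ∈ A ∩ arrivals D t n ↔
      (stopPath t n (trunc n w) (trunc n x) θ ∈ A ∧
        ∑ k ∈ Finset.range n, (trunc n w k : ℝ) ≤ t) ∧
          t - ∑ k ∈ Finset.range n, (trunc n w k : ℝ) < w n := by
    rw [sum_trunc, Set.mem_inter_iff, arrivals, Set.mem_ofPred_eq]
    have hT : T n (((w, x), θ) : Omega D) = ∑ k ∈ Finset.range n, (w k : ℝ) := rfl
    have hW : (W n (((w, x), θ) : Omega D) : ℝ) = w n := rfl
    rw [T_succ, hT, hW, sub_lt_iff_lt_add']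
    by_cases h : (t : ℝ) < ∑ k ∈ Finset.range n, (w k : ℝ) + w n
    · have := mem_stopPath_iff hA (n := n) (w := w) (x := x) (θ := θ) (by rw [T_succ, hT, hW]; exact h)
      rw [this]
      simp [h]
    · simp [h]
  unfold pastInd
  by_cases h1 : stopPath t n (trunc n w) (trunc n x) θ ∈ A ∧
      ∑ k ∈ Finset.range n, (trunc n w k : ℝ) ≤ t
  · rw [if_pos h1, one_mul]
    by_cases h2 : t - ∑ k ∈ Finset.range n, (trunc n w k : ℝ) < w n
    · rw [Set.indicator_of_mem (hiff.2 ⟨h1, h2⟩), Set.indicator_of_mem (by exact h2)]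
      simp
    · rw [Set.indicator_of_notMem (fun h => h2 (hiff.1 h).2), Set.indicator_of_notMem (by exact h2),
        mul_zero]
  · rw [if_neg h1, Set.indicator_of_notMem (fun h => h1 (hiff.1 h).1)]
    simp

/-- `W n` is independent of the past and occurs only in the survival indicator. Integrating it out
leaves the tail of `K θ`. -/
theorem setLIntegral_arrivals (K : Kernel D Pos) [IsMarkovKernel K] (R : Measure Pos)
    [IsProbabilityMeasure R] (θ : D) {A : Set (Omega D)} {t : ℝ≥0} (hA : MeasurableSet[F D t] A)
    (n : ℕ) {g : (ℕ → Pos) → (ℕ → Pos) → ℝ≥0∞}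
    (hg : Measurable fun p : (ℕ → Pos) × (ℕ → Pos) => g p.1 p.2) {G : Omega D → ℝ≥0∞}
    (hG : Measurable G)
    (hGg : ∀ w x, ((w, x), θ) ∈ arrivals D t n → G ((w, x), θ) = g (trunc n w) (trunc n x)) :
    ∫⁻ ω in A ∩ arrivals D t n, G ω ∂(condP K R θ) =
      ∫⁻ w, ∫⁻ x, pastInd A t n θ (trunc n w) (trunc n x) * g (trunc n w) (trunc n x) *
        K θ {v : Pos | t - ∑ k ∈ Finset.range n, (trunc n w k : ℝ) < v}
          ∂(Measure.infinitePi fun _ : ℕ => R) ∂(Measure.infinitePi fun _ : ℕ => K θ) := by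
  have hA' : MeasurableSet A := (F D).le t A hA
  have hm := hA'.inter (measurableSet_arrivals (D := D) t n)
  rw [← lintegral_indicator hm, lintegral_condP K R θ (hG.indicator hm)]
  have h1 : ∀ w x : ℕ → Pos, (A ∩ arrivals D t n).indicator G ((w, x), θ) =
      pastInd A t n θ (trunc n w) (trunc n x) * g (trunc n w) (trunc n x) *
        {v : Pos | t - ∑ k ∈ Finset.range n, (trunc n w k : ℝ) < v}.indicator 1 (w n) := by
    intro w x
    rw [← indicator_arrivals hA n θ w x]
    by_cases h : ((w, x), θ) ∈ A ∩ arrivals D t n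
    · rw [Set.indicator_of_mem h, Set.indicator_of_mem h, hGg w x h.2]
    · rw [Set.indicator_of_notMem h, Set.indicator_of_notMem h]
  simp_rw [h1]
  have hPg : Measurable fun p : (ℕ → Pos) × (ℕ → Pos) =>
      pastInd A t n θ p.1 (trunc n p.2) * g p.1 (trunc n p.2) :=
    ((measurable_pastInd hA' t n θ).mul hg).comp
      (measurable_fst.prodMk ((measurable_trunc n).comp measurable_snd))
  have hPg' : ∀ w, Measurable fun x => pastInd A t n θ (trunc n w) (trunc n x) *
      g (trunc n w) (trunc n x) := fun w => hPg.comp measurable_prodMk_left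
  have hset : ∀ a : ℝ, MeasurableSet {v : Pos | a < v} := fun a =>
    measurableSet_lt measurable_const measurable_subtype_coe
  have h2 : ∀ (w : ℕ → Pos) (c : ℝ≥0∞), ∫⁻ x, pastInd A t n θ (trunc n w) (trunc n x) *
      g (trunc n w) (trunc n x) * c ∂(Measure.infinitePi fun _ : ℕ => R) =
      (∫⁻ x, pastInd A t n θ (trunc n w) (trunc n x) *
        g (trunc n w) (trunc n x) ∂(Measure.infinitePi fun _ : ℕ => R)) * c := fun w c =>
    lintegral_mul_const _ (hPg' w)
  simp_rw [h2]
  rw [lintegral_trunc_eval (K θ) n (g := fun w v => (∫⁻ x, pastInd A t n θ w (trunc n x) *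
      g w (trunc n x) ∂(Measure.infinitePi fun _ : ℕ => R)) *
        {v : Pos | t - ∑ k ∈ Finset.range n, (w k : ℝ) < v}.indicator 1 v)]
  · refine lintegral_congr fun w => ?_
    rw [lintegral_const_mul _ (measurable_one.indicator (hset _)), lintegral_indicator_one (hset _)]
  · refine Measurable.mul ?_ ?_
    · exact (hPg.lintegral_prod_right').comp measurable_fst
    · have hs : MeasurableSet {p : (ℕ → Pos) × Pos |
          t - ∑ k ∈ Finset.range n, (p.1 k : ℝ) < p.2} :=
        measurableSet_lt (by fun_prop) (by fun_prop)
      exact measurable_one.indicator hs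

/-- The law with density `exp ∘ γ` with respect to `R`. -/
noncomputable abbrev expTilt (R : Measure Pos) (γ : Pos → ℝ) : Measure Pos :=
  R.withDensity fun x => ENNReal.ofReal (Real.exp (γ x))

theorem withDensity_ofReal_rnDeriv {K L : Kernel D Pos} [IsMarkovKernel K] [IsMarkovKernel L]
    {θ : D} (h : L θ ≪ K θ) :
    (K θ).withDensity (fun x => ENNReal.ofReal (Kernel.rnDeriv L K θ x).toReal) = L θ := by
  conv_rhs => rw [← Kernel.withDensity_rnDeriv_eq h,
    Kernel.withDensity_apply _ (Kernel.measurable_rnDeriv L K)]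
  refine withDensity_congr_ae ?_
  filter_upwards [Kernel.rnDeriv_ne_top L K (a := θ)] with x hx
  exact ENNReal.ofReal_toReal hx

/-- Both sides become integrals over the first `n` coordinates. The product densities turn `L θ` and
`expTilt R γ` back into `K θ` and `R`, and the tail ratio accounts for the unfinished interarrival
period. -/
theorem condP_inter_arrivals (K L : Kernel D Pos) [IsMarkovKernel K] [IsMarkovKernel L]
    (R : Measure Pos) [IsProbabilityMeasure R] {γ : Pos → ℝ} (hγ : Measurable γ)
    [IsProbabilityMeasure (expTilt R γ)] {θ : D} (h : L θ ≪ K θ) (t : ℝ≥0) {A : Set (Omega D)}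
    (hA : MeasurableSet[F D t] A) (n : ℕ) :
    condP L (expTilt R γ) θ (A ∩ arrivals D t n) =
      ∫⁻ ω in A ∩ arrivals D t n, ENNReal.ofReal (Mtilde K L γ θ t ω) ∂(condP K R θ) := by
  have hA' : MeasurableSet A := (F D).le t A hA
  set f : Pos → ℝ≥0∞ := fun x => ENNReal.ofReal (Kernel.rnDeriv L K θ x).toReal with hf
  have hfm : Measurable f := (Kernel.measurable_rnDeriv_right L K θ).ennreal_toReal.ennreal_ofReal
  set e : Pos → ℝ≥0∞ := fun x => ENNReal.ofReal (Real.exp (γ x)) with he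
  have hem : Measurable e := (Real.measurable_exp.comp hγ).ennreal_ofReal
  have hL : (K θ).withDensity f = L θ := withDensity_ofReal_rnDeriv h
  have : IsProbabilityMeasure ((K θ).withDensity f) := by rw [hL]; infer_instance
  set V : (ℕ → Pos) → ℝ := fun w => t - ∑ k ∈ Finset.range n, (w k : ℝ) with hV
  have hVm : Measurable V := by fun_prop
  have hset : ∀ (M : Kernel D Pos) [IsMarkovKernel M],
      Measurable fun a : ℝ => M θ {v : Pos | a < v} := by
    intro M _
    simp_rw [← ofReal_one_sub_distr]
    exact (measurable_const.sub ((measurable_distr M).comp measurable_prodMk_left)).ennreal_ofReal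
  rw [← setLIntegral_one, setLIntegral_arrivals L (expTilt R γ) θ hA n (g := fun _ _ => 1)
    measurable_const measurable_const (fun _ _ _ => rfl)]
  set ratio : (ℕ → Pos) → ℝ≥0∞ := fun w =>
    ENNReal.ofReal ((1 - distr (L θ) (V w)) / (1 - distr (K θ) (V w))) with hratio
  have hrm : Measurable ratio := by
    refine Measurable.ennreal_ofReal (Measurable.div ?_ ?_)
    · exact measurable_const.sub (((measurable_distr L).comp measurable_prodMk_left).comp hVm)
    · exact measurable_const.sub (((measurable_distr K).comp measurable_prodMk_left).comp hVm)
  have hMm : Measurable fun ω => ENNReal.ofReal (Mtilde K L γ θ t ω) :=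
    ((measurable_Mtilde K L hγ t θ).mono ((F D).le t) le_rfl).ennreal_ofReal
  rw [setLIntegral_arrivals K R θ hA n
    (g := fun w x => (∏ j ∈ Finset.range n, f (w j)) * (∏ j ∈ Finset.range n, e (x j)) * ratio w)
    (by fun_prop) hMm]
  · have hP := measurable_pastInd hA' t n θ
    have hPr : ∀ w, Measurable fun x => pastInd A t n θ w x := fun w =>
      hP.comp measurable_prodMk_left
    simp only [mul_one]
    have h1 : ∀ w, ∫⁻ x, pastInd A t n θ (trunc n w) (trunc n x) * L θ {v : Pos | V (trunc n w) < v}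
        ∂(Measure.infinitePi fun _ : ℕ => expTilt R γ) =
        ∫⁻ x, (∏ j ∈ Finset.range n, e (x j)) * (pastInd A t n θ (trunc n w) (trunc n x) *
          L θ {v : Pos | V (trunc n w) < v}) ∂(Measure.infinitePi fun _ : ℕ => R) := fun w =>
      lintegral_trunc_withDensity R hem n (h := fun x => pastInd A t n θ (trunc n w) x *
          L θ {v : Pos | V (trunc n w) < v}) ((hPr _).mul_const _)
    simp_rw [hV] at h1
    simp_rw [h1]
    have h2 := lintegral_trunc_withDensity (K θ) hfm n (h := fun w =>
      ∫⁻ x, (∏ j ∈ Finset.range n, e (x j)) * (pastInd A t n θ w (trunc n x) *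
          L θ {v : Pos | V w < v}) ∂(Measure.infinitePi fun _ : ℕ => R)) (by
        refine Measurable.lintegral_prod_right' (f := fun p : (ℕ → Pos) × (ℕ → Pos) =>
          (∏ j ∈ Finset.range n, e (p.2 j)) * (pastInd A t n θ p.1 (trunc n p.2) *
          L θ {v : Pos | V p.1 < v})) ?_
        refine Measurable.mul (by fun_prop) (Measurable.mul ?_ ?_)
        · exact hP.comp (measurable_fst.prodMk ((measurable_trunc n).comp measurable_snd))
        · exact (hset L).comp (hVm.comp measurable_fst))
    simp_rw [hL, hV] at h2
    rw [h2]
    refine lintegral_congr fun w => ?_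
    have hmeas : Measurable fun x => (∏ j ∈ Finset.range n, e (x j)) *
        (pastInd A t n θ (trunc n w) (trunc n x) * L θ {v : Pos | V (trunc n w) < v}) := by
      have := (hPr (trunc n w)).comp (measurable_trunc n)
      exact Measurable.mul (by fun_prop) (Measurable.mul_const this _)
    rw [← lintegral_const_mul _ hmeas]
    refine lintegral_congr fun x => ?_
    have ha : ∏ j ∈ Finset.range n, f (trunc n w j) = ∏ j ∈ Finset.range n, f (w j) :=
      Finset.prod_congr rfl fun k hk => by rw [trunc_apply_of_lt (Finset.mem_range.1 hk)]
    have hb : ∏ j ∈ Finset.range n, e (trunc n x j) = ∏ j ∈ Finset.range n, e (x j) :=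
      Finset.prod_congr rfl fun k hk => by rw [trunc_apply_of_lt (Finset.mem_range.1 hk)]
    -- The old tail left by integrating out `W n` is converted into the new one by the last factor
    -- of `Mtilde`.
    have hc : ratio (trunc n w) * K θ {v : Pos | V (trunc n w) < v} =
      L θ {v : Pos | V (trunc n w) < v} := ofReal_ratio_mul h _
    simp only [hV] at hc
    rw [← hc, ha, hb]
    ring
  · intro w x hwx
    rw [Mtilde_eq, count_of_mem_arrivals hwx, MtildeOn]
    have hT : t - T n (((w, x), θ) : Omega D) = V (trunc n w) := by
      rw [hV]; simp only [sum_trunc]; rfl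
    rw [hT, ENNReal.ofReal_mul, ENNReal.ofReal_prod_of_nonneg, ← Finset.prod_mul_distrib]
    · congr 1
      refine Finset.prod_congr rfl fun k hk => ?_
      rw [trunc_apply_of_lt (Finset.mem_range.1 hk), trunc_apply_of_lt (Finset.mem_range.1 hk),
        mul_comm, ENNReal.ofReal_mul ENNReal.toReal_nonneg]
      rfl
    · exact fun _ _ => mul_nonneg (Real.exp_pos _).le ENNReal.toReal_nonneg
    · exact Finset.prod_nonneg fun _ _ => mul_nonneg (Real.exp_pos _).le ENNReal.toReal_nonneg

theorem setLIntegral_eq_tsum_arrivals {P : Measure (Omega D)}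
    (hP : ∀ᵐ ω ∂P, ∀ t : ℝ, ∃ n, t < T n ω) (t : ℝ≥0) {A : Set (Omega D)} (hA : MeasurableSet A)
    (g : Omega D → ℝ≥0∞) :
    ∫⁻ ω in A, g ω ∂P = ∑' n, ∫⁻ ω in A ∩ arrivals D t n, g ω ∂P := by
  rw [← lintegral_iUnion (fun n => hA.inter (measurableSet_arrivals t n))]
  · refine setLIntegral_congr ?_
    filter_upwards [hP] with ω hω
    have : ω ∈ ⋃ n, arrivals D t n := by
      obtain ⟨n, hn⟩ := exists_bracket (hω t)
      exact Set.mem_iUnion.2 ⟨n, hn⟩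
    rw [← Set.inter_iUnion]
    exact propext ⟨fun h => ⟨h, this⟩, fun h => h.1⟩
  · intro i j hij
    refine Set.disjoint_left.2 fun ω hi hj => hij ?_
    rw [← count_of_mem_arrivals hi.2, ← count_of_mem_arrivals hj.2]

theorem condP_apply_eq (K L : Kernel D Pos) [IsMarkovKernel K] [IsMarkovKernel L]
    (R : Measure Pos) [IsProbabilityMeasure R] {γ : Pos → ℝ} (hγ : Measurable γ)
    [IsProbabilityMeasure (expTilt R γ)] {θ : D} (h : L θ ≪ K θ) (t : ℝ≥0) {A : Set (Omega D)}
    (hA : MeasurableSet[F D t] A) :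
    condP L (expTilt R γ) θ A =
      ∫⁻ ω in A, ENNReal.ofReal (Mtilde K L γ θ t ω) ∂(condP K R θ) := by
  have hA' : MeasurableSet A := (F D).le t A hA
  rw [← setLIntegral_one, setLIntegral_eq_tsum_arrivals (ae_condP_exists_lt_T L _ θ) t hA',
    setLIntegral_eq_tsum_arrivals (ae_condP_exists_lt_T K R θ) t hA']
  refine tsum_congr fun n => ?_
  rw [setLIntegral_one, condP_inter_arrivals K L R hγ h t hA n]

end DensityTheta

/-! ### Consequences of a progressive density: martingale property, equivalence, uniqueness. -/

section ProgressiveDensity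

variable {D : Type*} [MeasurableSpace D]

theorem isProgDensity_of_lintegral {P Q : Measure (Omega D)} [IsFiniteMeasure Q]
    {M : ℝ≥0 → Omega D → ℝ} (hM : ∀ t, Measurable (M t)) (h0 : ∀ t, 0 ≤ᵐ[P] M t)
    (h : ∀ t A, MeasurableSet[F D t] A → Q A = ∫⁻ ω in A, ENNReal.ofReal (M t ω) ∂P) :
    IsProgDensity P Q M := by
  intro u t hut A hA
  have hA' := h t A ((F D).mono hut A hA)
  have h0' := ae_restrict_of_ae (s := A) (h0 t)
  have hint : IntegrableOn (M t) A P := by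
    refine ⟨(hM t).aestronglyMeasurable, ?_⟩
    rw [hasFiniteIntegral_iff_ofReal h0', ← hA']
    exact measure_lt_top _ _
  refine ⟨hint, ?_⟩
  rw [measureReal_def, hA', integral_eq_lintegral_of_nonneg_ae h0' hint.1]

theorem IsProgDensity.congr_ae {P Q : Measure (Omega D)} {M M' : ℝ≥0 → Omega D → ℝ}
    (h : IsProgDensity P Q M) (hM : ∀ t, M t =ᵐ[P] M' t) : IsProgDensity P Q M' := by
  intro u t hut A hA
  obtain ⟨h1, h2⟩ := h u t hut A hA
  have := ae_restrict_of_ae (s := A) (hM t)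
  exact ⟨h1.congr this, h2.trans (integral_congr_ae this)⟩

theorem IsProgDensity.isPosMartingale {P Q : Measure (Omega D)} [IsFiniteMeasure P]
    [IsProbabilityMeasure Q] {M : ℝ≥0 → Omega D → ℝ} (h : IsProgDensity P Q M)
    (hM : ∀ t, Measurable[F D t] (M t)) (h0 : ∀ t, ∀ᵐ ω ∂P, 0 < M t ω) : IsPosMartingale P M := by
  have hint : ∀ t, Integrable (M t) P := fun t => by
    have := (h t t le_rfl Set.univ MeasurableSet.univ).1
    rwa [integrableOn_univ] at this
  refine ⟨⟨fun t => (hM t).stronglyMeasurable, fun s t hst => ?_⟩, fun t => ⟨h0 t, ?_⟩⟩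
  -- Over an event of `F D s`, both `M s` and `M t` integrate to its `Q`-probability.
  · refine (ae_eq_condExp_of_forall_setIntegral_eq ((F D).le s) (hint t)
      (fun A hA _ => (hint s).integrableOn) (fun A hA _ => ?_)
      (hM s).stronglyMeasurable.aestronglyMeasurable).symm
    rw [← (h s s le_rfl A hA).2, ← (h s t hst A hA).2]
  · have := (h t t le_rfl Set.univ MeasurableSet.univ).2
    rw [Measure.restrict_univ] at this
    rw [← this, probReal_univ]

theorem IsProgDensity.progEquiv {P Q : Measure (Omega D)} [IsFiniteMeasure Q]
    {M : ℝ≥0 → Omega D → ℝ} (h : IsProgDensity P Q M) (h0 : ∀ t, ∀ᵐ ω ∂P, 0 < M t ω) :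
    ProgEquiv Q P := by
  intro t A hA
  obtain ⟨h1, h2⟩ := h t t le_rfl A hA
  have hA' : MeasurableSet A := (F D).le t A hA
  have hpos : ∀ᵐ ω ∂(P.restrict A), 0 < M t ω := ae_restrict_of_ae (h0 t)
  rw [← measureReal_eq_zero_iff, h2,
    integral_eq_zero_iff_of_nonneg_ae (hpos.mono fun _ h => h.le) h1]
  constructor
  · intro hz
    have hf : ∀ᵐ ω ∂(P.restrict A), False := by
      filter_upwards [hpos, hz] with ω h1 h2
      exact h1.ne' h2
    rw [ae_iff] at hf
    simpa using hf
  · intro hz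
    rw [Measure.restrict_eq_zero.2 hz]
    exact ae_zero.le (by simp) 

theorem IsProgDensity.eq_of_measurableSet {P Q Q' : Measure (Omega D)} [IsFiniteMeasure Q]
    [IsFiniteMeasure Q'] {M : ℝ≥0 → Omega D → ℝ} (h : IsProgDensity P Q M)
    (h' : IsProgDensity P Q' M) (t : ℝ≥0) {A : Set (Omega D)} (hA : MeasurableSet[F D t] A) :
    Q A = Q' A := by
  have := (h t t le_rfl A hA).2.trans (h' t t le_rfl A hA).2.symm
  rwa [measureReal_def, measureReal_def, ENNReal.toReal_eq_toReal_iff' (measure_ne_top _ _)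
    (measure_ne_top _ _)] at this

theorem measurable_truncPath (k : ℕ) : Measurable (truncPath k : Omega D → Omega D) := by
  refine Measurable.prodMk (Measurable.prodMk ?_ ?_) measurable_Theta
  · exact (measurable_trunc k).comp (measurable_pi_iff.2 fun j => measurable_W j)
  · exact (measurable_trunc k).comp (measurable_pi_iff.2 fun j => measurable_X j)

/-- Events depending on finitely many arrivals and claims form a generating `π`-system. They are the
events that become observable in finite time. -/
theorem generateFrom_truncPath : (inferInstance : MeasurableSpace (Omega D)) =
    MeasurableSpace.generateFrom {s | ∃ (k : ℕ) (A : Set (Omega D)), MeasurableSet A ∧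
      truncPath k ⁻¹' A = s} := by
  refine le_antisymm ?_ (MeasurableSpace.generateFrom_le ?_)
  · set C := {s | ∃ (k : ℕ) (A : Set (Omega D)), MeasurableSet A ∧ truncPath k ⁻¹' A = s}
    have hW : ∀ j, Measurable[MeasurableSpace.generateFrom C] (W j : Omega D → Pos) := by
      intro j B hB
      refine MeasurableSpace.measurableSet_generateFrom ⟨j + 1, W j ⁻¹' B, measurable_W j hB, ?_⟩
      ext ω
      change trunc (j + 1) (fun j => W j ω) j ∈ B ↔ W j ω ∈ B
      rw [trunc_apply_of_lt j.lt_succ_self]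
    have hX : ∀ j, Measurable[MeasurableSpace.generateFrom C] (X j : Omega D → Pos) := by
      intro j B hB
      refine MeasurableSpace.measurableSet_generateFrom ⟨j + 1, X j ⁻¹' B, measurable_X j hB, ?_⟩
      ext ω
      change trunc (j + 1) (fun j => X j ω) j ∈ B ↔ X j ω ∈ B
      rw [trunc_apply_of_lt j.lt_succ_self]
    have hΘ : Measurable[MeasurableSpace.generateFrom C] (Theta : Omega D → D) := by
      intro B hB
      exact MeasurableSpace.measurableSet_generateFrom
        ⟨0, Theta ⁻¹' B, measurable_Theta hB, rfl⟩
    have hid : Measurable[MeasurableSpace.generateFrom C] (fun ω : Omega D => ω) :=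
      Measurable.prodMk (Measurable.prodMk
        ((@measurable_pi_iff _ _ _ (MeasurableSpace.generateFrom C) _ _).2 hW)
        ((@measurable_pi_iff _ _ _ (MeasurableSpace.generateFrom C) _ _).2 hX)) hΘ
    exact fun A hA => hid hA
  · rintro _ ⟨k, A, hA, rfl⟩
    exact measurable_truncPath k hA

/-- Probability measures that agree on all `F t` are equal if the arrival times are almost surely
unbounded under one of them. -/
theorem eq_of_forall_F {Q Q' : Measure (Omega D)} [IsProbabilityMeasure Q]
    [IsProbabilityMeasure Q'] (hQ : ∀ᵐ ω ∂Q, ∀ t : ℝ, ∃ n, t < T n ω)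
    (h : ∀ t A, MeasurableSet[F D t] A → Q A = Q' A) : Q = Q' := by
  -- Only an inequality is accessible at first, since explosion is excluded under `Q` alone. Passing
  -- to complements yields the reverse inequality.
  have hle : ∀ k (A : Set (Omega D)), MeasurableSet A →
      Q (truncPath k ⁻¹' A) ≤ Q' (truncPath k ⁻¹' A) := by
    intro k A hA
    set B := truncPath k ⁻¹' A with hB
    have hBm : MeasurableSet B := measurable_truncPath k hA
    -- On `C j` the first `k` arrivals and claims are known by time `j`, so `B ∩ C j` lies in `F D
    -- j`. Almost every path under `Q` is eventually in `C j`.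
    set C : ℕ → Set (Omega D) := fun j => {ω | k ≤ count (j : ℝ≥0) ω} with hC
    have hCm : ∀ j : ℕ, MeasurableSet[F D j] (C j) := fun j =>
      ((measurable_count_sigmaS (j : ℝ≥0)).mono (sigmaS_le_F _) le_rfl) measurableSet_Ici
    have hBC : ∀ j : ℕ, MeasurableSet[F D j] (B ∩ C j) := by
      intro j
      have : B ∩ C j = observed (j : ℝ≥0) ⁻¹' B ∩ C j := by
        ext ω
        simp only [Set.mem_inter_iff]
        refine and_congr_left fun hω => ?_
        rw [hB, Set.mem_preimage, Set.mem_preimage, Set.mem_preimage, truncPath_observed hω]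
      rw [this]
      exact (measurable_observed _ hBm).inter (hCm j)
    have hlim : Tendsto (fun j => Q (B ∩ C j)) atTop (nhds (Q B)) := by
      refine tendsto_measure_of_ae_tendsto_indicator_of_isFiniteMeasure atTop hBm
        (fun j => (F D).le _ _ (hBC j)) ?_
      filter_upwards [hQ] with ω hω
      have hk := exists_nat_ge (T k ω)
      obtain ⟨j₀, hj₀⟩ := hk
      filter_upwards [eventually_ge_atTop j₀] with j hj
      have : ω ∈ C j := by
        change k ≤ count (j : ℝ≥0) ω
        rw [le_count_iff (hω _)]
        refine hj₀.trans ?_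
        simpa using hj
      exact ⟨fun h => h.1, fun h => ⟨h, this⟩⟩
    refine le_of_tendsto' hlim fun j => ?_
    rw [h j _ (hBC j)]
    exact measure_mono Set.inter_subset_left
  refine ext_of_generate_finite _ generateFrom_truncPath ?_ ?_ (by simp)
  · rintro _ ⟨k, A, hA, rfl⟩ _ ⟨l, B, hB, rfl⟩ -
    refine ⟨max k l, truncPath k ⁻¹' A ∩ truncPath l ⁻¹' B,
      (measurable_truncPath k hA).inter (measurable_truncPath l hB), ?_⟩
    ext ω
    simp [truncPath_truncPath]
  · rintro _ ⟨k, A, hA, rfl⟩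
    refine le_antisymm (hle k A hA) ?_
    have := hle k Aᶜ hA.compl
    rw [Set.preimage_compl, prob_compl_eq_one_sub (measurable_truncPath k hA),
      prob_compl_eq_one_sub (measurable_truncPath k hA)] at this
    exact (ENNReal.sub_le_sub_iff_left prob_le_one ENNReal.one_ne_top).1 this

end ProgressiveDensity

/-! ### Mixtures: disintegration over the parameter and the mixed density. -/

section Mixture

variable {D : Type*} [MeasurableSpace D]

theorem measurable_W_seq : Measurable fun (ω : Omega D) (k : ℕ) => W k ω :=
  measurable_pi_iff.2 measurable_W

theorem measurable_X_seq : Measurable fun (ω : Omega D) (k : ℕ) => X k ω :=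
  measurable_pi_iff.2 measurable_X

/-- The measures `P_θ` as a Markov kernel. -/
noncomputable def condKernel (K : Kernel D Pos) [IsMarkovKernel K] (R : Measure Pos)
    [IsProbabilityMeasure R] : Kernel D (Omega D) := ⟨condP K R, measurable_condP K R⟩

instance instIsMarkovKernelCondKernel (K : Kernel D Pos) [IsMarkovKernel K] (R : Measure Pos)
    [IsProbabilityMeasure R] : IsMarkovKernel (condKernel K R) :=
  ⟨fun θ => instIsProbabilityMeasureCondP K R θ⟩

section

variable (ν : Measure D) (K : Kernel D Pos) [IsMarkovKernel K] (R : Measure Pos)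
  [IsProbabilityMeasure R]

theorem lintegral_mixP {h : Omega D → ℝ≥0∞} (hh : Measurable h) :
    ∫⁻ ω, h ω ∂(mixP ν K R) = ∫⁻ θ, ∫⁻ ω, h ω ∂(condP K R θ) ∂ν :=
  Measure.lintegral_bind (measurable_condP K R).aemeasurable hh.aemeasurable

theorem mixP_apply {A : Set (Omega D)} (hA : MeasurableSet A) :
    mixP ν K R A = ∫⁻ θ, condP K R θ A ∂ν :=
  Measure.bind_apply hA (measurable_condP K R).aemeasurable

theorem measurable_condP_apply {A : Set (Omega D)} (hA : MeasurableSet A) :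
    Measurable fun θ => condP K R θ A :=
  (Measure.measurable_coe hA).comp (measurable_condP K R)

theorem condP_prod (θ : D) {A B : Set (ℕ → Pos)} {C : Set D} (hC : MeasurableSet C) :
    condP K R θ ((A ×ˢ B) ×ˢ C) = (Measure.infinitePi fun _ : ℕ => K θ) A *
      (Measure.infinitePi fun _ : ℕ => R) B * C.indicator 1 θ := by
  rw [condP, Measure.prod_prod, Measure.prod_prod, Measure.dirac_apply' _ hC]

theorem mixP_prod {A B : Set (ℕ → Pos)} {C : Set D} (hA : MeasurableSet A) (hB : MeasurableSet B)
    (hC : MeasurableSet C) :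
    mixP ν K R ((A ×ˢ B) ×ˢ C) = (∫⁻ θ in C, (Measure.infinitePi fun _ : ℕ => K θ) A ∂ν) *
      (Measure.infinitePi fun _ : ℕ => R) B := by
  rw [mixP_apply _ _ _ ((hA.prod hB).prod hC), ← lintegral_indicator hC]
  simp_rw [condP_prod K R _ hC]
  have hm : Measurable fun θ => (Measure.infinitePi fun _ : ℕ => K θ) A :=
    (Measure.measurable_coe hA).comp (measurable_infinitePi K)
  rw [← lintegral_mul_const _ (hm.indicator hC)]
  refine lintegral_congr fun θ => ?_
  by_cases h : θ ∈ C <;> simp [h]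

theorem mixP_map_Theta : (mixP ν K R).map Theta = ν := by
  ext C hC
  have := mixP_prod ν K R MeasurableSet.univ MeasurableSet.univ hC
  rw [Measure.map_apply measurable_Theta hC]
  have h2 : (Theta ⁻¹' C : Set (Omega D)) = (Set.univ ×ˢ Set.univ) ×ˢ C := by
    ext ω; simp [Theta]
  rw [h2, this]
  simp

/-- The disintegration behind `condExp_mixP`: conditional expectation given `Θ` is integration
against `condP K R (Theta ω)`. -/
theorem mixP_map_prodMk_Theta [SFinite ν] : (mixP ν K R).map (fun ω => (Theta ω, ω)) =
    ν ⊗ₘ condKernel K R := by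
  have hf : Measurable fun ω : Omega D => (Theta ω, ω) := measurable_Theta.prodMk measurable_id
  ext A hA
  rw [Measure.map_apply hf hA, mixP_apply _ _ _ (hf hA), Measure.compProd_apply hA]
  refine lintegral_congr fun θ => ?_
  change _ = condP K R θ (Prod.mk θ ⁻¹' A)
  rw [← lintegral_indicator_one (hf hA), ← lintegral_indicator_one (measurable_prodMk_left hA),
    lintegral_condP _ _ _ (measurable_one.indicator (hf hA)),
    lintegral_condP _ _ _ (measurable_one.indicator (measurable_prodMk_left hA))]
  rfl

theorem condExp_mixP [IsProbabilityMeasure ν] {f : Omega D → ℝ} (hf : Integrable f (mixP ν K R))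
    (hfm : Measurable f) :
    (mixP ν K R)[f | sigmaTheta D] =ᵐ[mixP ν K R] fun ω => ∫ ω', f ω' ∂(condP K R (Theta ω)) := by
  have hg : Measurable fun ω : Omega D => (Theta ω, ω) := measurable_Theta.prodMk measurable_id
  have hf2 : Measurable fun p : D × Omega D => f p.2 := hfm.comp measurable_snd
  have hsm : StronglyMeasurable fun θ => ∫ ω', f ω' ∂(condP K R θ) :=
    hfm.stronglyMeasurable.integral_kernel (κ := condKernel K R)
  have hf' : Integrable (fun p : D × Omega D => f p.2) (ν ⊗ₘ condKernel K R) := by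
    rw [← mixP_map_prodMk_Theta, integrable_map_measure
      hf2.aestronglyMeasurable hg.aemeasurable]
    exact hf
  have hint : Integrable (fun θ => ∫ ω', f ω' ∂(condP K R θ)) ν := hf'.integral_compProd
  have hint' : Integrable (fun ω => ∫ ω', f ω' ∂(condP K R (Theta ω))) (mixP ν K R) := by
    have h2 := hint
    rw [← mixP_map_Theta ν K R] at h2
    exact h2.comp_measurable measurable_Theta
  refine (ae_eq_condExp_of_forall_setIntegral_eq measurable_Theta.comap_le hf
    (fun A hA _ => hint'.integrableOn) ?_ ?_).symm
  · rintro _ ⟨C, hC, rfl⟩ -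
    have h1 : ∫ ω in Theta ⁻¹' C, f ω ∂(mixP ν K R) =
        ∫ p in C ×ˢ Set.univ, f p.2 ∂(ν ⊗ₘ condKernel K R) := by
      rw [← mixP_map_prodMk_Theta, setIntegral_map (hC.prod MeasurableSet.univ)
        hf2.aestronglyMeasurable hg.aemeasurable]
      congr 2
      ext ω; simp
    rw [h1, Measure.setIntegral_compProd hC MeasurableSet.univ hf'.integrableOn]
    have h2 := setIntegral_map (μ := mixP ν K R) hC hsm.aestronglyMeasurable
      measurable_Theta.aemeasurable
    rw [← h2, mixP_map_Theta]
    simp only [Measure.restrict_univ]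
    rfl
  · exact (hsm.comp_measurable (Measurable.of_comap_le le_rfl)).aestronglyMeasurable

theorem condExp_mixP_indicator [IsProbabilityMeasure ν] {A : Set (Omega D)} (hA : MeasurableSet A) :
    (mixP ν K R)⟦A | sigmaTheta D⟧ =ᵐ[mixP ν K R] fun ω => (condP K R (Theta ω)).real A := by
  refine (condExp_mixP ν K R ((integrable_const 1).indicator hA)
    (measurable_const.indicator hA)).trans (ae_of_all _ fun ω => ?_)
  simp only
  rw [integral_indicator hA]
  simp

theorem ae_mixP_Theta {p : D → Prop} (h : ∀ᵐ θ ∂ν, p θ) : ∀ᵐ ω ∂(mixP ν K R), p (Theta ω) := by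
  rw [← mixP_map_Theta ν K R] at h
  exact ae_of_ae_map measurable_Theta.aemeasurable h

theorem ae_mixP_forall_W {q : D → Pos → Prop} (hq : MeasurableSet {p : D × Pos | q p.1 p.2})
    (h : ∀ᵐ θ ∂ν, ∀ᵐ w ∂(K θ), q θ w) : ∀ᵐ ω ∂(mixP ν K R), ∀ k, q (Theta ω) (W k ω) := by
  refine ae_all_iff.2 fun k => ?_
  have hs : MeasurableSet {ω : Omega D | ¬ q (Theta ω) (W k ω)} :=
    (measurable_Theta.prodMk (measurable_W k)) hq.compl
  rw [ae_iff, mixP_apply _ _ _ hs, lintegral_eq_zero_iff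
    (measurable_condP_apply K R hs)]
  filter_upwards [h] with θ hθ
  have h1 : MeasurableSet {ω : Omega D | ¬ q θ (W k ω)} :=
    (measurable_const.prodMk (measurable_W k)) hq.compl
  -- The Dirac factor of `condP` evaluates `Theta` at `θ` inside the integral, so singletons of `D`
  -- need not be measurable.
  have h2 : condP K R θ {ω : Omega D | ¬ q (Theta ω) (W k ω)} =
      condP K R θ {ω : Omega D | ¬ q θ (W k ω)} := by
    rw [← lintegral_indicator_one hs, ← lintegral_indicator_one h1,
      lintegral_condP _ _ _ (measurable_one.indicator hs),
      lintegral_condP _ _ _ (measurable_one.indicator h1)]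
    rfl
  rw [h2]
  exact (ae_condP_forall_W K R θ hθ).mono fun ω h => h k

theorem ae_mixP_exists_lt_T : ∀ᵐ ω ∂(mixP ν K R), ∀ t : ℝ, ∃ n, t < T n ω := by
  have h : ∀ᵐ ω ∂(mixP ν K R), ∀ j : ℕ, ∃ n, (j : ℝ) < T n ω := by
    refine ae_all_iff.2 fun j => ?_
    have hs : MeasurableSet {ω : Omega D | ¬ ∃ n, (j : ℝ) < T n ω} := by
      have : {ω : Omega D | ¬ ∃ n, (j : ℝ) < T n ω} = ⋂ n, {ω | (j : ℝ) < T n ω}ᶜ := by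
        ext ω; simp
      rw [this]
      exact MeasurableSet.iInter fun n => (measurableSet_lt measurable_const (measurable_T n)).compl
    rw [ae_iff, mixP_apply _ _ _ hs, lintegral_eq_zero_iff
      (measurable_condP_apply K R hs)]
    exact ae_of_all _ fun θ => (ae_condP_exists_lt_T K R θ).mono fun ω h => h j
  filter_upwards [h] with ω hω t
  obtain ⟨j, hj⟩ := exists_nat_ge t
  exact (hω j).imp fun n hn => hj.trans_lt hn

end

/-- The mixture of the measures with densities `Mtilde` has density `Mmix`. -/
theorem mixP_apply_eq (μ : Measure D) (K L : Kernel D Pos) [IsMarkovKernel K]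
    [IsMarkovKernel L] (R : Measure Pos) [IsProbabilityMeasure R] {γ : Pos → ℝ} (hγ : Measurable γ)
    [IsProbabilityMeasure (expTilt R γ)] {ξ : D → ℝ} (hξ : Measurable ξ)
    (h : ∀ᵐ θ ∂μ, L θ ≪ K θ) (t : ℝ≥0) {A : Set (Omega D)} (hA : MeasurableSet[F D t] A) :
    mixP (μ.withDensity fun θ => ENNReal.ofReal (ξ θ)) L (expTilt R γ) A =
      ∫⁻ ω in A, ENNReal.ofReal (Mmix K L γ ξ t ω) ∂(mixP μ K R) := by
  have hA' : MeasurableSet A := (F D).le t A hA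
  have hM : ∀ θ, Measurable fun ω => ENNReal.ofReal (Mtilde K L γ θ t ω) := fun θ =>
    ((measurable_Mtilde K L hγ t θ).mono ((F D).le t) le_rfl).ennreal_ofReal
  have hMm : Measurable fun ω => ENNReal.ofReal (Mmix K L γ ξ t ω) := by
    refine Measurable.ennreal_ofReal (Measurable.mul (hξ.comp measurable_Theta) ?_)
    exact (measurable_Mtilde_comp K L hγ t (measurable_Theta_F t)).mono ((F D).le t) le_rfl
  rw [mixP_apply _ _ _ hA', lintegral_withDensity_eq_lintegral_mul _ hξ.ennreal_ofReal
    (measurable_condP_apply L _ hA'), ← lintegral_indicator hA',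
    lintegral_mixP _ _ _ (hMm.indicator hA')]
  refine lintegral_congr_ae ?_
  filter_upwards [h] with θ hθ
  rw [Pi.mul_apply, condP_apply_eq K L R hγ hθ t hA, ← lintegral_indicator hA',
    ← lintegral_const_mul _ ((hM θ).indicator hA'),
    lintegral_condP _ _ _ (((hM θ).indicator hA').const_mul _),
    lintegral_condP _ _ _ (hMm.indicator hA')]
  refine lintegral_congr fun w => lintegral_congr fun x => ?_
  by_cases hω : (((w, x), θ) : Omega D) ∈ A
  · rw [Set.indicator_of_mem hω, Set.indicator_of_mem hω, Mmix,
      ENNReal.ofReal_mul' (Mtilde_nonneg _ _ _ _ _ _)]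
    rfl
  · rw [Set.indicator_of_notMem hω, Set.indicator_of_notMem hω, mul_zero]

end Mixture

/-! ### Compound mixed renewal structure: mixtures have it, and it forces a mixture. -/

section RenewalStructure

variable {D : Type*} [MeasurableSpace D]

theorem isRiskProcess_of_prod {Q : Measure (Omega D)} [IsProbabilityMeasure Q] {R : Measure Pos}
    [IsProbabilityMeasure R]
    (h : ∀ A B : Set (ℕ → Pos), MeasurableSet A → MeasurableSet B →
      Q ({ω | (fun k => W k ω) ∈ A} ∩ {ω | (fun k => X k ω) ∈ B}) =
        Q {ω | (fun k => W k ω) ∈ A} * (Measure.infinitePi fun _ : ℕ => R) B) :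
    IsRiskProcess Q := by
  have hXs : Q.map (fun ω k => X k ω) = Measure.infinitePi fun _ : ℕ => R := by
    ext B hB
    have := h Set.univ B MeasurableSet.univ hB
    rw [Measure.map_apply measurable_X_seq hB]
    simpa using! this
  have hX : ∀ k, Q.map (X k) = R := by
    intro k
    have h1 : (X k : Omega D → Pos) = (fun x : ℕ → Pos => x k) ∘ fun ω k => X k ω := rfl
    rw [h1, ← Measure.map_map (measurable_pi_apply k) measurable_X_seq, hXs,
      Measure.infinitePi_map_eval]
  have hWX : IndepFun (fun (ω : Omega D) (k : ℕ) => W k ω) (fun ω k => X k ω) Q := by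
    rw [indepFun_iff_measure_inter_preimage_eq_mul]
    intro A B hA hB
    have h1 := h A B hA hB
    rw [← hXs, Measure.map_apply measurable_X_seq hB] at h1
    exact h1
  refine ⟨?_, fun k => ?_, ?_⟩
  · rw [iIndepFun_iff_map_fun_eq_infinitePi_map measurable_X, hXs]
    congr 1
    funext k
    exact (hX k).symm
  · exact ⟨(measurable_X k).aemeasurable, (measurable_X 0).aemeasurable, (hX k).trans (hX 0).symm⟩
  -- `N` is a function of the interarrival times only. Dummy claims and a `Unit` parameter exhibit
  -- it as one, and independence transfers.
  · have hN : Measurable fun (w : ℕ → Pos) (t : ℝ≥0) =>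
        N t (((w, fun _ => onePos), ()) : Omega Unit) := by
      refine measurable_pi_iff.2 fun t => (measurable_N t).comp ?_
      exact (measurable_id.prodMk measurable_const).prodMk measurable_const
    exact hWX.comp hN measurable_id

theorem condP_W_inter_X (K : Kernel D Pos) [IsMarkovKernel K] (R : Measure Pos)
    [IsProbabilityMeasure R] (θ : D) (A B : Set (ℕ → Pos)) :
    condP K R θ ({ω | (fun k => W k ω) ∈ A} ∩ {ω | (fun k => X k ω) ∈ B}) =
      (Measure.infinitePi fun _ : ℕ => K θ) A * (Measure.infinitePi fun _ : ℕ => R) B := by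
  have := condP_prod K R θ (A := A) (B := B) MeasurableSet.univ
  rw [← setOf_W_inter_setOf_X_inter_Theta] at this
  simpa using this

theorem condP_W (K : Kernel D Pos) [IsMarkovKernel K] (R : Measure Pos)
    [IsProbabilityMeasure R] (θ : D) (A : Set (ℕ → Pos)) :
    condP K R θ {ω | (fun k => W k ω) ∈ A} = (Measure.infinitePi fun _ : ℕ => K θ) A := by
  simpa using condP_W_inter_X K R θ A Set.univ

theorem condP_X (K : Kernel D Pos) [IsMarkovKernel K] (R : Measure Pos)
    [IsProbabilityMeasure R] (θ : D) (B : Set (ℕ → Pos)) :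
    condP K R θ {ω | (fun k => X k ω) ∈ B} = (Measure.infinitePi fun _ : ℕ => R) B := by
  simpa using condP_W_inter_X K R θ Set.univ B

theorem condP_map_W_seq (K : Kernel D Pos) [IsMarkovKernel K] (R : Measure Pos)
    [IsProbabilityMeasure R] (θ : D) :
    (condP K R θ).map (fun ω k => W k ω) = Measure.infinitePi fun _ : ℕ => K θ := by
  ext A hA
  rw [Measure.map_apply measurable_W_seq hA]
  exact condP_W K R θ A

theorem condP_map_W (K : Kernel D Pos) [IsMarkovKernel K] (R : Measure Pos)
    [IsProbabilityMeasure R] (θ : D) (k : ℕ) : (condP K R θ).map (W k) = K θ := by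
  have h1 : (W k : Omega D → Pos) = (fun x : ℕ → Pos => x k) ∘ fun ω k => W k ω := rfl
  rw [h1, ← Measure.map_map (measurable_pi_apply k) measurable_W_seq, condP_map_W_seq,
    Measure.infinitePi_map_eval]

theorem isCRP_condP (K : Kernel D Pos) [IsMarkovKernel K] (R : Measure Pos)
    [IsProbabilityMeasure R] (θ : D) : IsCRP (condP K R θ) (K θ) := by
  refine ⟨isRiskProcess_of_prod (R := R) fun A B _ _ => ?_, ?_, condP_map_W K R θ⟩
  · rw [condP_W_inter_X, condP_W]
  · rw [iIndepFun_iff_map_fun_eq_infinitePi_map measurable_W, condP_map_W_seq]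
    congr 1
    funext k
    exact (condP_map_W K R θ k).symm

variable (ν : Measure D) [IsProbabilityMeasure ν] (K : Kernel D Pos) [IsMarkovKernel K]
  (R : Measure Pos) [IsProbabilityMeasure R]

theorem measurableSet_W_mem {A : Set (ℕ → Pos)} (hA : MeasurableSet A) :
    MeasurableSet {ω : Omega D | (fun k => W k ω) ∈ A} := measurable_W_seq hA

theorem measurableSet_X_mem {A : Set (ℕ → Pos)} (hA : MeasurableSet A) :
    MeasurableSet {ω : Omega D | (fun k => X k ω) ∈ A} := measurable_X_seq hA

theorem condA1_mixP : CondA1 (mixP ν K R) := by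
  intro A B hA hB
  filter_upwards [condExp_mixP_indicator ν K R ((measurableSet_W_mem hA).inter
    (measurableSet_X_mem hB)), condExp_mixP_indicator ν K R (measurableSet_W_mem hA),
    condExp_mixP_indicator ν K R (measurableSet_X_mem hB)] with ω h1 h2 h3
  rw [h1, h2, h3, measureReal_def, measureReal_def, measureReal_def, condP_W_inter_X, condP_W,
    condP_X, ENNReal.toReal_mul]

theorem mixP_X_mem {B : Set (ℕ → Pos)} (hB : MeasurableSet B) :
    mixP ν K R {ω | (fun k => X k ω) ∈ B} = (Measure.infinitePi fun _ : ℕ => R) B := by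
  rw [mixP_apply _ _ _ (measurableSet_X_mem hB)]
  simp_rw [condP_X]
  simp

theorem mixP_map_X_seq : (mixP ν K R).map (fun ω k => X k ω) = Measure.infinitePi fun _ : ℕ => R := by
  ext B hB
  rw [Measure.map_apply measurable_X_seq hB]
  exact mixP_X_mem ν K R hB

theorem mixP_map_X (k : ℕ) : (mixP ν K R).map (X k) = R := by
  have h1 : (X k : Omega D → Pos) = (fun x : ℕ → Pos => x k) ∘ fun ω k => X k ω := rfl
  rw [h1, ← Measure.map_map (measurable_pi_apply k) measurable_X_seq, mixP_map_X_seq,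
    Measure.infinitePi_map_eval]

theorem condA2_mixP : CondA2 (mixP ν K R) := by
  rw [CondA2, indepFun_iff_measure_inter_preimage_eq_mul]
  intro C B hC hB
  have h1 : Theta ⁻¹' C ∩ (fun (ω : Omega D) (k : ℕ) => X k ω) ⁻¹' B =
      (Set.univ ×ˢ B) ×ˢ C := by
    ext ω; simp [and_comm, Theta, X]
  rw [h1, mixP_prod _ _ _ MeasurableSet.univ hB hC,
    ← Measure.map_apply measurable_Theta hC, mixP_map_Theta,
    ← Measure.map_apply measurable_X_seq hB, mixP_map_X_seq]
  simp

theorem condDistrib_W_mixP (k : ℕ) :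
    condDistrib (W k) Theta (mixP ν K R) =ᵐ[(mixP ν K R).map Theta] K := by
  refine condDistrib_ae_eq_of_measure_eq_compProd_of_measurable measurable_Theta (measurable_W k) ?_
  have : IsProbabilityMeasure ((mixP ν K R).map fun ω => (Theta ω, W k ω)) :=
    Measure.isProbabilityMeasure_map (measurable_Theta.prodMk (measurable_W k)).aemeasurable
  refine Measure.ext_prod fun {C A} hC hA => ?_
  rw [Measure.map_apply (measurable_Theta.prodMk (measurable_W k)) (hC.prod hA), mixP_map_Theta,
    Measure.compProd_apply_prod hC hA]
  have hA' : MeasurableSet ((fun w : ℕ → Pos => w k) ⁻¹' A) := measurable_pi_apply k hA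
  have h1 : (fun ω : Omega D => (Theta ω, W k ω)) ⁻¹' (C ×ˢ A) =
      (((fun w : ℕ → Pos => w k) ⁻¹' A) ×ˢ Set.univ) ×ˢ C := by
    ext ω; simp [and_comm, Theta, W]
  rw [h1, mixP_prod _ _ _ hA' MeasurableSet.univ hC, measure_univ, mul_one]
  refine lintegral_congr fun θ => ?_
  rw [← Measure.map_apply (measurable_pi_apply k) hA, Measure.infinitePi_map_eval]

theorem condIndepSeq_mixP : CondIndepSeq (mixP ν K R) W := by
  intro m _ y
  have hm : ∀ k, MeasurableSet {x : Pos | (x : ℝ) ≤ y k} := fun k =>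
    measurableSet_le measurable_subtype_coe measurable_const
  have hW : ∀ k, MeasurableSet {ω : Omega D | (W k ω : ℝ) ≤ y k} := fun k => measurable_W k (hm k)
  have hI : MeasurableSet (⋂ k ∈ Finset.range m, {ω : Omega D | (W k ω : ℝ) ≤ y k}) :=
    Finset.measurableSet_biInter _ fun k _ => hW k
  have h2 : ∀ᵐ ω ∂(mixP ν K R), ∀ k, ((mixP ν K R)⟦{ω | (W k ω : ℝ) ≤ y k} | sigmaTheta D⟧) ω =
      (condP K R (Theta ω)).real {ω | (W k ω : ℝ) ≤ y k} :=
    ae_all_iff.2 fun k => condExp_mixP_indicator ν K R (hW k)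
  filter_upwards [condExp_mixP_indicator ν K R hI, h2] with ω h1 h2
  rw [h1]
  simp_rw [h2, measureReal_def]
  rw [← ENNReal.toReal_prod]
  congr 1
  have h3 : (⋂ k ∈ Finset.range m, {ω : Omega D | (W k ω : ℝ) ≤ y k}) =
      {ω | (fun k => W k ω) ∈ (Finset.range m : Set ℕ).pi fun k => {x : Pos | (x : ℝ) ≤ y k}} := by
    ext ω; simp [Set.mem_pi]
  rw [h3, condP_W, Measure.infinitePi_pi _ fun k _ => hm k]
  refine Finset.prod_congr rfl fun k _ => ?_
  rw [← condP_map_W K R (Theta ω) k, Measure.map_apply (measurable_W k) (hm k)]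
  rfl

theorem isCMRP_mixP : IsCMRP (mixP ν K R) K := by
  refine ⟨isRiskProcess_of_prod (R := R) fun A B hA hB => ?_, condIndepSeq_mixP ν K R,
    condDistrib_W_mixP ν K R⟩
  have h1 := mixP_prod ν K R hA hB MeasurableSet.univ
  have h2 := mixP_prod ν K R hA MeasurableSet.univ MeasurableSet.univ
  rw [← setOf_W_inter_setOf_X_inter_Theta] at h1 h2
  have h3 : {ω : Omega D | (fun k => X k ω) ∈ Set.univ} = Set.univ := rfl
  rw [Set.preimage_univ, Set.inter_univ] at h1 h2
  rw [h3, Set.inter_univ, measure_univ, mul_one] at h2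
  rw [h1, h2]

/-- Initial boxes; they determine a law on the space of sequences. -/
def initBox (m : ℕ) (y : ℕ → ℝ) : Set (ℕ → Pos) := {w | ∀ k < m, (w k : ℝ) ≤ y k}

theorem measurableSet_initBox (m : ℕ) (y : ℕ → ℝ) : MeasurableSet (initBox m y) := by
  have : initBox m y = ⋂ k ∈ Finset.range m, {w : ℕ → Pos | (w k : ℝ) ≤ y k} := by
    ext w; simp [initBox]
  rw [this]
  exact Finset.measurableSet_biInter _ fun k _ => measurableSet_le
    (measurable_subtype_coe.comp (measurable_pi_apply k)) measurable_const

/-- Boxes of length at least `2` already form a generating `π`-system. The bound matches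
`CondIndepSeq`, which speaks only of `2 ≤ m`. -/
theorem ext_of_initBox {α β : Measure (ℕ → Pos)} [IsFiniteMeasure α]
    (huniv : α Set.univ = β Set.univ)
    (h : ∀ m, 2 ≤ m → ∀ y, α (initBox m y) = β (initBox m y)) : α = β := by
  refine ext_of_generate_finite {s | ∃ m, 2 ≤ m ∧ ∃ y, initBox m y = s} ?_ ?_ ?_ huniv
  · refine le_antisymm ?_ (MeasurableSpace.generateFrom_le ?_)
    · set C := {s | ∃ m, 2 ≤ m ∧ ∃ y, initBox m y = s}
      have hk : ∀ k, Measurable[MeasurableSpace.generateFrom C] fun w : ℕ → Pos => w k := by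
        intro k
        refine measurable_comap_iff.2 ?_
        refine measurable_of_Iic fun x => ?_
        -- A constraint on one coordinate is a countable union of boxes whose other bounds are a
        -- growing integer `j`.
        have : (Subtype.val ∘ fun w : ℕ → Pos => w k) ⁻¹' Set.Iic x =
            ⋃ j : ℕ, initBox (k + 2) (Function.update (fun _ => (j : ℝ)) k x) := by
          ext w
          simp only [Set.mem_preimage, Function.comp, Set.mem_Iic, Set.mem_iUnion, initBox,
            Set.mem_ofPred_eq]
          constructor
          · intro hw
            obtain ⟨j, hj⟩ := exists_nat_ge (∑ i ∈ Finset.range (k + 2), (w i : ℝ))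
            refine ⟨j, fun i hi => ?_⟩
            by_cases hik : i = k
            · subst hik; simpa using hw
            · rw [Function.update_of_ne hik]
              exact (Finset.single_le_sum (f := fun i => (w i : ℝ)) (fun i _ => (w i).2.le)
                (Finset.mem_range.2 hi)).trans hj
          · rintro ⟨j, hj⟩
            simpa using hj k (by omega)
        rw [this]
        exact MeasurableSet.iUnion fun j =>
          MeasurableSpace.measurableSet_generateFrom ⟨k + 2, by omega, _, rfl⟩
      have hid : Measurable[MeasurableSpace.generateFrom C] (fun w : ℕ → Pos => w) :=
        (@measurable_pi_iff _ _ _ (MeasurableSpace.generateFrom C) _ _).2 hk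
      exact fun A hA => hid hA
    · rintro _ ⟨m, -, y, rfl⟩
      exact measurableSet_initBox m y
  · rintro _ ⟨m, hm, y, rfl⟩ _ ⟨m', -, y', rfl⟩ -
    refine ⟨max m m', hm.trans (le_max_left _ _), fun k => if k < m then
      (if k < m' then min (y k) (y' k) else y k) else y' k, ?_⟩
    ext w
    simp only [initBox, Set.mem_ofPred_eq, Set.mem_inter_iff]
    constructor
    · intro h
      refine ⟨fun k hk => ?_, fun k hk => ?_⟩
      · have := h k (hk.trans_le (le_max_left _ _))
        rw [if_pos hk] at this
        split_ifs at this
        · exact this.trans (min_le_left _ _)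
        · exact this
      · have := h k (hk.trans_le (le_max_right _ _))
        rw [if_pos hk] at this
        split_ifs at this
        · exact this.trans (min_le_right _ _)
        · exact this
    · rintro ⟨h1, h2⟩ k hk
      split_ifs with ha hb
      · exact le_min (h1 k ha) (h2 k hb)
      · exact h1 k ha
      · exact h2 k ((lt_max_iff.1 hk).resolve_left ha)
  · rintro _ ⟨m, hm, y, rfl⟩
    exact h m hm y

/-- Given `Θ`, (a1) splits the event into its `W` and `X` parts, (a2) makes the `X` part constant,
and the renewal structure makes the `W` part a product. The result involves `Q` only through the
laws of `Θ` and of the claim sequence. -/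
theorem measureReal_initBox {L : Kernel D Pos} {Q : Measure (Omega D)} [IsProbabilityMeasure Q] (h1 : CondA1 Q)
    (h2 : CondA2 Q) (h3 : IsCMRP Q L) {m : ℕ} (hm : 2 ≤ m) (y : ℕ → ℝ) {B : Set (ℕ → Pos)}
    (hB : MeasurableSet B) {C : Set D} (hC : MeasurableSet C) :
    Q.real ((initBox m y ×ˢ B) ×ˢ C) =
      ∫ θ in C, (∏ k ∈ Finset.range m, (L θ).real {x | (x : ℝ) ≤ y k}) *
        (Q.map fun ω k => X k ω).real B ∂(Q.map Theta) := by
  have hle : sigmaTheta D ≤ (inferInstance : MeasurableSpace (Omega D)) :=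
    measurable_Theta.comap_le
  have hmx : ∀ k, MeasurableSet {x : Pos | (x : ℝ) ≤ y k} := fun k =>
    measurableSet_le measurable_subtype_coe measurable_const
  have hbox := measurableSet_W_mem (D := D) (measurableSet_initBox m y)
  have hX := measurableSet_X_mem (D := D) hB
  have hCm : MeasurableSet[sigmaTheta D] (Theta ⁻¹' C : Set (Omega D)) := ⟨C, hC, rfl⟩
  have e1 := h1 _ _ (measurableSet_initBox m y) hB
  have e2 : Q⟦{ω | (fun k => X k ω) ∈ B} | sigmaTheta D⟧ =ᵐ[Q]
      fun _ => (Q.map fun ω k => X k ω).real B := by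
    have hcomap : MeasurableSet[MeasurableSpace.comap (fun (ω : Omega D) (k : ℕ) => X k ω)
        inferInstance] {ω : Omega D | (fun k => X k ω) ∈ B} := ⟨B, hB, rfl⟩
    have := condExp_indep_eq (μ := Q) (f := {ω : Omega D | (fun k => X k ω) ∈ B}.indicator
      fun _ => (1 : ℝ)) measurable_X_seq.comap_le hle
      (stronglyMeasurable_const.indicator hcomap) ((IndepFun_iff_Indep _ _ _).1 h2).symm
    refine this.trans (ae_of_all _ fun _ => ?_)
    simp only
    rw [integral_indicator hX, setIntegral_const, smul_eq_mul, mul_one, measureReal_def,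
      measureReal_def, Measure.map_apply measurable_X_seq hB]
    rfl
  have e3 : Q⟦{ω | (fun k => W k ω) ∈ initBox m y} | sigmaTheta D⟧ =ᵐ[Q]
      fun ω => ∏ k ∈ Finset.range m, (L (Theta ω)).real {x | (x : ℝ) ≤ y k} := by
    have hset : {ω : Omega D | (fun k => W k ω) ∈ initBox m y} =
        ⋂ k ∈ Finset.range m, {ω | (W k ω : ℝ) ≤ y k} := by
      ext ω; simp [initBox]
    rw [hset]
    have hk : ∀ᵐ ω ∂Q, ∀ k, (Q⟦{ω | (W k ω : ℝ) ≤ y k} | sigmaTheta D⟧) ω =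
        (L (Theta ω)).real {x | (x : ℝ) ≤ y k} := by
      refine ae_all_iff.2 fun k => ?_
      have ha := condDistrib_ae_eq_condExp (μ := Q) measurable_Theta (measurable_W k) (hmx k)
      have hb := ae_of_ae_map measurable_Theta.aemeasurable (h3.condLaw k)
      filter_upwards [ha, hb] with ω ha hb
      rw [hb] at ha
      exact ha.symm
    filter_upwards [h3.condIndep m hm y, hk] with ω ha hb
    rw [ha]
    simp_rw [hb]
  have hint : Integrable (({ω | (fun k => W k ω) ∈ initBox m y} ∩
      {ω : Omega D | (fun k => X k ω) ∈ B}).indicator fun _ => (1 : ℝ)) Q :=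
    (integrable_const 1).indicator (hbox.inter hX)
  have e4 := setIntegral_condExp hle hint hCm
  have hmeas : Measurable fun θ => (∏ k ∈ Finset.range m, (L θ).real {x | (x : ℝ) ≤ y k}) *
        (Q.map fun ω k => X k ω).real B := by
    refine Measurable.mul_const (Finset.measurable_fun_prod _ fun k _ => ?_) _
    exact (L.measurable_coe (hmx k)).ennreal_toReal
  rw [setIntegral_map hC hmeas.aestronglyMeasurable measurable_Theta.aemeasurable]
  rw [setIntegral_indicator (hbox.inter hX), setIntegral_const, smul_eq_mul, mul_one] at e4
  rw [← setOf_W_inter_setOf_X_inter_Theta, Set.inter_comm, ← e4]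
  refine integral_congr_ae (ae_restrict_of_ae ?_)
  filter_upwards [e1, e2, e3] with ω h1 h2 h3
  rw [h1, h2, h3]

variable {K R} in
/-- A measure satisfying the structural conditions is a mixture of product measures. -/
theorem eq_mixP {Q : Measure (Omega D)} [IsProbabilityMeasure Q] (h1 : CondA1 Q)
    (h2 : CondA2 Q) (h3 : IsCMRP Q K) (hX : Q.map (X 0) = R) : Q = mixP (Q.map Theta) K R := by
  have hν : IsProbabilityMeasure (Q.map Theta) :=
    Measure.isProbabilityMeasure_map measurable_Theta.aemeasurable
  set Q' := mixP (Q.map Theta) K R with hQ'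
  have hXs : Q.map (fun ω k => X k ω) = Q'.map fun ω k => X k ω := by
    rw [mixP_map_X_seq, (iIndepFun_iff_map_fun_eq_infinitePi_map measurable_X).1 h3.risk.indep_X]
    congr 1
    funext k
    exact (h3.risk.identDistrib_X k).map_eq.trans hX
  have hΘ : Q.map Theta = Q'.map Theta := (mixP_map_Theta _ K R).symm
  refine Measure.ext_prod₃_iff'.2 fun {A B C} hA hB hC => ?_
  have hBC : MeasurableSet {ω : Omega D | (fun k => X k ω) ∈ B ∧ Theta ω ∈ C} :=
    (measurableSet_X_mem hB).inter (measurable_Theta hC)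
  -- With `B` and `C` frozen, the comparison is between two finite measures on the space of
  -- interarrival sequences.
  have key : (Q.restrict {ω : Omega D | (fun k => X k ω) ∈ B ∧ Theta ω ∈ C}).map
      (fun ω k => W k ω) = (Q'.restrict {ω : Omega D | (fun k => X k ω) ∈ B ∧ Theta ω ∈ C}).map
      (fun ω k => W k ω) := by
    have hval : ∀ (P : Measure (Omega D)) (A : Set (ℕ → Pos)), MeasurableSet A →
        (P.restrict {ω : Omega D | (fun k => X k ω) ∈ B ∧ Theta ω ∈ C}).map
          (fun ω k => W k ω) A = P ((A ×ˢ B) ×ˢ C) := by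
      intro P A hA
      rw [Measure.map_apply measurable_W_seq hA, Measure.restrict_apply (measurable_W_seq hA)]
      congr 1
      ext ω
      exact (and_assoc (a := (fun k => W k ω) ∈ A)).symm
    have hb : ∀ m, 2 ≤ m → ∀ y, Q ((initBox m y ×ˢ B) ×ˢ C) = Q' ((initBox m y ×ˢ B) ×ˢ C) := by
      intro m hm y
      have ha := measureReal_initBox h1 h2 h3 hm y hB hC
      have hb := measureReal_initBox (condA1_mixP (Q.map Theta) K R) (condA2_mixP _ K R)
        (isCMRP_mixP _ K R) hm y hB hC
      rw [← hQ', ← hXs, ← hΘ, ← ha] at hb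
      rw [measureReal_def, measureReal_def, ENNReal.toReal_eq_toReal_iff' (measure_ne_top _ _)
        (measure_ne_top _ _)] at hb
      exact hb.symm
    refine ext_of_initBox ?_ fun m hm y => ?_
    · rw [hval _ _ MeasurableSet.univ, hval _ _ MeasurableSet.univ]
      -- The total masses must agree as well. Exhausting by boxes with integer bounds reduces this
      -- to the box case.
      have hlim : ∀ (P : Measure (Omega D)), P ((Set.univ ×ˢ B) ×ˢ C) =
          ⨆ j : ℕ, P ((initBox 2 (fun _ => j) ×ˢ B) ×ˢ C) := by
        intro P
        have : ((Set.univ ×ˢ B) ×ˢ C : Set (Omega D)) =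
            ⋃ j : ℕ, (initBox 2 (fun _ => j) ×ˢ B) ×ˢ C := by
          ext ω
          simp only [Set.mem_prod, Set.mem_univ, true_and, Set.mem_iUnion]
          constructor
          · intro h
            obtain ⟨j, hj⟩ := exists_nat_ge (max (ω.1.1 0 : ℝ) (ω.1.1 1))
            refine ⟨j, ⟨fun k hk => ?_, h.1⟩, h.2⟩
            interval_cases k
            · exact (le_max_left _ _).trans hj
            · exact (le_max_right _ _).trans hj
          · rintro ⟨j, h⟩
            exact ⟨h.1.2, h.2⟩
        rw [this, Monotone.measure_iUnion]
        intro i j hij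
        refine Set.prod_mono_left (Set.prod_mono_left fun w hw k hk => (hw k hk).trans ?_)
        exact Nat.cast_le.2 hij
      rw [hlim, hlim]
      exact iSup_congr fun j => hb 2 le_rfl _
    · rw [hval _ _ (measurableSet_initBox m y), hval _ _ (measurableSet_initBox m y)]
      exact hb m hm y
  have := congrArg (fun ρ => ρ A) key
  rw [Measure.map_apply measurable_W_seq hA, Measure.map_apply measurable_W_seq hA,
    Measure.restrict_apply (measurable_W_seq hA), Measure.restrict_apply (measurable_W_seq hA)] at this
  have hset : ((A ×ˢ B) ×ˢ C : Set (Omega D)) = (fun (ω : Omega D) k => W k ω) ⁻¹' A ∩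
      {ω : Omega D | (fun k => X k ω) ∈ B ∧ Theta ω ∈ C} := by
    ext ω
    exact and_assoc
  rw [hset]
  exact this

end RenewalStructure

/-! ### The Laplace transform and the root of `m * lap ν s = 1`. -/

section Laplace

/-- The Laplace transform of a law on `(0, ∞)`. -/
noncomputable def lap (ν : Measure Pos) (s : ℝ) : ℝ := ∫ w, Real.exp (-s * w) ∂ν

theorem measurable_exp_neg_mul (s : ℝ) : Measurable fun w : Pos => Real.exp (-s * w) := by
  fun_prop

variable (ν : Measure Pos) [IsProbabilityMeasure ν]

theorem norm_exp_neg_mul_le {s : ℝ} (hs : 0 ≤ s) (w : Pos) : ‖Real.exp (-s * w)‖ ≤ 1 := by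
  rw [Real.norm_of_nonneg (Real.exp_pos _).le, Real.exp_le_one_iff, neg_mul]
  exact neg_nonpos.2 (mul_nonneg hs w.2.le)

theorem integrable_exp_neg_mul {s : ℝ} (hs : 0 ≤ s) :
    Integrable (fun w : Pos => Real.exp (-s * w)) ν :=
  Integrable.of_bound (measurable_exp_neg_mul s).aestronglyMeasurable 1
    (ae_of_all _ (norm_exp_neg_mul_le hs))

theorem lap_lt_lap {s s' : ℝ} (h : s < s') (hs : Integrable (fun w : Pos => Real.exp (-s * w)) ν)
    (hs' : Integrable (fun w : Pos => Real.exp (-s' * w)) ν) : lap ν s' < lap ν s := by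
  have hlt : ∀ w : Pos, Real.exp (-s' * w) < Real.exp (-s * w) := fun w => by
    rw [Real.exp_lt_exp]
    nlinarith [mul_pos (sub_pos.2 h) w.2]
  rw [← sub_pos, lap, lap, ← integral_sub hs hs', integral_pos_iff_support_of_nonneg
    (fun w => (sub_pos.2 (hlt w)).le) (hs.sub hs')]
  have : Function.support (fun w : Pos => Real.exp (-s * w) - Real.exp (-s' * w)) = Set.univ :=
    Set.eq_univ_of_forall fun w => (sub_pos.2 (hlt w)).ne'
  rw [this, measure_univ]
  exact one_pos

theorem lap_zero : lap ν 0 = 1 := by simp [lap]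

theorem lap_lt_lap_of_nonneg {s s' : ℝ} (h0 : 0 ≤ s) (h : s < s') : lap ν s' < lap ν s :=
  lap_lt_lap ν h (integrable_exp_neg_mul ν h0) (integrable_exp_neg_mul ν (h0.trans h.le))

theorem continuousOn_lap : ContinuousOn (lap ν) (Set.Ici 0) := by
  refine continuousOn_of_dominated (bound := fun _ => 1)
    (fun s _ => (measurable_exp_neg_mul s).aestronglyMeasurable)
    (fun s hs => ae_of_all _ (norm_exp_neg_mul_le hs)) (integrable_const 1)
    (ae_of_all _ fun w => ?_)
  fun_prop

theorem tendsto_lap_atTop : Tendsto (lap ν) atTop (nhds 0) := by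
  have h : Tendsto (lap ν) atTop (nhds (∫ _, (0 : ℝ) ∂ν)) := by
    refine tendsto_integral_filter_of_dominated_convergence (fun _ => 1)
      (Eventually.of_forall fun s => (measurable_exp_neg_mul s).aestronglyMeasurable)
      ?_ (integrable_const 1) (ae_of_all _ fun w => ?_)
    · filter_upwards [eventually_ge_atTop 0] with s hs
      exact ae_of_all _ (norm_exp_neg_mul_le hs)
    · refine Real.tendsto_exp_atBot.comp ?_
      exact (tendsto_neg_atTop_atBot).atBot_mul_const w.2
  simpa using h

/-- For negative `s` the exponential is either integrable, and then `lap ν s > 1`, or not, and then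
the integral has its default value `0`. Neither is compatible with `m ≥ 1`, so there are no spurious
roots. -/
theorem nonneg_of_mul_lap_eq_one {m : ℝ} (hm : 1 ≤ m) {s : ℝ} (h : m * lap ν s = 1) : 0 ≤ s := by
  by_contra hs
  push Not at hs
  have hint : Integrable (fun w : Pos => Real.exp (-s * w)) ν := by
    by_contra hn
    rw [lap, integral_undef hn, mul_zero] at h
    exact zero_ne_one h
  have := lap_lt_lap ν hs hint (integrable_exp_neg_mul ν le_rfl)
  rw [lap_zero] at this
  nlinarith

theorem exists_mul_lap_eq_one {m : ℝ} (hm : 1 ≤ m) : ∃ s, m * lap ν s = 1 := by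
  have hm0 : 0 < m := one_pos.trans_le hm
  obtain ⟨b, hb1, hb0⟩ := (((tendsto_lap_atTop ν).eventually_lt_const (inv_pos.2 hm0)).and
    (eventually_ge_atTop 0)).exists
  have := intermediate_value_Icc' hb0 ((continuousOn_lap ν).mono Set.Icc_subset_Ici_self)
  obtain ⟨s, -, hs⟩ := this ⟨hb1.le, by rw [lap_zero]; exact inv_le_one_of_one_le₀ hm⟩
  exact ⟨s, by rw [hs, mul_inv_cancel₀ hm0.ne']⟩

theorem eq_of_mul_lap_eq_one {m : ℝ} (hm : 1 ≤ m) {s s' : ℝ} (h : m * lap ν s = 1)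
    (h' : m * lap ν s' = 1) : s = s' := by
  have h0 := nonneg_of_mul_lap_eq_one ν hm h
  have h0' := nonneg_of_mul_lap_eq_one ν hm h'
  have he : lap ν s = lap ν s' :=
    mul_left_cancel₀ (one_pos.trans_le hm).ne' (h.trans h'.symm)
  rcases lt_trichotomy s s' with hlt | heq | hlt
  · exact absurd he (lap_lt_lap_of_nonneg ν h0 hlt).ne'
  · exact heq
  · exact absurd he (lap_lt_lap_of_nonneg ν h0' hlt).ne

/-- Strict monotonicity turns `s θ ≤ a` into `m * lap (K θ) a ≤ 1` for `a ≥ 0`, and this is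
measurable in `θ` even though the root is obtained by choice. -/
theorem measurable_of_mul_lap_eq_one {D : Type*} [MeasurableSpace D] (K : Kernel D Pos)
    [IsMarkovKernel K] {m : ℝ} (hm : 1 ≤ m) {s : D → ℝ} (hs : ∀ θ, m * lap (K θ) (s θ) = 1) :
    Measurable s := by
  have hm0 : 0 < m := one_pos.trans_le hm
  have h0 : ∀ θ, 0 ≤ s θ := fun θ => nonneg_of_mul_lap_eq_one (K θ) hm (hs θ)
  refine measurable_of_Iic fun a => ?_
  rcases lt_or_ge a 0 with ha | ha
  · convert MeasurableSet.empty
    ext θ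
    simpa using ha.trans_le (h0 θ)
  · have : s ⁻¹' Set.Iic a = (fun θ => m * lap (K θ) a) ⁻¹' Set.Iic 1 := by
      ext θ
      simp only [Set.mem_preimage, Set.mem_Iic]
      rw [← hs θ, mul_le_mul_iff_right₀ hm0]
      constructor
      · intro h
        rcases h.eq_or_lt with h | h
        · rw [h]
        · exact (lap_lt_lap_of_nonneg (K θ) (h0 θ) h).le
      · intro h
        by_contra hn
        exact absurd h (not_le.2 (lap_lt_lap_of_nonneg (K θ) ha (not_le.1 hn)))
    rw [this]
    have hl : Measurable fun θ => lap (K θ) a :=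
      ((measurable_exp_neg_mul a).stronglyMeasurable.integral_kernel (κ := K)).measurable
    exact (hl.const_mul m) measurableSet_Iic

end Laplace

/-! ### The tilted interarrival laws and the explicit density. -/

section Tilt

variable {D : Type*} [MeasurableSpace D]

/-- The law `ν` tilted by `w ↦ m exp (-s w)`. -/
noncomputable def lapTilt (m s : ℝ) (ν : Measure Pos) : Measure Pos :=
  ν.withDensity fun w => ENNReal.ofReal (m * Real.exp (-s * w))

theorem isProbabilityMeasure_withDensity_ofReal {α : Type*} [MeasurableSpace α] {ρ : Measure α}
    {f : α → ℝ} (h0 : 0 ≤ᵐ[ρ] f) (h : ∫ x, f x ∂ρ = 1) :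
    IsProbabilityMeasure (ρ.withDensity fun x => ENNReal.ofReal (f x)) := by
  have hint : Integrable f ρ := by
    by_contra hn
    rw [integral_undef hn] at h
    exact zero_ne_one h
  constructor
  rw [withDensity_apply _ MeasurableSet.univ, Measure.restrict_univ,
    ← ofReal_integral_eq_lintegral_ofReal hint h0, h, ENNReal.ofReal_one]

theorem real_lapTilt {m : ℝ} (hm : 0 ≤ m) (s : ℝ) (ν : Measure Pos)
    [IsProbabilityMeasure ν] {B : Set Pos} (hB : MeasurableSet B) :
    (lapTilt m s ν).real B = m * ∫ w in B, Real.exp (-s * w) ∂ν := by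
  rw [measureReal_def, lapTilt, withDensity_apply _ hB, ← integral_const_mul,
    integral_eq_lintegral_of_nonneg_ae]
  · exact ae_of_all _ fun w => mul_nonneg hm (Real.exp_pos _).le
  · exact ((measurable_exp_neg_mul s).const_mul m).aestronglyMeasurable

theorem ae_condP_Theta [MeasurableSingletonClass D] (K : Kernel D Pos) [IsMarkovKernel K]
    (R : Measure Pos) [IsProbabilityMeasure R] (θ : D) : ∀ᵐ ω ∂(condP K R θ), Theta ω = θ := by
  have h : ∀ᵐ x ∂(Measure.dirac θ), x = θ := by rw [ae_dirac_eq]; rfl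
  exact (measurePreserving_snd (μ := (Measure.infinitePi fun _ : ℕ => K θ).prod
    (Measure.infinitePi fun _ : ℕ => R)) (ν := Measure.dirac θ)).quasiMeasurePreserving.ae h

/-- The tilting condition determines the new interarrival laws. -/
theorem ae_eq_lapTilt [MeasurableSingletonClass D] {μ : Measure D} [IsProbabilityMeasure μ]
    {K L : Kernel D Pos} [IsMarkovKernel K] [IsMarkovKernel L] {R : Measure Pos}
    [IsProbabilityMeasure R] {m : ℝ} (hm : 1 ≤ m) {s : D → ℝ}
    (hs : ∀ θ, m * lap (K θ) (s θ) = 1) (hL : IsTiltedW (mixP μ K R) s L) :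
    ∀ᵐ θ ∂μ, L θ = lapTilt m (s θ) (K θ) := by
  have hm0 : 0 < m := one_pos.trans_le hm
  have h0 : ∀ θ, 0 ≤ s θ := fun θ => nonneg_of_mul_lap_eq_one (K θ) hm (hs θ)
  have hsm : Measurable s := measurable_of_mul_lap_eq_one K hm hs
  have hfm : Measurable (Function.uncurry fun (θ : D) (w : Pos) =>
      ENNReal.ofReal (m * Real.exp (-s θ * w))) := by
    unfold Function.uncurry
    fun_prop
  set L' : Kernel D Pos := K.withDensity fun θ w => ENNReal.ofReal (m * Real.exp (-s θ * w)) with hL'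
  have hL'a : ∀ θ, L' θ = lapTilt m (s θ) (K θ) := fun θ => Kernel.withDensity_apply _ hfm θ
  have hpr : ∀ θ, IsProbabilityMeasure (lapTilt m (s θ) (K θ)) := fun θ =>
    isProbabilityMeasure_withDensity_ofReal
      (ae_of_all _ fun w => mul_nonneg hm0.le (Real.exp_pos _).le)
      (by rw [integral_const_mul]; exact hs θ)
  have : IsMarkovKernel L' := ⟨fun θ => by rw [hL'a]; exact hpr θ⟩
  have key : ∀ B : Set Pos, MeasurableSet B → ∀ᵐ θ ∂μ, L θ B = L' θ B := by
    intro B hB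
    have hfB : Measurable ((W 0 ⁻¹' B).indicator
        fun ω : Omega D => Real.exp (-s (Theta ω) * W 0 ω)) := by
      refine Measurable.indicator ?_ (measurable_W 0 hB)
      have h1 := hsm.comp (measurable_Theta (D := D))
      have h2 := measurable_subtype_coe.comp (measurable_W (D := D) 0)
      exact Real.measurable_exp.comp (h1.neg.mul h2)
    have hf : Measurable fun ω : Omega D => Real.exp (-s (Theta ω) * W 0 ω) := by
      have h1 := hsm.comp (measurable_Theta (D := D))
      have h2 := measurable_subtype_coe.comp (measurable_W (D := D) 0)
      exact Real.measurable_exp.comp (h1.neg.mul h2)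
    have hint : Integrable (fun ω : Omega D => Real.exp (-s (Theta ω) * W 0 ω)) (mixP μ K R) :=
      Integrable.of_bound hf.aestronglyMeasurable 1
        (ae_of_all _ fun ω => norm_exp_neg_mul_le (h0 _) _)
    have hval : ∀ θ (B : Set Pos), MeasurableSet B → ∫ ω, (W 0 ⁻¹' B).indicator
        (fun ω : Omega D => Real.exp (-s (Theta ω) * W 0 ω)) ω ∂(condP K R θ) =
          ∫ w in B, Real.exp (-s θ * w) ∂(K θ) := by
      intro θ B hB
      rw [integral_indicator (measurable_W 0 hB)]
      have h1 : ∫ ω in W 0 ⁻¹' B, Real.exp (-s (Theta ω) * W 0 ω) ∂(condP K R θ) =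
          ∫ ω in W 0 ⁻¹' B, Real.exp (-s θ * W 0 ω) ∂(condP K R θ) := by
        refine integral_congr_ae (ae_restrict_of_ae ?_)
        filter_upwards [ae_condP_Theta K R θ] with ω hω
        rw [hω]
      rw [h1]
      conv_rhs => rw [← condP_map_W K R θ 0]
      rw [setIntegral_map hB (measurable_exp_neg_mul (s θ)).aestronglyMeasurable
        (measurable_W 0).aemeasurable]
    have h1 := condExp_mixP μ K R (hint.indicator (measurable_W 0 hB)) hfB
    have h2 := condExp_mixP μ K R hint hf
    have h3 : ∀ᵐ ω ∂(mixP μ K R), (L (Theta ω)).real B = (L' (Theta ω)).real B := by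
      filter_upwards [hL B hB, h1, h2] with ω e1 e2 e3
      have h4 := hval (Theta ω) Set.univ MeasurableSet.univ
      simp only [Set.preimage_univ, Set.indicator_univ, Measure.restrict_univ] at h4
      have h5 : lap (K (Theta ω)) (s (Theta ω)) = m⁻¹ :=
        eq_inv_of_mul_eq_one_right (hs (Theta ω))
      rw [lap] at h5
      rw [e1, e2, e3, hval _ B hB, h4, h5, hL'a, real_lapTilt hm0.le _ _ hB, div_inv_eq_mul,
        mul_comm]
    have h4 : ∀ᵐ θ ∂μ, (L θ).real B = (L' θ).real B := by
      have hms : MeasurableSet {θ | (L θ).real B = (L' θ).real B} :=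
        measurableSet_eq_fun (L.measurable_coe hB).ennreal_toReal
          (L'.measurable_coe hB).ennreal_toReal
      rw [← mixP_map_Theta μ K R]
      exact (ae_map_iff measurable_Theta.aemeasurable hms).2 h3
    filter_upwards [h4] with θ hθ
    rwa [measureReal_def, measureReal_def, ENNReal.toReal_eq_toReal_iff' (measure_ne_top _ _)
      (measure_ne_top _ _)] at hθ
  -- The null set in `key` depends on `B`. Equality of the composition products yields one null set
  -- for all `B`.
  have hcomp : μ ⊗ₘ L = μ ⊗ₘ L' := by
    refine Measure.ext_prod fun {C B} hC hB => ?_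
    rw [Measure.compProd_apply_prod hC hB, Measure.compProd_apply_prod hC hB]
    exact lintegral_congr_ae (ae_restrict_of_ae (key B hB))
  filter_upwards [Kernel.ae_eq_of_compProd_eq hcomp] with θ hθ
  rw [hθ, hL'a]

theorem absolutelyContinuous_lapTilt (m s : ℝ) (ν : Measure Pos) : lapTilt m s ν ≪ ν :=
  withDensity_absolutelyContinuous _ _

theorem ae_rnDeriv_eq_of_lapTilt {K L : Kernel D Pos} [IsMarkovKernel K] [IsMarkovKernel L]
    {m s : ℝ} (hm : 0 ≤ m) {θ : D} (h : L θ = lapTilt m s (K θ)) :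
    ∀ᵐ w ∂(K θ), (Kernel.rnDeriv L K θ w).toReal = m * Real.exp (-s * w) := by
  have h1 := Measure.rnDeriv_withDensity (K θ) (f := fun w : Pos =>
    ENNReal.ofReal (m * Real.exp (-s * w))) ((measurable_exp_neg_mul s).const_mul m).ennreal_ofReal
  filter_upwards [Kernel.rnDeriv_eq_rnDeriv_measure (κ := L) (η := K) (a := θ), h1] with w e1 e2
  rw [e1, h, lapTilt, e2, ENNReal.toReal_ofReal (mul_nonneg hm (Real.exp_pos _).le)]

/-- Almost surely, every `v < w` satisfies `ν (v, ∞) > 0`. -/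
theorem ae_forall_rat_lt_measure_ne_zero (ν : Measure Pos) :
    ∀ᵐ (w : Pos) ∂ν, ∀ q : ℚ, (q : ℝ) < (w : ℝ) → ν {x : Pos | (q : ℝ) < x} ≠ 0 := by
  refine ae_all_iff.2 fun q => ?_
  by_cases h : ν {x : Pos | (q : ℝ) < x} = 0
  · have h1 : ∀ᵐ (w : Pos) ∂ν, ¬ (q : ℝ) < (w : ℝ) := by
      rw [ae_iff]
      simpa using h
    filter_upwards [h1] with w hw hq
    exact absurd hq hw
  · exact ae_of_all _ fun w _ => h

theorem measure_tail_ne_zero {ν : Measure Pos} {w v : ℝ}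
    (h : ∀ q : ℚ, (q : ℝ) < w → ν {x : Pos | (q : ℝ) < x} ≠ 0) (hv : v < w) :
    ν {x : Pos | v < x} ≠ 0 := by
  obtain ⟨q, h1, h2⟩ := exists_rat_btwn hv
  exact fun h0 => h q h2 (measure_mono_null (fun (x : Pos) (hx : (q : ℝ) < x) => h1.trans hx) h0)

/-- In each factor the `m` of the interarrival density cancels the `1 / m` in `exp (γ x)`. The
remaining `ln m` comes from the new tail, which belongs to an interarrival period with no claim yet.
-/
theorem Mtilde_eq_Mexp {K L : Kernel D Pos} [IsMarkovKernel K] [IsMarkovKernel L] {γ : Pos → ℝ}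
    {r m s : ℝ} (hm : 0 < m) (hγ : ∀ x : Pos, γ x = r * x - Real.log m) {θ : D}
    (hθ : L θ = lapTilt m s (K θ)) {ω : Omega D}
    (hω : ∀ k, (Kernel.rnDeriv L K θ (W k ω)).toReal = m * Real.exp (-s * W k ω)) (t : ℝ≥0) :
    Mtilde K L γ θ t ω = Mexp r m s (K θ) (K θ) t ω := by
  have hset : MeasurableSet {w : Pos | V t ω < w} :=
    measurableSet_lt measurable_const measurable_subtype_coe
  have h1 : ∀ j, Real.exp (γ (X j ω)) * (Kernel.rnDeriv L K θ (W j ω)).toReal =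
      Real.exp (r * X j ω - s * W j ω) := by
    intro j
    rw [hω, hγ, Real.exp_sub, Real.exp_log hm, Real.exp_sub, neg_mul, Real.exp_neg]
    field_simp
  rw [Mtilde, Mexp, one_sub_distr (L θ), hθ, real_lapTilt hm.le _ _ hset]
  simp_rw [h1]
  rw [← Real.exp_sum, Real.exp_add, Real.exp_log hm, Finset.sum_sub_distrib, ← Finset.mul_sum,
    ← Finset.mul_sum, S, T]
  ring

end Tilt

/-! ### Positivity and Schmidli's form of the explicit density. -/

section Formulas

variable {D : Type*}

/-- The elapsed time `V t` is smaller than the current interarrival time, beyond which `ν` does not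
yet run out of mass. Numerator and denominator are thus both positive, simultaneously for all `t`.
-/
theorem Mexp_pos (r m : ℝ) {s : ℝ} (hs : 0 ≤ s) {ν : Measure Pos} [IsProbabilityMeasure ν]
    {ω : Omega D} (hex : ∀ t : ℝ, ∃ n, t < T n ω)
    (hω : ∀ k, ∀ q : ℚ, (q : ℝ) < W k ω → ν {x : Pos | (q : ℝ) < x} ≠ 0) (t : ℝ≥0) :
    0 < Mexp r m s ν ν t ω := by
  have hset : MeasurableSet {w : Pos | V t ω < w} :=
    measurableSet_lt measurable_const measurable_subtype_coe
  have hV : V t ω < W (count t ω) ω := by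
    have := (bracket_count (hex t)).2
    rw [T_succ] at this
    rw [V]
    linarith
  have hne := measure_tail_ne_zero (hω _) hV
  refine mul_pos (Real.exp_pos _) (div_pos ?_ ?_)
  · refine (setIntegral_pos_iff_support_of_nonneg_ae (ae_of_all _ fun w => (Real.exp_pos _).le)
      (integrable_exp_neg_mul ν hs).integrableOn).2 ?_
    have : Function.support (fun w : Pos => Real.exp (-s * w)) = Set.univ :=
      Set.eq_univ_of_forall fun w => (Real.exp_pos _).ne'
    rw [this, Set.univ_inter]
    exact pos_iff_ne_zero.2 hne
  · rw [one_sub_distr, measureReal_def]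
    exact ENNReal.toReal_pos hne (measure_ne_top _ _)

theorem Mexp_eq_schmidliL {r m c k u : ℝ} (hm : 0 < m) (ν : Measure Pos) (t : ℝ≥0)
    (ω : Omega D) : Mexp r m (k + c * r) ν ν t ω = schmidliL r m c k u ν t ω := by
  have hT : T (count t ω) ω = t - V t ω := by rw [V]; ring
  have he : r * S t ω - (k + c * r) * T (count t ω) ω =
      (-r * (reserve u c t ω - u)) + (-k * t) + (k + c * r) * V t ω := by
    rw [hT, reserve]; ring
  rw [Mexp, schmidliL, Real.exp_add, he, Real.exp_log hm, Real.exp_add, Real.exp_add]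
  ring

end Formulas

/-! ### Progressive densities of the mixtures, uniqueness of the pair, and explicit formulas almost
surely. -/

section ChangeOfMeasure

variable {D : Type*} [MeasurableSpace D]

theorem isProgDensity_condP (K L : Kernel D Pos) [IsMarkovKernel K] [IsMarkovKernel L]
    (R : Measure Pos) [IsProbabilityMeasure R] {γ : Pos → ℝ} (hγ : Measurable γ)
    [IsProbabilityMeasure (expTilt R γ)] {θ : D} (h : L θ ≪ K θ) :
    IsProgDensity (condP K R θ) (condP L (expTilt R γ) θ) (Mtilde K L γ θ) :=
  isProgDensity_of_lintegral (fun t => (measurable_Mtilde K L hγ t θ).mono ((F D).le t) le_rfl)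
    (fun t => ae_of_all _ (Mtilde_nonneg K L γ θ t))
    fun t _ hA => condP_apply_eq K L R hγ h t hA

theorem measurable_Mmix (K L : Kernel D Pos) [IsMarkovKernel K] [IsMarkovKernel L] {γ : Pos → ℝ}
    (hγ : Measurable γ) {ξ : D → ℝ} (hξ : Measurable ξ) (t : ℝ≥0) :
    Measurable[F D t] (Mmix K L γ ξ t) :=
  Measurable.mul (hξ.comp (measurable_Theta_F t))
    (measurable_Mtilde_comp K L hγ t (measurable_Theta_F t))

section

variable {μ : Measure D} {K : Kernel D Pos} [IsMarkovKernel K]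
  {R : Measure Pos} [IsProbabilityMeasure R]

theorem memRPlus_mixP_iff {ξ : D → ℝ} : MemRPlus (mixP μ K R) ξ ↔
    Measurable ξ ∧ (∀ᵐ θ ∂μ, 0 < ξ θ) ∧ ∫ θ, ξ θ ∂μ = 1 := by
  rw [MemRPlus, mixP_map_Theta]
  refine and_congr_right fun hξ => ?_
  have h := integral_map (measurable_Theta (D := D)).aemeasurable (μ := mixP μ K R)
    hξ.aestronglyMeasurable
  rw [mixP_map_Theta] at h
  rw [h]

theorem memFPln_mixP_iff [IsProbabilityMeasure μ] {γ : Pos → ℝ} : MemFPln (mixP μ K R) γ ↔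
    Measurable γ ∧ ∫ x, Real.exp (γ x) ∂(R) = 1 := by
  refine and_congr_right fun hγ => ?_
  have h := integral_map (measurable_X (D := D) 0).aemeasurable (μ := mixP μ K R)
    (Real.measurable_exp.comp hγ).aestronglyMeasurable
  rw [mixP_map_X] at h
  simp only [Function.comp] at h
  rw [h]

theorem MemRPlus.isProbabilityMeasure {ξ : D → ℝ} (h : MemRPlus (mixP μ K R) ξ) :
    IsProbabilityMeasure (μ.withDensity fun θ => ENNReal.ofReal (ξ θ)) := by
  obtain ⟨-, h1, h2⟩ := memRPlus_mixP_iff.1 h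
  exact isProbabilityMeasure_withDensity_ofReal (h1.mono fun _ h => h.le) h2

theorem MemFPln.isProbabilityMeasure [IsProbabilityMeasure μ] {γ : Pos → ℝ}
    (h : MemFPln (mixP μ K R) γ) :
    IsProbabilityMeasure (expTilt R γ) :=
  isProbabilityMeasure_withDensity_ofReal (ae_of_all _ fun _ => (Real.exp_pos _).le)
    (memFPln_mixP_iff.1 h).2

theorem isProgDensity_mixP [IsProbabilityMeasure μ] {L : Kernel D Pos} [IsMarkovKernel L]
    (hL : ∀ᵐ θ ∂μ, L θ ≪ K θ)
    {γ : Pos → ℝ} (hγ : Measurable γ) [IsProbabilityMeasure (expTilt R γ)] {ξ : D → ℝ}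
    (hξ : MemRPlus (mixP μ K R) ξ) :
    IsProgDensity (mixP μ K R)
      (mixP (μ.withDensity fun θ => ENNReal.ofReal (ξ θ)) L (expTilt R γ)) (Mmix K L γ ξ) := by
  obtain ⟨h0, h1, h2⟩ := memRPlus_mixP_iff.1 hξ
  have := hξ.isProbabilityMeasure
  refine isProgDensity_of_lintegral
    (fun t => (measurable_Mmix K L hγ h0 t).mono ((F D).le t) le_rfl) (fun t => ?_)
    fun t _ hA => mixP_apply_eq μ K L R hγ h0 hL t hA
  filter_upwards [ae_mixP_Theta μ K R h1] with ω hω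
  exact mul_nonneg hω.le (Mtilde_nonneg _ _ _ _ _ _)

/-- A probability measure with progressive density `Mmix` is a mixture of product measures. -/
theorem IsProgDensity.eq_mixP [IsProbabilityMeasure μ] {L : Kernel D Pos} [IsMarkovKernel L]
    (hL : ∀ᵐ θ ∂μ, L θ ≪ K θ)
    {γ : Pos → ℝ} (hγ : Measurable γ) [IsProbabilityMeasure (expTilt R γ)] {ξ : D → ℝ}
    (hξ : MemRPlus (mixP μ K R) ξ) {Q : Measure (Omega D)} [IsProbabilityMeasure Q]
    (hQ : IsProgDensity (mixP μ K R) Q (Mmix K L γ ξ)) :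
    Q = mixP (μ.withDensity fun θ => ENNReal.ofReal (ξ θ)) L (expTilt R γ) := by
  have := hξ.isProbabilityMeasure
  exact (eq_of_forall_F (ae_mixP_exists_lt_T _ L _) fun t A hA =>
    (isProgDensity_mixP hL hγ hξ).eq_of_measurableSet hQ t hA).symm

/-- Each pair represents `Q` as an explicit mixture. Comparing the laws of `X 0` and of `Θ` compares
`exp ∘ γ` and `ξ` as densities. -/
theorem ae_eq_of_isProgDensity [IsProbabilityMeasure μ] {L : Kernel D Pos} [IsMarkovKernel L]
    (hL : ∀ᵐ θ ∂μ, L θ ≪ K θ)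
    {γ γ' : Pos → ℝ} {ξ ξ' : D → ℝ} (hγ : MemFPln (mixP μ K R) γ) (hξ : MemRPlus (mixP μ K R) ξ)
    (hγ' : MemFPln (mixP μ K R) γ') (hξ' : MemRPlus (mixP μ K R) ξ') {Q : Measure (Omega D)}
    [IsProbabilityMeasure Q] (hQ : IsProgDensity (mixP μ K R) Q (Mmix K L γ ξ))
    (hQ' : IsProgDensity (mixP μ K R) Q (Mmix K L γ' ξ')) : γ' =ᵐ[R] γ ∧ ξ' =ᵐ[μ] ξ := by
  have := hγ.isProbabilityMeasure
  have := hγ'.isProbabilityMeasure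
  have := hξ.isProbabilityMeasure
  have := hξ'.isProbabilityMeasure
  have e := hQ.eq_mixP hL hγ.1 hξ
  have e' := hQ'.eq_mixP hL hγ'.1 hξ'
  constructor
  · have h : expTilt R γ' = expTilt R γ := by
      rw [← mixP_map_X (μ.withDensity fun θ => ENNReal.ofReal (ξ' θ)) L (expTilt R γ') 0, ← e', e,
        mixP_map_X]
    have h2 := (withDensity_eq_iff_of_sigmaFinite
      (Real.measurable_exp.comp hγ'.1).ennreal_ofReal.aemeasurable
      (Real.measurable_exp.comp hγ.1).ennreal_ofReal.aemeasurable).1 h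
    filter_upwards [h2] with x hx
    exact Real.exp_injective ((ENNReal.ofReal_eq_ofReal_iff (Real.exp_pos _).le
      (Real.exp_pos _).le).1 hx)
  · have h : (μ.withDensity fun θ => ENNReal.ofReal (ξ' θ)) =
        μ.withDensity fun θ => ENNReal.ofReal (ξ θ) := by
      rw [← mixP_map_Theta (μ.withDensity fun θ => ENNReal.ofReal (ξ' θ)) L (expTilt R γ'), ← e', e,
        mixP_map_Theta]
    have h2 := (withDensity_eq_iff_of_sigmaFinite hξ'.1.ennreal_ofReal.aemeasurable
      hξ.1.ennreal_ofReal.aemeasurable).1 h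
    filter_upwards [h2, (memRPlus_mixP_iff.1 hξ).2.1, (memRPlus_mixP_iff.1 hξ').2.1] with θ h3 h4 h5
    exact (ENNReal.ofReal_eq_ofReal_iff h5.le h4.le).1 h3

end

section Exponential

variable {K L : Kernel D Pos} [IsMarkovKernel K] [IsMarkovKernel L] {R : Measure Pos}
  [IsProbabilityMeasure R] {γ : Pos → ℝ} {r m : ℝ}

theorem ae_condP_Mtilde (hm : 0 < m) (hγ : ∀ x : Pos, γ x = r * x - Real.log m) {s : ℝ}
    (hs : 0 ≤ s) {θ : D} (hθ : L θ = lapTilt m s (K θ)) :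
    ∀ᵐ ω ∂(condP K R θ), ∀ t, Mtilde K L γ θ t ω = Mexp r m s (K θ) (K θ) t ω ∧
      0 < Mtilde K L γ θ t ω := by
  filter_upwards [ae_condP_forall_W K R θ (ae_rnDeriv_eq_of_lapTilt hm.le hθ),
    ae_condP_forall_W K R θ (ae_forall_rat_lt_measure_ne_zero (K θ)),
    ae_condP_exists_lt_T K R θ] with ω h1 h2 h3 t
  have h := Mtilde_eq_Mexp hm hγ hθ h1 t
  exact ⟨h, h ▸ Mexp_pos r m hs h3 h2 t⟩

/-- To obtain a single null set under the mixture, the exceptional conditions must be jointly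
measurable in `(θ, w)`. The tail condition is so because it ranges over rational levels. -/
theorem ae_mixP_Mtilde {μ : Measure D} (hm : 0 < m)
    (hγ : ∀ x : Pos, γ x = r * x - Real.log m) {s : D → ℝ} (hsm : Measurable s)
    (hs : ∀ θ, 0 ≤ s θ) (hL : ∀ᵐ θ ∂μ, L θ = lapTilt m (s θ) (K θ)) :
    ∀ᵐ ω ∂(mixP μ K R), ∀ t, Mtilde K L γ (Theta ω) t ω =
      Mexp r m (s (Theta ω)) (K (Theta ω)) (K (Theta ω)) t ω ∧
        0 < Mtilde K L γ (Theta ω) t ω := by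
  have hq1 : MeasurableSet {p : D × Pos | (Kernel.rnDeriv L K p.1 p.2).toReal =
      m * Real.exp (-s p.1 * p.2)} := by
    refine measurableSet_eq_fun (Kernel.measurable_rnDeriv L K).ennreal_toReal ?_
    fun_prop
  have hq2 : MeasurableSet {p : D × Pos | ∀ q : ℚ, (q : ℝ) < (p.2 : ℝ) →
      K p.1 {x : Pos | (q : ℝ) < x} ≠ 0} := by
    have : {p : D × Pos | ∀ q : ℚ, (q : ℝ) < (p.2 : ℝ) → K p.1 {x : Pos | (q : ℝ) < x} ≠ 0} =
        ⋂ q : ℚ, {p : D × Pos | (q : ℝ) < (p.2 : ℝ)}ᶜ ∪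
          {p : D × Pos | K p.1 {x : Pos | (q : ℝ) < x} = 0}ᶜ := by
      ext p
      simp [imp_iff_not_or]
    rw [this]
    refine MeasurableSet.iInter fun q => MeasurableSet.union ?_ ?_
    · exact (measurableSet_lt measurable_const (by fun_prop)).compl
    · have hx : MeasurableSet {x : Pos | (q : ℝ) < x} :=
        measurableSet_lt measurable_const measurable_subtype_coe
      exact (((K.measurable_coe hx).comp measurable_fst) (measurableSet_singleton 0)).compl
  filter_upwards [ae_mixP_forall_W μ K R hq1 (hL.mono fun θ h => ae_rnDeriv_eq_of_lapTilt hm.le h),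
    ae_mixP_forall_W μ K R hq2 (ae_of_all _ fun θ => ae_forall_rat_lt_measure_ne_zero (K θ)),
    ae_mixP_exists_lt_T μ K R, ae_mixP_Theta μ K R hL] with ω h1 h2 h3 h4 t
  have h := Mtilde_eq_Mexp hm hγ h4 h1 t
  exact ⟨h, h ▸ Mexp_pos r m (hs _) h3 h2 t⟩

end Exponential

theorem measurable_V_F (t : ℝ≥0) : Measurable[F D t] (V t : Omega D → ℝ) := by
  have h1 : Measurable[F D t] (count t : Omega D → ℕ) :=
    (measurable_count_sigmaS t).mono (sigmaS_le_F t) le_rfl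
  have h2 : Measurable fun p : ℕ × Omega D => (t : ℝ) - T p.1 p.2 :=
    measurable_from_prod_countable_right fun n => measurable_const.sub (measurable_T n)
  have h3 : (V t : Omega D → ℝ) = (fun p : ℕ × Omega D => (t : ℝ) - T p.1 p.2) ∘
      fun ω => (count t ω, observed t ω) := by
    funext ω
    have : T (count t ω) (observed t ω) = T (count t ω) ω := T_congr fun k hk => W_observed hk
    simp only [Function.comp, V, this]
  have h4 : Measurable[F D t] fun ω : Omega D => (count t ω, observed t ω) :=
    h1.prodMk (measurable_observed t)
  have h5 := h2.comp h4
  rw [h3]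
  exact h5

/-- The filtration is not completed, so adaptedness cannot be inherited from the a.s. equality with
`Mtilde`. It holds because the process is a function of `S t` and `V t`. -/
theorem measurable_schmidliL (r m c k u : ℝ) (ν : Measure Pos) [IsProbabilityMeasure ν] (t : ℝ≥0) :
    Measurable[F D t] (schmidliL r m c k u ν t : Omega D → ℝ) := by
  have hS : Measurable[F D t] (S t : Omega D → ℝ) :=
    (measurable_S_sigmaS le_rfl).mono (sigmaS_le_F t) le_rfl
  have htail : Measurable fun v : ℝ => ∫ w in {w : Pos | v < w}, Real.exp (-(k + c * r) * w) ∂ν := by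
    have hs : ∀ v : ℝ, MeasurableSet {w : Pos | v < w} := fun v =>
      measurableSet_lt measurable_const measurable_subtype_coe
    simp_rw [← fun v => integral_indicator (μ := ν) (f := fun w : Pos =>
      Real.exp (-(k + c * r) * w)) (hs v)]
    have hm : Measurable (({p : ℝ × Pos | p.1 < p.2}).indicator fun p : ℝ × Pos =>
        Real.exp (-(k + c * r) * p.2)) := by
      refine Measurable.indicator (by fun_prop) ?_
      exact measurableSet_lt measurable_fst (measurable_subtype_coe.comp measurable_snd)
    exact (hm.stronglyMeasurable.integral_prod_right (f := fun (v : ℝ) (w : Pos) =>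
      ({p : ℝ × Pos | p.1 < p.2}).indicator (fun p : ℝ × Pos =>
        Real.exp (-(k + c * r) * p.2)) (v, w))).measurable
  have hdistr : Measurable (distr ν) :=
    (measurable_distr (Kernel.const Unit ν)).comp (measurable_const (a := ()).prodMk measurable_id)
  have hfun : Measurable fun p : ℝ × ℝ =>
      Real.exp (-r * (u + c * t - p.1 - u)) * Real.exp (-k * t) * m *
        Real.exp ((k + c * r) * p.2) *
        (∫ w in {w : Pos | p.2 < w}, Real.exp (-(k + c * r) * w) ∂ν) / (1 - distr ν p.2) := by
    refine Measurable.div (Measurable.mul (by fun_prop) (htail.comp measurable_snd)) ?_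
    exact measurable_const.sub (hdistr.comp measurable_snd)
  have hSV : Measurable[F D t] fun ω : Omega D => (S t ω, V t ω) := hS.prodMk (measurable_V_F t)
  have h := hfun.comp hSV
  have heq : (schmidliL r m c k u ν t : Omega D → ℝ) = (fun p : ℝ × ℝ =>
      Real.exp (-r * (u + c * t - p.1 - u)) * Real.exp (-k * t) * m *
        Real.exp ((k + c * r) * p.2) *
        (∫ w in {w : Pos | p.2 < w}, Real.exp (-(k + c * r) * w) ∂ν) / (1 - distr ν p.2)) ∘
          fun ω => (S t ω, V t ω) := rfl
  rw [heq]
  exact h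

end ChangeOfMeasure

/-! ### Regular conditional probabilities: existence for mixtures and essential uniqueness. -/

section RegularConditionalProbability

/-- Consistency, applied to `C` and to its complement, shows that `Qy y` lives on the fibre set over
whichever of the two contains `y`. Hence the composition product of `Q.map f` with `Qy` is
determined by `Q` and `f`. -/
theorem IsRCP.setLIntegral {E Y : Type*} [MeasurableSpace E] [MeasurableSpace Y] {Q : Measure E}
    {f : E → Y} {Qy : Y → Measure E} (h : IsRCP Q f Qy) (hf : Measurable f) {A : Set E}
    (hA : MeasurableSet A) {C : Set Y} (hC : MeasurableSet C) :
    ∫⁻ y in C, Qy y A ∂(Q.map f) = Q (f ⁻¹' C ∩ A) := by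
  rw [← h.disintegrate _ ((hf hC).inter hA), ← lintegral_indicator hC]
  refine lintegral_congr_ae ?_
  filter_upwards [h.consistent C hC, h.consistent Cᶜ hC.compl] with y h1 h2
  have := h.isProb y
  by_cases hy : y ∈ C
  · rw [Set.indicator_of_mem hy]
    have h3 : (Qy y) (f ⁻¹' C)ᶜ = 0 := (prob_compl_eq_zero_iff (hf hC)).2 (h1 hy)
    rw [Set.inter_comm]
    exact (measure_inter_conull h3).symm
  · rw [Set.indicator_of_notMem hy]
    have h3 : (Qy y) (f ⁻¹' C)ᶜ = 1 := h2 hy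
    rw [prob_compl_eq_one_iff (hf hC)] at h3
    exact (measure_mono_null Set.inter_subset_left h3).symm

theorem IsRCP.ae_eq {E Y : Type*} [MeasurableSpace E] [MeasurableSpace Y]
    [MeasurableSpace.CountablyGenerated E] {Q : Measure E} [IsFiniteMeasure Q] {f : E → Y}
    {Qy Qy' : Y → Measure E} (h : IsRCP Q f Qy) (h' : IsRCP Q f Qy') (hf : Measurable f) :
    ∀ᵐ y ∂(Q.map f), Qy y = Qy' y := by
  let κ : Kernel Y E := ⟨Qy, Measure.measurable_of_measurable_coe _ h.measurable⟩
  let κ' : Kernel Y E := ⟨Qy', Measure.measurable_of_measurable_coe _ h'.measurable⟩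
  have : IsMarkovKernel κ := ⟨h.isProb⟩
  have : IsMarkovKernel κ' := ⟨h'.isProb⟩
  have hc : (Q.map f) ⊗ₘ κ = (Q.map f) ⊗ₘ κ' := by
    refine Measure.ext_prod fun {C A} hC hA => ?_
    rw [Measure.compProd_apply_prod hC hA, Measure.compProd_apply_prod hC hA]
    exact (h.setLIntegral hf hA hC).trans (h'.setLIntegral hf hA hC).symm
  exact Kernel.ae_eq_of_compProd_eq hc

theorem isRCP_mixP {D : Type*} [MeasurableSpace D] (ν : Measure D) (K : Kernel D Pos)
    [IsMarkovKernel K] (R : Measure Pos) [IsProbabilityMeasure R] :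
    IsRCP (mixP ν K R) Theta (condP K R) := by
  refine ⟨fun θ => inferInstance, fun A hA => measurable_condP_apply K R hA, fun A hA => ?_,
    fun B hB => ae_of_all _ fun θ hθ => ?_⟩
  · rw [mixP_map_Theta, mixP_apply _ _ _ hA]
  · have := condP_prod K R θ (A := Set.univ) (B := Set.univ) hB
    have h2 : (Theta ⁻¹' B : Set (Omega D)) = (Set.univ ×ˢ Set.univ) ×ˢ B := by
      ext ω; simp [Theta]
    rw [h2, this]
    simp [hθ]

end RegularConditionalProbability

/-! ### Identification of the root, the claim law and the mixing density. -/

section Main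

variable {D : Type*} [MeasurableSpace D]

theorem one_le_integral_exp_X {P : Measure (Omega D)} [IsProbabilityMeasure P] {r : ℝ} (hr : 0 ≤ r)
    (hX : Integrable (fun ω => Real.exp (r * X 0 ω)) P) : 1 ≤ ∫ ω, Real.exp (r * X 0 ω) ∂P := by
  have h := integral_mono (integrable_const (1 : ℝ)) hX fun ω =>
    Real.one_le_exp (mul_nonneg hr (X 0 ω).2.le)
  simpa using h

theorem isKappa_condP_iff (K : Kernel D Pos) [IsMarkovKernel K] (R : Measure Pos)
    [IsProbabilityMeasure R] (P : Measure (Omega D)) (r c k : ℝ) (θ : D) :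
    IsKappa P (condP K R θ) r c k ↔
      (∫ ω, Real.exp (r * X 0 ω) ∂P) * lap (K θ) (k + c * r) = 1 := by
  have h := integral_map (measurable_W (D := D) 0).aemeasurable (μ := condP K R θ)
    (measurable_exp_neg_mul (k + c * r)).aestronglyMeasurable
  rw [condP_map_W] at h
  rw [IsKappa, lap, h, mgf, mgf, neg_add, ← sub_eq_add_neg]

theorem kappa_condP_spec (K : Kernel D Pos) [IsMarkovKernel K] (R : Measure Pos)
    [IsProbabilityMeasure R] {P : Measure (Omega D)} {r : ℝ}
    (hm : 1 ≤ ∫ ω, Real.exp (r * X 0 ω) ∂P) (c : ℝ) (θ : D) :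
    IsKappa P (condP K R θ) r c (kappa P (condP K R θ) r c) := by
  obtain ⟨s, hs⟩ := exists_mul_lap_eq_one (K θ) hm
  exact Classical.epsilon_spec (p := fun k => IsKappa P (condP K R θ) r c k)
    ⟨s - c * r, (isKappa_condP_iff K R P r c _ θ).2 (by rwa [sub_add_cancel])⟩

theorem exp_gam {P : Measure (Omega D)} {r : ℝ} (hm : 0 < ∫ ω, Real.exp (r * X 0 ω) ∂P) (x : Pos) :
    Real.exp (gam P r x) = Real.exp (r * x) / ∫ ω, Real.exp (r * X 0 ω) ∂P := by
  rw [gam, Real.exp_sub, Real.exp_log hm]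

theorem measurable_gam (P : Measure (Omega D)) (r : ℝ) : Measurable (gam P r) := by
  unfold gam
  fun_prop

theorem memFPln_gam {P : Measure (Omega D)} {r : ℝ} (hm : 0 < ∫ ω, Real.exp (r * X 0 ω) ∂P) :
    MemFPln P (gam P r) := by
  refine ⟨measurable_gam P r, ?_⟩
  simp_rw [exp_gam hm]
  rw [integral_div, div_self hm.ne']

theorem isTiltedX_iff {μ : Measure D} [IsProbabilityMeasure μ] {K : Kernel D Pos} [IsMarkovKernel K]
    {R : Measure Pos} [IsProbabilityMeasure R] {Q : Measure (Omega D)} [IsProbabilityMeasure Q]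
    {r : ℝ} (hm : 0 < ∫ ω, Real.exp (r * X 0 ω) ∂(mixP μ K R)) :
    IsTiltedX (mixP μ K R) Q r ↔ Q.map (X 0) = expTilt R (gam (mixP μ K R) r) := by
  have := (memFPln_gam hm).isProbabilityMeasure
  have : IsProbabilityMeasure (Q.map (X 0)) :=
    Measure.isProbabilityMeasure_map (measurable_X 0).aemeasurable
  have key : ∀ B : Set Pos, MeasurableSet B → (expTilt R (gam (mixP μ K R) r)).real B =
      (∫ ω in X 0 ⁻¹' B, Real.exp (r * X 0 ω) ∂(mixP μ K R)) /
        ∫ ω, Real.exp (r * X 0 ω) ∂(mixP μ K R) := by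
    intro B hB
    have h1 := setIntegral_map (g := X 0) (μ := mixP μ K R) hB (f := fun x : Pos => Real.exp (r * x))
      (by fun_prop : Measurable fun x : Pos => Real.exp (r * x)).aestronglyMeasurable
      (measurable_X 0).aemeasurable
    rw [mixP_map_X] at h1
    rw [measureReal_def, withDensity_apply _ hB, ← integral_eq_lintegral_of_nonneg_ae
      (ae_of_all _ fun x => (Real.exp_pos _).le)
      (Real.measurable_exp.comp (measurable_gam _ r)).aestronglyMeasurable]
    simp_rw [exp_gam hm]
    rw [integral_div, h1]
  constructor
  · intro h
    refine Measure.ext fun B hB => ?_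
    have h1 := (h B hB).trans (key B hB).symm
    rw [← map_measureReal_apply (measurable_X 0) hB] at h1
    rwa [measureReal_def, measureReal_def, ENNReal.toReal_eq_toReal_iff' (measure_ne_top _ _)
      (measure_ne_top _ _)] at h1
  · intro h B hB
    rw [← key B hB, ← h, map_measureReal_apply (measurable_X 0) hB]

variable {μ : Measure D} [IsProbabilityMeasure μ] {K L : Kernel D Pos} [IsMarkovKernel K]
  [IsMarkovKernel L] {R : Measure Pos} [IsProbabilityMeasure R]

theorem ae_condDistrib_W_mixP (μ : Measure D) [IsProbabilityMeasure μ] (K : Kernel D Pos)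
    [IsMarkovKernel K] (R : Measure Pos) [IsProbabilityMeasure R] (k : ℕ) :
    ∀ᵐ ω ∂(mixP μ K R), condDistrib (W k) Theta (mixP μ K R) (Theta ω) = K (Theta ω) :=
  ae_of_ae_map measurable_Theta.aemeasurable (condDistrib_W_mixP μ K R k)

/-- A mixture of product measures whose density process is positive belongs to `MemM`. -/
theorem memM_mixP {ν : Measure D} [IsProbabilityMeasure ν] {R' : Measure Pos}
    [IsProbabilityMeasure R'] {P : Measure (Omega D)} [IsProbabilityMeasure P]
    {M : ℝ≥0 → Omega D → ℝ} (h : IsProgDensity P (mixP ν L R') M)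
    (h0 : ∀ t, ∀ᵐ ω ∂P, 0 < M t ω) : MemM P (mixP ν L R') L :=
  ⟨condA1_mixP ν L R', condA2_mixP ν L R', h.progEquiv h0, isCMRP_mixP ν L R'⟩

/-- The mixing laws of two progressively equivalent measures are related by a positive density. -/
theorem ProgEquiv.exists_memRPlus {Q : Measure (Omega D)} [IsProbabilityMeasure Q]
    (h : ProgEquiv Q (mixP μ K R)) : ∃ ξ : D → ℝ, MemRPlus (mixP μ K R) ξ ∧
      Q.map Theta = μ.withDensity fun θ => ENNReal.ofReal (ξ θ) := by
  have : IsProbabilityMeasure (Q.map Theta) :=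
    Measure.isProbabilityMeasure_map measurable_Theta.aemeasurable
  have hz : ∀ B, MeasurableSet B → (Q.map Theta B = 0 ↔ μ B = 0) := by
    intro B hB
    -- `Θ` is known at time `0`, so equivalence on `F D 0` already relates the mixing laws.
    have h1 := h 0 (Theta ⁻¹' B) (measurable_Theta_F 0 hB)
    rwa [← Measure.map_apply measurable_Theta hB, ← Measure.map_apply measurable_Theta hB,
      mixP_map_Theta] at h1
  have hac : Q.map Theta ≪ μ := Measure.AbsolutelyContinuous.mk fun B hB h1 => (hz B hB).2 h1
  have hac' : μ ≪ Q.map Theta := Measure.AbsolutelyContinuous.mk fun B hB h1 => (hz B hB).1 h1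
  refine ⟨fun θ => ((Q.map Theta).rnDeriv μ θ).toReal, memRPlus_mixP_iff.2 ⟨?_, ?_, ?_⟩, ?_⟩
  · exact (Measure.measurable_rnDeriv _ _).ennreal_toReal
  · filter_upwards [Measure.rnDeriv_pos' hac', Measure.rnDeriv_lt_top (Q.map Theta) μ] with θ h1 h2
    exact ENNReal.toReal_pos h1.ne' h2.ne
  · rw [Measure.integral_toReal_rnDeriv hac]
    simp
  · conv_lhs => rw [← Measure.withDensity_rnDeriv_eq _ _ hac]
    refine withDensity_congr_ae ?_
    filter_upwards [Measure.rnDeriv_lt_top (Q.map Theta) μ] with θ h2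
    rw [ENNReal.ofReal_toReal h2.ne]

end Main

end CMRP

/-! ### Assembly of the theorem. -/

theorem mainTheorem8 {d l : ℕ} {D : Set (Fin d → ℝ)}
    -- the canonical model
    (μ : Measure D) [IsProbabilityMeasure μ]
    (K : Kernel D Pos) [IsMarkovKernel K]
    (R : Measure Pos) [IsProbabilityMeasure R]
    (P : Measure (Omega D)) [IsProbabilityMeasure P] (hP : P = mixP μ K R)
    (Pθ : D → Measure (Omega D)) (hPθ : Pθ = condP K R)
    -- the premium rate
    (c : D → ℝ) (hc : Measurable c) (hc0 : ∀ θ, 0 < c θ)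
    (r : ℝ) (hr : 0 ≤ r) (hX : Integrable (fun ω => Real.exp (r * X 0 ω)) P)
    (m : ℝ) (hm : m = ∫ ω, Real.exp (r * X 0 ω) ∂P)
    (κ : D → ℝ) (hκ : κ = fun θ => kappa P (Pθ θ) r (c θ))
    (s : D → ℝ) (hs : s = fun θ => κ θ + c θ * r)
    -- the new interarrival laws `Λ(ρ(θ))`
    (ρ : D → (Fin l → ℝ)) (hρ : Measurable ρ)
    (Λ : Kernel (Fin l → ℝ) Pos) [IsMarkovKernel Λ]
    (hΛ : IsTiltedW P s (Λ.comap ρ hρ)) :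
    -- `κ_θ(r)` is well defined
    (∀ θ, IsKappa P (Pθ θ) r (c θ) (κ θ) ∧ ∀ k, IsKappa P (Pθ θ) r (c θ) k → k = κ θ) ∧
    -- (i)
    (∀ (Q : Measure (Omega D)) [IsProbabilityMeasure Q],
      MemM P Q (Λ.comap ρ hρ) → IsTiltedX P Q r →
      MemFPln P (gam P r) ∧
      ∃ ξ : D → ℝ, MemRPlus P ξ ∧
        Q.map Theta = (P.map Theta).withDensity (fun θ => ENNReal.ofReal (ξ θ)) ∧
        IsProgDensity P Q (Mmix K (Λ.comap ρ hρ) (gam P r) ξ) ∧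
        IsPosMartingale P (Mmix K (Λ.comap ρ hρ) (gam P r) ξ) ∧
        (∀ᵐ ω ∂P, ∀ t, Mmix K (Λ.comap ρ hρ) (gam P r) ξ t ω =
          ξ (Theta ω) * Mexp r m (s (Theta ω)) (condDistrib (W 0) Theta P (Theta ω))
            (K (Theta ω)) t ω) ∧
        ∀ (γ' : Pos → ℝ) (ξ' : D → ℝ), MemFPln P γ' → MemRPlus P ξ' →
          IsProgDensity P Q (Mmix K (Λ.comap ρ hρ) γ' ξ') →
          γ' =ᵐ[P.map (X 0)] gam P r ∧ ξ' =ᵐ[P.map Theta] ξ) ∧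
    -- (ii)
    (∀ ξ : D → ℝ, MemRPlus P ξ →
      MemFPln P (gam P r) ∧
      (∃ (Q : Measure (Omega D)) (_ : IsProbabilityMeasure Q),
        MemM P Q (Λ.comap ρ hρ) ∧ IsTiltedX P Q r ∧
        Q.map Theta = (P.map Theta).withDensity (fun θ => ENNReal.ofReal (ξ θ)) ∧
        IsProgDensity P Q (Mmix K (Λ.comap ρ hρ) (gam P r) ξ) ∧
        ∀ (Q' : Measure (Omega D)) [IsProbabilityMeasure Q'],
          IsProgDensity P Q' (Mmix K (Λ.comap ρ hρ) (gam P r) ξ) → Q' = Q) ∧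
      IsPosMartingale P (Mmix K (Λ.comap ρ hρ) (gam P r) ξ) ∧
      (∀ᵐ ω ∂P, ∀ t, Mmix K (Λ.comap ρ hρ) (gam P r) ξ t ω =
        ξ (Theta ω) * Mexp r m (s (Theta ω)) (condDistrib (W 0) Theta P (Theta ω))
          (K (Theta ω)) t ω)) ∧
    -- (iii) and Schmidli's martingale `L^r(θ)`
    (∀ (Q : Measure (Omega D)) [IsProbabilityMeasure Q] (ξ : D → ℝ),
      MemM P Q (Λ.comap ρ hρ) → MemRPlus P ξ →
      IsProgDensity P Q (Mmix K (Λ.comap ρ hρ) (gam P r) ξ) →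
      ∃ Qθ : D → Measure (Omega D), IsRCP Q Theta Qθ ∧
        (∀ Qθ' : D → Measure (Omega D), IsRCP Q Theta Qθ' → ∀ᵐ θ ∂(Q.map Theta), Qθ' θ = Qθ θ) ∧
        ∃ N₀ : Set D, MeasurableSet N₀ ∧ P.map Theta N₀ = 0 ∧ ∀ θ, θ ∉ N₀ →
          MemMTheta (Pθ θ) (Qθ θ) (Λ (ρ θ)) ∧
          IsProgDensity (Pθ θ) (Qθ θ) (Mtilde K (Λ.comap ρ hρ) (gam P r) θ) ∧
          IsPosMartingale (Pθ θ) (Mtilde K (Λ.comap ρ hρ) (gam P r) θ) ∧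
          (∀ᵐ ω ∂(Pθ θ), ∀ t, Mtilde K (Λ.comap ρ hρ) (gam P r) θ t ω =
            Mexp r m (s θ) ((Pθ θ).map (W 0)) (K θ) t ω) ∧
          (P.map (fun ω => (W 0 ω : ℝ)) ≪ volume → ∀ u : ℝ, 0 < u →
            IsPosMartingale (Pθ θ) (schmidliL r m (c θ) (κ θ) u ((Pθ θ).map (W 0))) ∧
            ∀ᵐ ω ∂(Pθ θ), ∀ t, Mtilde K (Λ.comap ρ hρ) (gam P r) θ t ω =
              schmidliL r m (c θ) (κ θ) u ((Pθ θ).map (W 0)) t ω)) ∧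
    -- the mixed version of Schmidli's martingale
    (P.map (fun ω => (W 0 ω : ℝ)) ≪ volume → ∀ ξ : D → ℝ, MemRPlus P ξ → ∀ u : ℝ, 0 < u →
      ∀ᵐ ω ∂P, ∀ t, Mmix K (Λ.comap ρ hρ) (gam P r) ξ t ω =
        ξ (Theta ω) * schmidliL r m (c (Theta ω)) (κ (Theta ω)) u
          ((Pθ (Theta ω)).map (W 0)) t ω) := by
  subst hP hPθ hm hκ hs
  set P := mixP μ K R with hP
  set m := ∫ ω, Real.exp (r * X 0 ω) ∂P with hmdef
  set κ : D → ℝ := fun θ => kappa P (condP K R θ) r (c θ) with hκ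
  set s : D → ℝ := fun θ => κ θ + c θ * r with hsdef
  set L : Kernel D Pos := Λ.comap ρ hρ with hLdef
  set γ := gam P r with hγdef
  have hm1 : 1 ≤ m := one_le_integral_exp_X hr hX
  have hm0 : 0 < m := one_pos.trans_le hm1
  have hκs : ∀ θ, IsKappa P (condP K R θ) r (c θ) (κ θ) := fun θ =>
    kappa_condP_spec K R hm1 (c θ) θ
  have hlap : ∀ θ, m * lap (K θ) (s θ) = 1 := fun θ => (isKappa_condP_iff K R P r (c θ) _ θ).1 (hκs θ)
  have hs0 : ∀ θ, 0 ≤ s θ := fun θ => nonneg_of_mul_lap_eq_one (K θ) hm1 (hlap θ)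
  have hsm : Measurable s := measurable_of_mul_lap_eq_one K hm1 hlap
  have hL : ∀ᵐ θ ∂μ, L θ = lapTilt m (s θ) (K θ) := ae_eq_lapTilt hm1 hlap hΛ
  have hLac : ∀ᵐ θ ∂μ, L θ ≪ K θ := hL.mono fun θ h => h ▸ absolutelyContinuous_lapTilt _ _ _
  have hγ : ∀ x : Pos, γ x = r * x - Real.log m := fun x => rfl
  have hγm : MemFPln P γ := memFPln_gam hm0
  have hR' : IsProbabilityMeasure (expTilt R γ) := hγm.isProbabilityMeasure
  have hPΘ : P.map Theta = μ := mixP_map_Theta μ K R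
  have hmix := ae_mixP_Mtilde (R := R) hm0 hγ hsm hs0 hL
  have hpos : ∀ ξ, MemRPlus P ξ → ∀ t, ∀ᵐ ω ∂P, 0 < Mmix K L γ ξ t ω := by
    intro ξ hξ t
    filter_upwards [hmix, ae_mixP_Theta μ K R (memRPlus_mixP_iff.1 hξ).2.1] with ω h1 h2
    exact mul_pos h2 (h1 t).2
  have hform : ∀ ξ : D → ℝ, ∀ᵐ ω ∂P, ∀ t, Mmix K L γ ξ t ω = ξ (Theta ω) * Mexp r m (s (Theta ω))
      (condDistrib (W 0) Theta P (Theta ω)) (K (Theta ω)) t ω := by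
    intro ξ
    filter_upwards [hmix, ae_condDistrib_W_mixP μ K R 0] with ω h1 h2 t
    rw [h2, Mmix, (h1 t).1]
  have hden : ∀ ξ, MemRPlus P ξ → IsProgDensity P
      (mixP (μ.withDensity fun θ => ENNReal.ofReal (ξ θ)) L (expTilt R γ)) (Mmix K L γ ξ) :=
    fun ξ hξ => isProgDensity_mixP hLac hγm.1 hξ
  have hmart : ∀ ξ, MemRPlus P ξ → IsPosMartingale P (Mmix K L γ ξ) := by
    intro ξ hξ
    have := hξ.isProbabilityMeasure
    exact (hden ξ hξ).isPosMartingale (measurable_Mmix K L hγm.1 hξ.1) (hpos ξ hξ)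
  refine ⟨fun θ => ⟨hκs θ, fun k hk => ?_⟩, ?_, ?_, ?_, ?_⟩
  · have := eq_of_mul_lap_eq_one (K θ) hm1 ((isKappa_condP_iff K R P r (c θ) k θ).1 hk) (hlap θ)
    exact add_right_cancel this
  · intro Q _ hQ hQX
    obtain ⟨ξ, hξ, hQξ⟩ := hQ.progEquiv.exists_memRPlus
    -- The structural conditions and the claim law pin `Q` down as a mixture, so its density is the
    -- one computed for mixtures.
    have hQeq := eq_mixP hQ.a1 hQ.a2 hQ.isCMRP ((isTiltedX_iff hm0).1 hQX)
    rw [hQξ] at hQeq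
    have hQd : IsProgDensity P Q (Mmix K L γ ξ) := by
      rw [hQeq]; exact hden ξ hξ
    refine ⟨hγm, ξ, hξ, by rw [hPΘ]; exact hQξ, hQd, hmart ξ hξ, hform ξ, ?_⟩
    intro γ' ξ' hγ' hξ' hQd'
    rw [hPΘ, mixP_map_X]
    exact ae_eq_of_isProgDensity hLac hγm hξ hγ' hξ' hQd hQd'
  · intro ξ hξ
    have := hξ.isProbabilityMeasure
    refine ⟨hγm, ⟨mixP (μ.withDensity fun θ => ENNReal.ofReal (ξ θ)) L (expTilt R γ), inferInstance,
      memM_mixP (hden ξ hξ) (hpos ξ hξ), (isTiltedX_iff hm0).2 (mixP_map_X _ _ _ 0), ?_, hden ξ hξ,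
      fun Q' _ hQ' => hQ'.eq_mixP hLac hγm.1 hξ⟩, hmart ξ hξ, hform ξ⟩
    rw [hPΘ, mixP_map_Theta]
  · intro Q _ ξ _ hξ hQd
    have := hξ.isProbabilityMeasure
    have hQeq := hQd.eq_mixP hLac hγm.1 hξ
    have hrcp : IsRCP Q Theta (condP L (expTilt R γ)) := by
      rw [hQeq]; exact isRCP_mixP _ _ _
    -- The exceptional set is a measurable hull of the parameters where the tilting identity fails.
    -- Off it, every claim follows from `L θ = lapTilt m (s θ) (K θ)`.
    refine ⟨condP L (expTilt R γ), hrcp, fun Qθ' h' => h'.ae_eq hrcp measurable_Theta,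
      toMeasurable μ {θ | ¬ L θ = lapTilt m (s θ) (K θ)}, measurableSet_toMeasurable _ _, ?_, ?_⟩
    · rw [hPΘ, measure_toMeasurable]
      exact hL
    intro θ hθ
    have hLθ : L θ = lapTilt m (s θ) (K θ) := by
      by_contra h
      exact hθ (subset_toMeasurable _ _ h)
    have hdθ := isProgDensity_condP K L R hγm.1 (hLθ ▸ absolutelyContinuous_lapTilt _ _ _ : L θ ≪ K θ)
    have hae := ae_condP_Mtilde (R := R) hm0 hγ (hs0 θ) hLθ
    have hpθ : ∀ t, ∀ᵐ ω ∂(condP K R θ), 0 < Mtilde K L γ θ t ω := fun t =>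
      hae.mono fun ω h => (h t).2
    have hsch : ∀ u, ∀ᵐ ω ∂(condP K R θ), ∀ t, Mtilde K L γ θ t ω =
        schmidliL r m (c θ) (κ θ) u ((condP K R θ).map (W 0)) t ω := by
      intro u
      filter_upwards [hae] with ω h t
      rw [condP_map_W, (h t).1, Mexp_eq_schmidliL hm0]
    refine ⟨⟨inferInstance, hdθ.progEquiv hpθ, isCRP_condP L (expTilt R γ) θ⟩, hdθ,
      hdθ.isPosMartingale (fun t => measurable_Mtilde K L hγm.1 t θ) hpθ, ?_,
      fun _ u _ => ⟨?_, hsch u⟩⟩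
    · filter_upwards [hae] with ω h t
      rw [condP_map_W, (h t).1]
    -- Schmidli's process is another version of the density of the tilted measure, hence itself a
    -- martingale once adapted.
    · refine (hdθ.congr_ae fun t => (hsch u).mono fun ω h => h t).isPosMartingale
        (fun t => ?_) fun t => ?_
      · rw [condP_map_W]
        exact measurable_schmidliL _ _ _ _ _ _ t
      · filter_upwards [hsch u, hpθ t] with ω h1 h2
        exact h1 t ▸ h2
  · intro _ ξ _ u _
    filter_upwards [hmix] with ω h t
    rw [condP_map_W, Mmix, (h t).1, Mexp_eq_schmidliL hm0]
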